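/- Let $(\Omega,\Sigma,P)$ be a nonatomic probability space, i.e. every $A\in\Sigma$ with $P(A)>0$ contains some $B\in\Sigma$ with $0<P(B)<P(A)$. Let $\mathfrak A$ be the family of all finite algebras of sets contained in $\Sigma$. Every $\mathcal A\in\mathfrak A$ is generated by the partition of $\Omega$ into its atoms (its minimal nonempty members) $A_1,\dots,A_n$, and we then write $\mathcal A=\langle A_1,\dots,A_n\rangle$. (If $A\in\{\emptyset,\Omega\}$, then $\langle A,\Omega\setminus A\rangle$ denotes the trivial algebra.) An *additive partition entropy* is a function $I:\mathfrak A\to\mathbb R$ such that $I(\sigma(\mathcal A\cup\mathcal B))=I(\mathcal A)+I(\mathcal B)$ whenever $\mathcal A,\mathcal B\in\mathfrak A$ are independent, where $\sigma(\mathcal A\cup\mathcal B)$ is the algebra generated by $\mathcal A\cup\mathcal B$. A function $I:\mathfrak A\to\mathbb R$ is *continuous on $\mathfrak A_2$* if for all $A,B_1,B_2,\ldots\in\Sigma$ with $0<P(A)<1$ and $P(A\vartriangle B_k)\to0$ one has $I(\langle B_k,\Omega\setminus B_k\rangle)\to I(\langle A,\Omega\setminus A\rangle)$. It is *continuous* if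 it is continuous with respect to the pseudometric $$D(\mathcal A,\mathcal B)=\inf\{P(Z): Z\in\Sigma,\ \{A\setminus Z: A\in\mathcal A\}=\{B\setminus Z: B\in\mathcal B\}\}+|N(\mathcal A)-N(\mathcal B)|$$ on $\mathfrak A$, where $N(\mathcal A)$ is the number of atoms of $\mathcal A$ of nonzero probability. A (classical) *additive entropy* is a real function $H$ of the finite sequences $p=(p_1,\dots,p_n)$, $n\ge1$, with $p_i\ge0$ and $\sum_i p_i=1$, that is symmetric (independent of the order of the $p_i$) and satisfies $H(p\otimes q)=H(p)+H(q)$ for all such $p,q$, where $p\otimes q$ is the sequence of all products $p_iq_j$ in lexicographic order of $(i,j)$. For such $H$ put $$H_P(\langle A_1,\dots,A_n\rangle)=H(P(A_1),\dots,P(A_n)).$$ A countably additive set function $\mathfrak m:\Sigma\to\mathbb R$ is *absolutely continuous* with respect to $P$ if for every $\varepsilon>0$ there is $\delta>0$ such that $|\mathfrak m(A)|<\varepsilon$ for all $A\in\Sigma$ with $P(A)<\delta$. For such $\mathfrak m$ put $$L_{\mathfrak m}(\langle A_1,\dots,A_n\rangle)=\sum_{i=1}^n\mathfrak m(A_i)\log_2\frac1{P(A_i)},$$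 where terms with $P(A_i)=0$ (for which $\mathfrak m(A_i)=0$) are $0$. **Theorem.** Let $I$ be an additive partition entropy that is continuous on $\mathfrak A_2$. 1. There is exactly one pair $(H,\mathfrak m)$ consisting of an additive entropy $H$ and a countably additive set function $\mathfrak m:\Sigma\to\mathbb R$ absolutely continuous with respect to $P$ with $\mathfrak m(\Omega)=0$ such that $I=H_P+L_{\mathfrak m}$. 2. For every additive entropy $H$ and every countably additive $\mathfrak m:\Sigma\to\mathbb R$ absolutely continuous with respect to $P$ such that $I=H_P+L_{\mathfrak m}$, both $H_P$ and $L_{\mathfrak m}$ are additive partition entropies, and $L_{\mathfrak m}$ is continuous. If moreover $I$ is continuous, then $H_P$ is continuous, and $H$ is continuous in the open domain, i.e. for every $n$ the restriction of $H$ to $\{(p_1,\dots,p_n): p_i>0,\ \sum_i p_i=1\}$ is continuous. -/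

import Mathlib

open MeasureTheory

/-- A probability space is nonatomic if every event of positive probability contains an event
of strictly smaller positive probability. -/
def IsNonatomic {Ω : Type*} [MeasurableSpace Ω] (P : Measure Ω) : Prop :=
  ∀ A : Set Ω, MeasurableSet A → 0 < P A →
    ∃ B : Set Ω, MeasurableSet B ∧ B ⊆ A ∧ 0 < P B ∧ P B < P A

/-- The family `𝔄` of all finite algebras of sets contained in the given `σ`-algebra. -/
@[ext] structure FiniteSubalgebra (Ω : Type*) [MeasurableSpace Ω] where
  /-- the underlying algebra of sets -/
  alg : BooleanSubalgebra (Set Ω)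
  finite : (alg : Set (Set Ω)).Finite
  measurable : ∀ A ∈ alg, MeasurableSet A

/-- The algebra of sets generated by a finite family is finite. -/
theorem finite_booleanClosure {Ω : Type*} {G : Set (Set Ω)} (hG : G.Finite) :
    ((BooleanSubalgebra.closure G : BooleanSubalgebra (Set Ω)) : Set (Set Ω)).Finite := by
  classical
  have : Finite G := hG
  let f : Ω → G → Prop := fun x s => x ∈ s.1
  let L : BooleanSubalgebra (Set Ω) :=
    { carrier := Set.range (fun T : Set (G → Prop) => f ⁻¹' T)
      supClosed' := by
        rintro _ ⟨S, rfl⟩ _ ⟨T, rfl⟩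
        exact ⟨S ∪ T, rfl⟩
      infClosed' := by
        rintro _ ⟨S, rfl⟩ _ ⟨T, rfl⟩
        exact ⟨S ∩ T, rfl⟩
      compl_mem' := by
        rintro _ ⟨S, rfl⟩
        exact ⟨Sᶜ, rfl⟩
      bot_mem' := ⟨∅, rfl⟩ }
  have hL : BooleanSubalgebra.closure G ≤ L := by
    rw [BooleanSubalgebra.closure_le]
    intro s hs
    exact ⟨{u | u ⟨s, hs⟩}, rfl⟩
  exact (Set.finite_range (fun T : Set (G → Prop) => f ⁻¹' T)).subset hL

/-- The algebra of sets generated by a family of measurable sets consists of measurable sets. -/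
theorem measurable_booleanClosure {Ω : Type*} [MeasurableSpace Ω] {G : Set (Set Ω)}
    (hG : ∀ A ∈ G, MeasurableSet A) : ∀ A ∈ BooleanSubalgebra.closure G, MeasurableSet A := by
  let L : BooleanSubalgebra (Set Ω) :=
    { carrier := {A | MeasurableSet A}
      supClosed' := fun _ hA _ hB => MeasurableSet.union hA hB
      infClosed' := fun _ hA _ hB => MeasurableSet.inter hA hB
      compl_mem' := fun hA => MeasurableSet.compl hA
      bot_mem' := MeasurableSet.empty }
  have hL : BooleanSubalgebra.closure G ≤ L := by
    rw [BooleanSubalgebra.closure_le]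
    exact hG
  exact fun A hA => hL hA

namespace FiniteSubalgebra

variable {Ω : Type*} [MeasurableSpace Ω]

/-- `σ(G)`: the smallest algebra of sets containing the finite family `G` of events. -/
def generate (G : Set (Set Ω)) (hfin : G.Finite) (hmeas : ∀ A ∈ G, MeasurableSet A) :
    FiniteSubalgebra Ω where
  alg := BooleanSubalgebra.closure G
  finite := finite_booleanClosure hfin
  measurable := measurable_booleanClosure hmeas

/-- `σ(𝒜 ∪ ℬ)`. -/
def join (𝒜 ℬ : FiniteSubalgebra Ω) : FiniteSubalgebra Ω :=
  generate ((𝒜.alg : Set (Set Ω)) ∪ (ℬ.alg : Set (Set Ω))) (𝒜.finite.union ℬ.finite)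
    (fun A hA => hA.elim (𝒜.measurable A) (ℬ.measurable A))

/-- `⟨A, Ω \ A⟩`: the algebra generated by the partition of `Ω` into `A` and its complement. -/
def twoAtom (A : Set Ω) (hA : MeasurableSet A) : FiniteSubalgebra Ω :=
  generate {A, Aᶜ} (Set.toFinite _) (by
    rintro B (rfl | rfl)
    · exact hA
    · exact hA.compl)

/-- The atoms of an algebra: its minimal nonempty members. -/
noncomputable def atoms (𝒜 : FiniteSubalgebra Ω) : Finset (Set Ω) :=
  (𝒜.finite.subset (t := {A | Minimal (fun B : Set Ω => B ∈ 𝒜.alg ∧ B ≠ ∅) A})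
    (fun _ hA => hA.1.1)).toFinset

theorem mem_atoms {𝒜 : FiniteSubalgebra Ω} {A : Set Ω} :
    A ∈ 𝒜.atoms ↔ Minimal (fun B : Set Ω => B ∈ 𝒜.alg ∧ B ≠ ∅) A := by
  simp [atoms]

theorem measurableSet_of_mem_atoms {𝒜 : FiniteSubalgebra Ω} {A : Set Ω} (hA : A ∈ 𝒜.atoms) :
    MeasurableSet A :=
  𝒜.measurable A (mem_atoms.1 hA).prop.1

theorem pairwiseDisjoint_atoms (𝒜 : FiniteSubalgebra Ω) :
    (𝒜.atoms : Set (Set Ω)).PairwiseDisjoint id := by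
  intro A hA B hB hAB
  rw [Finset.mem_coe, mem_atoms] at hA hB
  by_contra h
  have hne : A ∩ B ≠ ∅ := fun h' => h (Set.disjoint_iff_inter_eq_empty.2 h')
  have hmem : A ∩ B ∈ 𝒜.alg := BooleanSubalgebra.inf_mem hA.prop.1 hB.prop.1
  have h1 : A ⊆ A ∩ B := hA.le_of_le ⟨hmem, hne⟩ Set.inter_subset_left
  have h2 : B ⊆ A ∩ B := hB.le_of_le ⟨hmem, hne⟩ Set.inter_subset_right
  exact hAB (Set.Subset.antisymm (h1.trans Set.inter_subset_right)
    (h2.trans Set.inter_subset_left))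

theorem exists_mem_atoms (𝒜 : FiniteSubalgebra Ω) (x : Ω) : ∃ A ∈ 𝒜.atoms, x ∈ A := by
  have hfin : {B : Set Ω | B ∈ 𝒜.alg ∧ x ∈ B}.Finite := 𝒜.finite.subset (fun _ h => h.1)
  obtain ⟨M, hM⟩ := hfin.exists_minimal ⟨Set.univ, BooleanSubalgebra.top_mem, Set.mem_univ x⟩
  have hM1 : M ∈ 𝒜.alg ∧ x ∈ M := hM.prop
  refine ⟨M, mem_atoms.2 ⟨⟨hM1.1, fun h => ?_⟩, ?_⟩, hM1.2⟩
  · have hx := hM1.2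
    rw [h] at hx
    exact hx
  · rintro B ⟨hB, hBne⟩ hBM
    by_cases hx : x ∈ B
    · exact hM.le_of_le ⟨hB, hx⟩ hBM
    · exfalso
      have h : M ⊆ M \ B :=
        hM.le_of_le ⟨BooleanSubalgebra.sdiff_mem hM1.1 hB, hM1.2, hx⟩ Set.sdiff_subset
      exact hBne (Set.eq_empty_of_forall_notMem fun y hy => (h (hBM hy)).2 hy)

theorem sum_atoms (P : Measure Ω) [IsProbabilityMeasure P] (𝒜 : FiniteSubalgebra Ω) :
    ∑ A ∈ 𝒜.atoms, P.real A = 1 := by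
  have h := measureReal_biUnion_finset (μ := P) (s := 𝒜.atoms) (f := id)
    𝒜.pairwiseDisjoint_atoms (fun A hA => measurableSet_of_mem_atoms hA)
  have hU : (⋃ A ∈ 𝒜.atoms, id A) = Set.univ := by
    refine Set.eq_univ_of_forall fun x => ?_
    obtain ⟨A, hA, hx⟩ := 𝒜.exists_mem_atoms x
    exact Set.mem_biUnion (Finset.mem_coe.2 hA) hx
  rw [hU, probReal_univ] at h
  exact h.symm

/-- The sequence `(P(A₁), …, P(Aₙ))`, where `A₁, …, Aₙ` is an enumeration of the atoms of `𝒜`. -/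
noncomputable def atomProbs (P : Measure Ω) [IsProbabilityMeasure P] (𝒜 : FiniteSubalgebra Ω) :
    stdSimplex ℝ (Fin 𝒜.atoms.card) :=
  ⟨fun i => P.real (𝒜.atoms.equivFin.symm i : Set Ω), fun _ => measureReal_nonneg, by
    rw [Equiv.sum_comp 𝒜.atoms.equivFin.symm (fun A : 𝒜.atoms => P.real (A : Set Ω)),
      Finset.sum_coe_sort 𝒜.atoms (fun A => P.real A)]
    exact sum_atoms P 𝒜⟩

/-- Independence of two finite algebras. -/
def Independent (P : Measure Ω) (𝒜 ℬ : FiniteSubalgebra Ω) : Prop :=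
  ∀ A ∈ 𝒜.alg, ∀ B ∈ ℬ.alg, P (A ∩ B) = P A * P B

/-- The trace `{A ∩ K : A ∈ 𝒜}` of an algebra on a set `K`. -/
def trace (𝒜 : FiniteSubalgebra Ω) (K : Set Ω) : Set (Set Ω) :=
  (fun A => A ∩ K) '' (𝒜.alg : Set (Set Ω))

/-- `N(𝒜)`: the number of atoms of nonvanishing probability. -/
noncomputable def numAtoms (P : Measure Ω) (𝒜 : FiniteSubalgebra Ω) : ℕ :=
  {A : Set Ω | A ∈ 𝒜.atoms ∧ P A ≠ 0}.ncard

/-- The pseudometric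
`D(𝒜, ℬ) = inf {P(Z) : 𝒜 and ℬ have the same trace on Ω \ Z} + |N(𝒜) - N(ℬ)|`. -/
noncomputable def openDist (P : Measure Ω) (𝒜 ℬ : FiniteSubalgebra Ω) : ℝ :=
  sInf {r : ℝ | ∃ Z : Set Ω, MeasurableSet Z ∧ 𝒜.trace Zᶜ = ℬ.trace Zᶜ ∧ r = P.real Z} +
    |(numAtoms P 𝒜 : ℝ) - (numAtoms P ℬ : ℝ)|

end FiniteSubalgebra

section PartitionEntropy

variable {Ω : Type*} [MeasurableSpace Ω]

/-- Additive partition entropies: `I(σ(𝒜 ∪ ℬ)) = I(𝒜) + I(ℬ)` for independent `𝒜`, `ℬ`. -/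
def IsAdditivePartitionEntropy (P : Measure Ω) (I : FiniteSubalgebra Ω → ℝ) : Prop :=
  ∀ 𝒜 ℬ : FiniteSubalgebra Ω, FiniteSubalgebra.Independent P 𝒜 ℬ →
    I (𝒜.join ℬ) = I 𝒜 + I ℬ

/-- (Open-domain) continuity: continuity in the pseudometric `D`. -/
def IsContinuousEntropy (P : Measure Ω) (I : FiniteSubalgebra Ω → ℝ) : Prop :=
  ∀ 𝒜 : FiniteSubalgebra Ω, ∀ ε : ℝ, 0 < ε → ∃ δ : ℝ, 0 < δ ∧ ∀ ℬ : FiniteSubalgebra Ω,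
    FiniteSubalgebra.openDist P 𝒜 ℬ < δ → |I ℬ - I 𝒜| < ε

/-- Continuity on the algebras `⟨A, Ω \ A⟩` with `0 < P(A) < 1`: if `P(A ∆ Aₖ) → 0`, then
`I(⟨Aₖ, Ω \ Aₖ⟩) → I(⟨A, Ω \ A⟩)`. -/
def IsContinuousOnTwoAtom (P : Measure Ω) (I : FiniteSubalgebra Ω → ℝ) : Prop :=
  ∀ (A : Set Ω) (hA : MeasurableSet A) (B : ℕ → Set Ω) (hB : ∀ k, MeasurableSet (B k)),
    0 < P A → P A < 1 →
    Filter.Tendsto (fun k => P (symmDiff A (B k))) Filter.atTop (nhds 0) →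
    Filter.Tendsto (fun k => I (FiniteSubalgebra.twoAtom (B k) (hB k))) Filter.atTop
      (nhds (I (FiniteSubalgebra.twoAtom A hA)))

/-- Absolute continuity of a countably additive real set function with respect to `P`. -/
def IsAbsCont (P : Measure Ω) (m : SignedMeasure Ω) : Prop :=
  ∀ ε : ℝ, 0 < ε → ∃ δ : ℝ, 0 < δ ∧ ∀ A : Set Ω, MeasurableSet A → P.real A < δ → |m A| < ε

/-- `L_m(𝒜) = ∑ m(Aᵢ) log₂ (1 / P(Aᵢ))`, the sum being over the atoms of `𝒜`. An atom with
`P(Aᵢ) = 0` contributes `0`, which is the convention `0 · ∞ = 0` when `m` vanishes on sets of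
probability `0`. -/
noncomputable def Lm (P : Measure Ω) (m : SignedMeasure Ω) (𝒜 : FiniteSubalgebra Ω) : ℝ :=
  ∑ A ∈ 𝒜.atoms, m A * Real.logb 2 (1 / P.real A)

/-- `p ⊗ q = (p₁q₁, …, p₁qₙ, p₂q₁, …, p₂qₙ, …, pₘq₁, …, pₘqₙ)`. -/
def simplexTensor {m n : ℕ} (p : stdSimplex ℝ (Fin m)) (q : stdSimplex ℝ (Fin n)) :
    stdSimplex ℝ (Fin (m * n)) :=
  ⟨fun k => p.1 (finProdFinEquiv.symm k).1 * q.1 (finProdFinEquiv.symm k).2,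
    fun _ => mul_nonneg (p.2.1 _) (q.2.1 _), by
      rw [Equiv.sum_comp finProdFinEquiv.symm (fun k : Fin m × Fin n => p.1 k.1 * q.1 k.2),
        Fintype.sum_prod_type]
      simp only [← Finset.mul_sum]
      rw [q.2.2]
      simpa using p.2.2⟩

/-- The sequence `p` rearranged by the permutation `s`. -/
def simplexPermute {n : ℕ} (s : Equiv.Perm (Fin n)) (p : stdSimplex ℝ (Fin n)) :
    stdSimplex ℝ (Fin n) :=
  ⟨fun i => p.1 (s i), fun _ => p.2.1 _, by rw [Equiv.sum_comp s p.1]; exact p.2.2⟩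

/-- A (classical) additive entropy: a symmetric real function `H` of finite sequences
`(p₁, …, pₙ)` with `pᵢ ≥ 0`, `∑ pᵢ = 1`, such that `H(p ⊗ q) = H(p) + H(q)`. -/
def IsAdditiveEntropy (H : (n : ℕ) → stdSimplex ℝ (Fin n) → ℝ) : Prop :=
  (∀ (n : ℕ) (s : Equiv.Perm (Fin n)) (p : stdSimplex ℝ (Fin n)),
    H n (simplexPermute s p) = H n p) ∧
  (∀ (m n : ℕ) (p : stdSimplex ℝ (Fin m)) (q : stdSimplex ℝ (Fin n)),
    H (m * n) (simplexTensor p q) = H m p + H n q)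

/-- `H_P(𝒜) = H(P(A₁), …, P(Aₙ))`, where `A₁, …, Aₙ` are the atoms of `𝒜`. -/
noncomputable def HP (P : Measure Ω) [IsProbabilityMeasure P]
    (H : (n : ℕ) → stdSimplex ℝ (Fin n) → ℝ) (𝒜 : FiniteSubalgebra Ω) : ℝ :=
  H 𝒜.atoms.card (𝒜.atomProbs P)

/-- Continuity of `H` in the open domain, i.e. on each open simplex. -/
def IsContinuousOpenSimplex (H : (n : ℕ) → stdSimplex ℝ (Fin n) → ℝ) : Prop :=
  ∀ n : ℕ, ContinuousOn (H n) {p | ∀ i, 0 < p.1 i}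

end PartitionEntropy

/-!
A finite algebra is handled as a labelling `φ : Ω → ι` of the points by finitely many labels, whose
cells `φ ⁻¹' {i}` form the partition. Empty cells and the names of the labels do not affect
`labelAlg φ`, which gives the freedom to permute labels and to take pairs `(φ, χ)`.

**Null events.** An additive partition entropy does not see events of probability zero: two
labellings that agree almost surely become equivalent once joined with one almost surely constant
labelling, and such a labelling is independent of everything (`IsAdditivePartitionEntropy.congr_ae`).

**Exchanges.** If `φ` and `χ` are independent, exchanging the product events `{φ = i, χ = a}` and
`{φ = j, χ = b}` of equal probability, both in `φ` and in `χ`, again gives independent labellings,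
and the total entropy is unchanged (`IsAdditivePartitionEntropy.swap_joint`). So what `φ` loses, `χ`
gains. With a suitable four-cell `χ`, the loss caused by exchanging small events `X`, `Y` of equal
probability between the cells `i` and `j` depends only on `X`, `Y` and the ratio of the two cell
probabilities (`entropy_sub_swapCells`); this is `swapGain P I t X Y` with `t = pᵢ / (pᵢ + pⱼ)`. It
is additive in `(X, Y)` and additive in the logarithm of the odds of `t` (`swapGain_mul`).

**The measure.** Continuity on the algebras with two atoms makes the gain small when `X`, `Y` are
small. Averaging over the arcs `Y` of a uniformly distributed coordinate on `Ω` splits the gain as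
`ν t X - ν t Y`, with `ν t` additive on small events. It extends to a finitely additive set
function, which is countably additive because it is small on small events. Additivity in the log
odds, together with boundedness, makes it linear in the log odds, and so there is one signed measure
`m` with `swapGain P I t X Y = log₂ ((1 - t) / t) * (m X - m Y)`
(`exists_signedMeasure_swapGain`). This is exactly the loss of `L_m` under the same exchange.

**The classical part.** Hence `J = I - L_m` is invariant under all exchanges of events of equal
probability (`exists_isSwapInvariant_sub_Lm`). Two independent labellings with the same law are
connected by such exchanges, and any two labellings with the same law have a common independent
copy, so `J` depends on the law alone (`IsSwapInvariant.eq_of_law_eq`): `J = H_P`.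

**Uniqueness and continuity.** Two events of equal probability `t ≠ 1/2` have algebras with the same
`H_P`, so `I` determines `m B - m C` for all such pairs, and with it `m`
(`decomposition_unique`). Finally `L_m` is continuous by absolute continuity of `m`
(`isContinuousEntropy_Lm`), and partitions with close laws can be chosen close to each other, which
transfers continuity from `H_P` to `H` (`isContinuousOpenSimplex_of_HP`).
-/

/-! ### Sets of prescribed probability -/

section Nonatomic

variable {Ω : Type*} [MeasurableSpace Ω] {P : Measure Ω} [IsProbabilityMeasure P]

/-- Halving repeatedly, one finds events of arbitrarily small positive probability. -/
theorem IsNonatomic.exists_real_lt (hP : IsNonatomic P) {A : Set Ω} (hA : MeasurableSet A)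
    (hpos : 0 < P.real A) {ε : ℝ} (hε : 0 < ε) :
    ∃ B, MeasurableSet B ∧ B ⊆ A ∧ 0 < P.real B ∧ P.real B < ε := by
  have key : ∀ n : ℕ, ∃ B, MeasurableSet B ∧ B ⊆ A ∧ 0 < P.real B ∧ P.real B ≤ (1 / 2) ^ n := by
    intro n
    induction n with
    | zero => exact ⟨A, hA, subset_rfl, hpos, by simp⟩
    | succ n ih =>
      obtain ⟨B, hB, hBA, hB0, hBn⟩ := ih
      obtain ⟨C, hC, hCB, hC0, hC1⟩ := hP B hB (ENNReal.toReal_pos_iff.1 hB0).1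
      have hC0' : 0 < P.real C := ENNReal.toReal_pos_iff.2 ⟨hC0, measure_lt_top _ _⟩
      have hC1' : P.real C < P.real B := by
        exact (ENNReal.toReal_lt_toReal (measure_ne_top _ _) (measure_ne_top _ _)).2 hC1
      have hd : P.real (B \ C) = P.real B - P.real C := measureReal_sdiff hCB hC
      rw [pow_succ]
      rcases le_total (P.real C) (P.real B / 2) with h | h
      · exact ⟨C, hC, hCB.trans hBA, hC0', by linarith⟩
      · exact ⟨B \ C, hB.diff hC, Set.sdiff_subset.trans hBA, by linarith, by linarith⟩
  obtain ⟨n, hn⟩ := exists_pow_lt_of_lt_one hε (by norm_num : (1 / 2 : ℝ) < 1)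
  obtain ⟨B, h1, h2, h3, h4⟩ := key n
  exact ⟨B, h1, h2, h3, h4.trans_lt hn⟩

/-- Sierpiński's theorem. The set is the union of a sequence of sets of probability at most `r`,
each of which realizes at least half of the enlargement that is possible at its step. -/
theorem IsNonatomic.exists_real_eq (hP : IsNonatomic P) {A : Set Ω} (hA : MeasurableSet A)
    {r : ℝ} (h0 : 0 ≤ r) (hr : r ≤ P.real A) :
    ∃ B, MeasurableSet B ∧ B ⊆ A ∧ P.real B = r := by
  let G : Set (Set Ω) := {C | MeasurableSet C ∧ C ⊆ A ∧ P.real C ≤ r}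
  have step : ∀ C : G, ∃ C' : G, C.1 ⊆ C'.1 ∧
      ∀ B ∈ G, C.1 ⊆ B → P.real B - P.real C.1 ≤ 2 * (P.real C'.1 - P.real C.1) := by
    rintro ⟨C, hC⟩
    let S : Set ℝ := {x | ∃ B ∈ G, C ⊆ B ∧ P.real B = x}
    have hbdd : BddAbove S := ⟨r, by rintro _ ⟨B, hB, -, rfl⟩; exact hB.2.2⟩
    have hCS : P.real C ∈ S := ⟨C, hC, subset_rfl, rfl⟩
    have hle : P.real C ≤ sSup S := le_csSup hbdd hCS
    rcases hle.eq_or_lt with h | h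
    · refine ⟨⟨C, hC⟩, subset_rfl, fun B hB hCB => ?_⟩
      have := le_csSup hbdd (show P.real B ∈ S from ⟨B, hB, hCB, rfl⟩)
      simp only [sub_self, mul_zero]
      linarith
    · obtain ⟨_, ⟨D, hD, hCD, rfl⟩, hlt⟩ :=
        exists_lt_of_lt_csSup ⟨_, hCS⟩ (show (P.real C + sSup S) / 2 < sSup S by linarith)
      refine ⟨⟨D, hD⟩, hCD, fun B hB hCB => ?_⟩
      have := le_csSup hbdd (show P.real B ∈ S from ⟨B, hB, hCB, rfl⟩)
      simp only
      linarith
  choose next hnext1 hnext2 using step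
  let c : ℕ → G := fun n => next^[n] ⟨∅, MeasurableSet.empty, Set.empty_subset _, by simpa using h0⟩
  have hcs : ∀ n, c (n + 1) = next (c n) := fun n => Function.iterate_succ_apply' _ _ _
  have hmono : Monotone fun n => (c n).1 :=
    monotone_nat_of_le_succ fun n => by
      change (c n).1 ⊆ (c (n + 1)).1
      rw [hcs]
      exact hnext1 _
  have hlim : Filter.Tendsto (fun n => P.real (c n).1) Filter.atTop
      (nhds (P.real (⋃ n, (c n).1))) :=
    (ENNReal.tendsto_toReal (measure_ne_top _ _)).comp (tendsto_measure_iUnion_atTop hmono)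
  have hU : (⋃ n, (c n).1) ∈ G :=
    ⟨MeasurableSet.iUnion fun n => (c n).2.1, Set.iUnion_subset fun n => (c n).2.2.1,
      le_of_tendsto' hlim fun n => (c n).2.2.2⟩
  refine ⟨_, hU.1, hU.2.1, le_antisymm hU.2.2 ?_⟩
  by_contra! hlt
  set C := ⋃ n, (c n).1 with hC
  have hd : P.real (A \ C) = P.real A - P.real C := measureReal_sdiff hU.2.1 hU.1
  obtain ⟨B, hB, hBA, hB0, hB1⟩ := hP.exists_real_lt (hA.diff hU.1) (by linarith)
    (sub_pos.2 hlt)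
  have hdisj : Disjoint C B := Set.disjoint_left.2 fun x hx hxB => (hBA hxB).2 hx
  have hCB : P.real (C ∪ B) = P.real C + P.real B := measureReal_union hdisj hB
  have hG : C ∪ B ∈ G := ⟨hU.1.union hB, Set.union_subset hU.2.1 (hBA.trans Set.sdiff_subset),
    by linarith⟩
  have h2 : ∀ n, P.real (C ∪ B) - P.real (c n).1 ≤
      2 * (P.real (c (n + 1)).1 - P.real (c n).1) := by
    intro n
    rw [hcs]
    exact hnext2 _ _ hG ((Set.subset_iUnion (fun n => (c n).1) n).trans Set.subset_union_left)
  have h3 := le_of_tendsto_of_tendsto' (hlim.const_sub (P.real (C ∪ B)))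
    (((hlim.comp (Filter.tendsto_add_atTop_nat 1)).sub hlim).const_mul 2) h2
  simp only [sub_self, mul_zero] at h3
  linarith

theorem IsNonatomic.exists_between (hP : IsNonatomic P) {A C : Set Ω} (hA : MeasurableSet A)
    (hC : MeasurableSet C) (hAC : A ⊆ C) {r : ℝ} (h0 : P.real A ≤ r) (hr : r ≤ P.real C) :
    ∃ B, MeasurableSet B ∧ A ⊆ B ∧ B ⊆ C ∧ P.real B = r := by
  have hd : P.real (C \ A) = P.real C - P.real A := measureReal_sdiff hAC hA
  obtain ⟨B, hB, hBA, hBr⟩ := hP.exists_real_eq (hC.diff hA) (sub_nonneg.2 h0)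
    (by rw [hd]; linarith)
  refine ⟨A ∪ B, hA.union hB, Set.subset_union_left,
    Set.union_subset hAC (hBA.trans Set.sdiff_subset), ?_⟩
  rw [measureReal_union (Set.disjoint_left.2 fun x hx hxB => (hBA hxB).2 hx) hB, hBr]
  ring

theorem measureReal_symmDiff_of_subset {A B : Set Ω} (hA : MeasurableSet A) (hAB : A ⊆ B) :
    P.real (symmDiff A B) = P.real B - P.real A := by
  rw [Set.symmDiff_def, Set.sdiff_eq_empty.2 hAB, Set.empty_union, measureReal_sdiff hAB hA]

/-- A set of prescribed probability that avoids `V` can be chosen close to a given set `B`. -/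
theorem IsNonatomic.exists_near (hP : IsNonatomic P) {B V : Set Ω} (hB : MeasurableSet B)
    (hV : MeasurableSet V) {r : ℝ} (h0 : 0 ≤ r) (hr : r ≤ 1 - P.real V) :
    ∃ Z, MeasurableSet Z ∧ Disjoint Z V ∧ P.real Z = r ∧
      P.real (symmDiff Z B) ≤ |r - P.real B| + 2 * P.real V := by
  have hbase : MeasurableSet (B \ V) := hB.diff hV
  have h1 : P.real (symmDiff (B \ V) B) ≤ P.real V := by
    rw [measureReal_symmDiff_of_subset hbase Set.sdiff_subset]
    have := le_measureReal_sdiff (μ := P) (s₁ := B) (s₂ := V)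
    linarith
  have h1' : P.real B - P.real V ≤ P.real (B \ V) := le_measureReal_sdiff
  have h1'' : P.real (B \ V) ≤ P.real B := measureReal_mono Set.sdiff_subset
  have habs := le_abs_self (r - P.real B)
  have habs' := neg_abs_le (r - P.real B)
  have tri : ∀ Z : Set Ω, P.real (symmDiff Z B) ≤
      P.real (symmDiff Z (B \ V)) + P.real (symmDiff (B \ V) B) :=
    fun Z => measureReal_symmDiff_le _
  rcases le_total r (P.real (B \ V)) with h | h
  · obtain ⟨Z, hZ, hZB, hZr⟩ := hP.exists_real_eq hbase h0 h
    refine ⟨Z, hZ, Set.disjoint_left.2 fun x hx hxV => (hZB hx).2 hxV, hZr, ?_⟩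
    have h2 := tri Z
    rw [measureReal_symmDiff_of_subset hZ hZB] at h2
    linarith
  · obtain ⟨Z, hZ, hBZ, hZV, hZr⟩ := hP.exists_between hbase hV.compl
      (fun x hx => hx.2) h (by rwa [probReal_compl_eq_one_sub hV])
    refine ⟨Z, hZ, Set.disjoint_left.2 fun x hx hxV => hZV hx hxV, hZr, ?_⟩
    have h2 := tri Z
    rw [symmDiff_comm Z (B \ V), measureReal_symmDiff_of_subset hbase hBZ] at h2
    linarith

end Nonatomic

/-! ### A uniformly distributed random variable -/

section Uniform

variable {Ω : Type*} [MeasurableSpace Ω] {P : Measure Ω} [IsProbabilityMeasure P]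

/-- A chain of sets indexed by the dyadic rationals `k / 2 ^ n`, as a double sequence: level `n + 1`
inserts the set `mid A C` between two neighbours `A ⊆ C` of level `n`. -/
def dyadicChain (mid : Set Ω → Set Ω → Set Ω) : ℕ → ℕ → Set Ω
  | 0, k => if k = 0 then ∅ else Set.univ
  | n + 1, k => if Even k then dyadicChain mid n (k / 2)
      else mid (dyadicChain mid n (k / 2)) (dyadicChain mid n (k / 2 + 1))

/-- A monotone chain of events whose probabilities are the dyadic rationals. -/
theorem IsNonatomic.exists_dyadicChain (hP : IsNonatomic P) : ∃ F : ℕ → ℕ → Set Ω,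
    (∀ n k, MeasurableSet (F n k)) ∧
    (∀ n k n' k', k * 2 ^ n' ≤ k' * 2 ^ n → F n k ⊆ F n' k') ∧
    (∀ n k, k ≤ 2 ^ n → P.real (F n k) = k / 2 ^ n) ∧ F 0 1 = Set.univ := by
  have hmid : ∀ A C : Set Ω, ∃ M : Set Ω, MeasurableSet A → MeasurableSet C → A ⊆ C →
      MeasurableSet M ∧ A ⊆ M ∧ M ⊆ C ∧ P.real M = (P.real A + P.real C) / 2 := by
    intro A C
    by_cases h : MeasurableSet A ∧ MeasurableSet C ∧ A ⊆ C
    · have hle : P.real A ≤ P.real C := measureReal_mono h.2.2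
      obtain ⟨M, hM⟩ := hP.exists_between h.1 h.2.1 h.2.2
        (r := (P.real A + P.real C) / 2) (by linarith) (by linarith)
      exact ⟨M, fun _ _ _ => hM⟩
    · exact ⟨∅, fun h1 h2 h3 => absurd ⟨h1, h2, h3⟩ h⟩
  choose mid hmid using hmid
  let F := dyadicChain mid
  have heven : ∀ n k, F (n + 1) (2 * k) = F n k := by
    intro n k
    simp [F, dyadicChain]
  have hodd : ∀ n k, F (n + 1) (2 * k + 1) = mid (F n k) (F n (k + 1)) := by
    intro n k
    have h2 : (2 * k + 1) / 2 = k := by omega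
    simp [F, dyadicChain, h2]
  have hlevel : ∀ n, (∀ k, MeasurableSet (F n k)) ∧ (∀ k, F n k ⊆ F n (k + 1)) ∧
      ∀ k, k ≤ 2 ^ n → P.real (F n k) = k / 2 ^ n := by
    intro n
    induction n with
    | zero =>
      refine ⟨fun k => ?_, fun k => ?_, fun k hk => ?_⟩
      · by_cases h : k = 0 <;> simp [F, dyadicChain, h]
      · simp [F, dyadicChain]
      · rw [pow_zero] at hk
        interval_cases k <;> simp [F, dyadicChain]
    | succ n ih =>
      obtain ⟨ih1, ih2, ih3⟩ := ih
      have hm := fun k => hmid (F n k) (F n (k + 1)) (ih1 k) (ih1 _) (ih2 k)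
      refine ⟨fun k => ?_, fun k => ?_, fun k hk => ?_⟩
      · obtain ⟨j, rfl | rfl⟩ := Nat.even_or_odd' k
        · rw [heven]; exact ih1 _
        · rw [hodd]; exact (hm j).1
      · obtain ⟨j, rfl | rfl⟩ := Nat.even_or_odd' k
        · rw [heven, hodd]; exact (hm j).2.1
        · rw [hodd, show 2 * j + 1 + 1 = 2 * (j + 1) by ring, heven]; exact (hm j).2.2.1
      · rw [pow_succ] at hk
        obtain ⟨j, rfl | rfl⟩ := Nat.even_or_odd' k
        · rw [heven, ih3 j (by omega)]
          push_cast
          field_simp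
          ring
        · rw [hodd, (hm j).2.2.2, ih3 j (by omega), ih3 (j + 1) (by omega)]
          push_cast
          field_simp
          ring
  have hmono : ∀ n, Monotone (F n) := fun n => monotone_nat_of_le_succ (hlevel n).2.1
  have hshift : ∀ m n k, F (n + m) (k * 2 ^ m) = F n k := by
    intro m n k
    induction m with
    | zero => simp
    | succ m ih =>
      rw [← add_assoc, show k * 2 ^ (m + 1) = 2 * (k * 2 ^ m) by ring, heven, ih]
  refine ⟨F, fun n => (hlevel n).1, fun n k n' k' h => ?_, fun n => (hlevel n).2.2, ?_⟩
  · rw [← hshift n' n k, ← hshift n n' k', add_comm n' n]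
    exact hmono _ h
  · simp [F, dyadicChain]

/-- A uniformly distributed random variable: `U x` is the infimum of the dyadic rationals whose
event in the chain contains `x`. -/
theorem IsNonatomic.exists_uniform (hP : IsNonatomic P) : ∃ U : Ω → ℝ, Measurable U ∧
    (∀ x, 0 ≤ U x) ∧ (∀ x, U x ≤ 1) ∧
    ∀ c : ℝ, 0 ≤ c → c ≤ 1 → P.real {x | U x < c} = c := by
  obtain ⟨F, hFm, hFmono, hFP, hF1⟩ := hP.exists_dyadicChain
  let S : Ω → Set ℝ := fun x => {r | ∃ n k : ℕ, x ∈ F n k ∧ r = k / 2 ^ n}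
  let U : Ω → ℝ := fun x => sInf (S x)
  have hbdd : ∀ x, BddBelow (S x) := fun x => ⟨0, by rintro _ ⟨n, k, -, rfl⟩; positivity⟩
  have h1S : ∀ x, (1 : ℝ) ∈ S x := fun x => ⟨0, 1, by rw [hF1]; trivial, by simp⟩
  have hlt : ∀ c : ℝ, {x | U x < c} = ⋃ n : ℕ, ⋃ k : ℕ, ⋃ _ : (k : ℝ) / 2 ^ n < c, F n k := by
    intro c
    ext x
    simp only [Set.mem_ofPred_eq, Set.mem_iUnion, U]
    rw [csInf_lt_iff (hbdd x) ⟨1, h1S x⟩]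
    constructor
    · rintro ⟨_, ⟨n, k, hx, rfl⟩, h⟩
      exact ⟨n, k, h, hx⟩
    · rintro ⟨n, k, h, hx⟩
      exact ⟨_, ⟨n, k, hx, rfl⟩, h⟩
  have hUm : ∀ c : ℝ, MeasurableSet {x | U x < c} := by
    intro c
    rw [hlt]
    exact MeasurableSet.iUnion fun n => MeasurableSet.iUnion fun k =>
      MeasurableSet.iUnion fun _ => hFm n k
  refine ⟨U, measurable_of_Iio hUm, fun x => le_csInf ⟨1, h1S x⟩ ?_,
    fun x => csInf_le (hbdd x) (h1S x), fun c hc0 hc1 => ?_⟩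
  · rintro _ ⟨n, k, -, rfl⟩
    positivity
  -- `{U < c}` lies between two neighbours of level `N` of the chain
  have hup : ∀ N : ℕ, P.real {x | U x < c} ≤ c + (1 / 2) ^ N := by
    intro N
    have hpos : (0 : ℝ) < 2 ^ N := by positivity
    have hce : (⌈c * 2 ^ N⌉₊ : ℝ) < c * 2 ^ N + 1 := Nat.ceil_lt_add_one (by positivity)
    have hle : ⌈c * 2 ^ N⌉₊ ≤ 2 ^ N := by
      rw [Nat.ceil_le]
      push_cast
      nlinarith
    have hsub : {x | U x < c} ⊆ F N ⌈c * 2 ^ N⌉₊ := by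
      rw [hlt]
      refine Set.iUnion_subset fun n => Set.iUnion_subset fun k => Set.iUnion_subset fun h =>
        hFmono _ _ _ _ ?_
      have hn : (0 : ℝ) < 2 ^ n := by positivity
      rw [div_lt_iff₀ hn] at h
      have h2 : c * 2 ^ N ≤ (⌈c * 2 ^ N⌉₊ : ℝ) := Nat.le_ceil _
      have : (k : ℝ) * 2 ^ N ≤ (⌈c * 2 ^ N⌉₊ : ℝ) * 2 ^ n := by nlinarith
      exact_mod_cast this
    refine (measureReal_mono hsub).trans ?_
    rw [hFP _ _ hle, one_div, inv_pow, div_le_iff₀ hpos, add_mul, inv_mul_cancel₀ hpos.ne']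
    exact hce.le
  have hlow : ∀ N : ℕ, c - (1 / 2) ^ N ≤ P.real {x | U x < c} := by
    intro N
    have hpos : (0 : ℝ) < 2 ^ N := by positivity
    rcases hc0.eq_or_lt with h0 | h0
    · have : (0 : ℝ) ≤ (1 / 2) ^ N := by positivity
      linarith [measureReal_nonneg (μ := P) (s := {x | U x < c})]
    have hce : (⌈c * 2 ^ N⌉₊ : ℝ) < c * 2 ^ N + 1 := Nat.ceil_lt_add_one (by positivity)
    have h1 : 1 ≤ ⌈c * 2 ^ N⌉₊ := Nat.one_le_iff_ne_zero.2 (Nat.ceil_pos.2 (by positivity)).ne'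
    have hle : ⌈c * 2 ^ N⌉₊ ≤ 2 ^ N := by
      rw [Nat.ceil_le]
      push_cast
      nlinarith
    have h2 : c * 2 ^ N ≤ (⌈c * 2 ^ N⌉₊ : ℝ) := Nat.le_ceil _
    have hcast : ((⌈c * 2 ^ N⌉₊ - 1 : ℕ) : ℝ) = (⌈c * 2 ^ N⌉₊ : ℝ) - 1 := by
      rw [Nat.cast_sub h1, Nat.cast_one]
    have hsub : F N (⌈c * 2 ^ N⌉₊ - 1) ⊆ {x | U x < c} := by
      rw [hlt]
      refine fun x hx => Set.mem_iUnion.2 ⟨N, Set.mem_iUnion.2 ⟨_, Set.mem_iUnion.2 ⟨?_, hx⟩⟩⟩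
      rw [div_lt_iff₀ hpos, hcast]
      linarith
    refine le_trans ?_ (measureReal_mono hsub)
    rw [hFP _ _ (by omega), hcast, one_div, inv_pow, le_div_iff₀ hpos, sub_mul,
      inv_mul_cancel₀ hpos.ne']
    linarith
  have hlim : Filter.Tendsto (fun N : ℕ => (1 / 2 : ℝ) ^ N) Filter.atTop (nhds 0) :=
    tendsto_pow_atTop_nhds_zero_of_lt_one (by norm_num) (by norm_num)
  refine le_antisymm ?_ ?_
  · simpa using ge_of_tendsto' (hlim.const_add c) hup
  · simpa using le_of_tendsto' (hlim.const_sub c) hlow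

/-- A uniform coordinate: the level sets `{fract (U - b) < q}` behave like the arcs `[b, b + q)`
of a circle of length one. -/
def IsUniformCoord (P : Measure Ω) (U : Ω → ℝ) : Prop :=
  Measurable U ∧ ∀ q : ℝ, 0 ≤ q → q ≤ 1 → P.real {x | Int.fract (U x) < q} = q

/-- The arc `[b, b + q)`, pulled back to `Ω`. -/
def arc (U : Ω → ℝ) (b q : ℝ) : Set Ω := {x | Int.fract (U x - b) < q}

theorem IsNonatomic.exists_uniformCoord (hP : IsNonatomic P) : ∃ U, IsUniformCoord P U := by
  obtain ⟨U, hU, h0, h1, hlaw⟩ := hP.exists_uniform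
  refine ⟨U, hU, fun q hq0 hq1 => le_antisymm ?_ ?_⟩
  · have hsub : {x | Int.fract (U x) < q} ⊆ {x | U x < q} ∪ {x | U x < 1}ᶜ := by
      intro x hx
      by_cases h : U x < 1
      · left
        have : Int.fract (U x) = U x := Int.fract_eq_self.2 ⟨h0 x, h⟩
        simpa [this] using hx
      · right
        exact h
    refine (measureReal_mono hsub).trans ((measureReal_union_le _ _).trans ?_)
    rw [hlaw q hq0 hq1, probReal_compl_eq_one_sub (measurableSet_lt hU measurable_const),
      hlaw 1 zero_le_one le_rfl]
    simp
  · refine (hlaw q hq0 hq1).symm.le.trans (measureReal_mono fun x hx => ?_)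
    have hx' : U x < q := hx
    have : Int.fract (U x) = U x := Int.fract_eq_self.2 ⟨h0 x, by linarith⟩
    simpa [this] using hx'

theorem measurableSet_arc {U : Ω → ℝ} (hU : Measurable U) (b q : ℝ) :
    MeasurableSet (arc U b q) :=
  measurableSet_lt (measurable_fract.comp (hU.sub_const b)) measurable_const

end Uniform

section Arc

variable {Ω : Type*} {U : Ω → ℝ} {b q r : ℝ}

theorem arc_add_one (U : Ω → ℝ) (b q : ℝ) : arc U (b + 1) q = arc U b q := by
  ext x
  simp [arc, ← sub_sub]

theorem fract_sub_lt_iff (hq : 0 ≤ q) (hqr : q + r ≤ 1) (x : Ω) :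
    Int.fract (U x - (b + q)) < r ↔
      q ≤ Int.fract (U x - b) ∧ Int.fract (U x - b) < q + r := by
  have hw0 := Int.fract_nonneg (U x - b)
  have hw1 := Int.fract_lt_one (U x - b)
  have hv := Int.floor_add_fract (U x - b)
  set w := Int.fract (U x - b)
  have h1 : Int.fract (U x - (b + q)) = Int.fract (w - q) := by
    rw [show U x - (b + q) = (w - q) + (⌊U x - b⌋ : ℝ) by linarith, Int.fract_add_intCast]
  rw [h1]
  rcases le_or_gt q w with h | h
  · rw [Int.fract_eq_self.2 ⟨by linarith, by linarith⟩]
    constructor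
    · intro h'
      exact ⟨h, by linarith⟩
    · intro h'
      linarith [h'.2]
  · constructor
    · intro h'
      have h2 : Int.fract (w - q) = w - q + 1 := by
        rw [← Int.fract_add_one]
        refine Int.fract_eq_self.2 ⟨?_, by linarith⟩
        have := Int.fract_nonneg (w - q)
        by_contra hneg
        have hr : r ≤ 0 ∨ 0 < r := le_or_gt r 0
        rcases hr with hr | hr <;> linarith
      linarith
    · intro h'
      linarith [h'.1]

theorem arc_add (hq : 0 ≤ q) (hr : 0 ≤ r) (hqr : q + r ≤ 1) :
    arc U b (q + r) = arc U b q ∪ arc U (b + q) r := by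
  ext x
  have := fract_sub_lt_iff (U := U) (b := b) hq hqr x
  simp only [arc, Set.mem_ofPred_eq, Set.mem_union, this]
  constructor
  · intro h
    by_cases h' : Int.fract (U x - b) < q
    · exact Or.inl h'
    · exact Or.inr ⟨not_lt.1 h', h⟩
  · rintro (h | h)
    · linarith
    · exact h.2

theorem disjoint_arc (hq : 0 ≤ q) (hqr : q + r ≤ 1) :
    Disjoint (arc U b q) (arc U (b + q) r) := by
  rw [Set.disjoint_left]
  intro x hx hx'
  have := (fract_sub_lt_iff (U := U) (b := b) hq hqr x).1 hx'
  have hx1 : Int.fract (U x - b) < q := hx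
  linarith [this.1]

end Arc

section Uniform

variable {Ω : Type*} [MeasurableSpace Ω] {P : Measure Ω} [IsProbabilityMeasure P]

theorem IsUniformCoord.measureReal_arc {U : Ω → ℝ} (hU : IsUniformCoord P U) (b : ℝ) {q : ℝ}
    (hq : 0 ≤ q) (hq1 : q ≤ 1) : P.real (arc U b q) = q := by
  have hzero : ∀ q, 0 ≤ q → q ≤ 1 → P.real (arc U 0 q) = q := by
    intro q h0 h1
    simpa [arc] using hU.2 q h0 h1
  have hadd : ∀ b q r, 0 ≤ q → 0 ≤ r → q + r ≤ 1 →
      P.real (arc U b (q + r)) = P.real (arc U b q) + P.real (arc U (b + q) r) := by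
    intro b q r h1 h2 h3
    rw [arc_add h1 h2 h3, measureReal_union (disjoint_arc h1 h3) (measurableSet_arc hU.1 _ _)]
  have hsmall : ∀ b q, 0 ≤ b → 0 ≤ q → b + q ≤ 1 → P.real (arc U b q) = q := by
    intro b q h1 h2 h3
    have := hadd 0 b q h1 h2 h3
    rw [hzero _ (by linarith) h3, hzero _ h1 (by linarith), zero_add] at this
    linarith
  have hunit : ∀ b q, 0 ≤ b → b < 1 → 0 ≤ q → q ≤ 1 → P.real (arc U b q) = q := by
    intro b q h1 h2 h3 h4
    rcases le_total (b + q) 1 with h | h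
    · exact hsmall b q h1 h3 h
    · have h5 := hadd b q (1 - q) h3 (by linarith) (by linarith)
      have h6 : arc U b (q + (1 - q)) = Set.univ := by
        ext x
        simpa [arc] using Int.fract_lt_one _
      have h7 : arc U (b + q) (1 - q) = arc U (b + q - 1) (1 - q) := by
        rw [← arc_add_one U (b + q - 1)]
        simp
      rw [h6, h7, hsmall (b + q - 1) (1 - q) (by linarith) (by linarith) (by linarith),
        probReal_univ] at h5
      linarith
  have hfr : arc U b q = arc U (Int.fract b) q := by
    ext x
    have : U x - Int.fract b = (U x - b) + (⌊b⌋ : ℝ) := by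
      have := Int.floor_add_fract b
      linarith
    simp only [arc, Set.mem_ofPred_eq]
    rw [this, Int.fract_add_intCast]
  rw [hfr]
  exact hunit _ _ (Int.fract_nonneg _) (Int.fract_lt_one _) hq hq1

/-- Every point lies in an event of probability zero, so that nonempty null events abound. -/
theorem IsNonatomic.exists_null_mem (hP : IsNonatomic P) (x : Ω) :
    ∃ N, MeasurableSet N ∧ x ∈ N ∧ P.real N = 0 := by
  obtain ⟨U, hU⟩ := hP.exists_uniformCoord
  refine ⟨⋂ n : ℕ, arc U (U x) (1 / (n + 1)),
    MeasurableSet.iInter fun n => measurableSet_arc hU.1 _ _, ?_, ?_⟩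
  · refine Set.mem_iInter.2 fun n => ?_
    have : (0 : ℝ) < 1 / (n + 1) := by positivity
    simpa [arc] using this
  · refine le_antisymm ?_ measureReal_nonneg
    refine ge_of_tendsto' tendsto_one_div_add_atTop_nhds_zero_nat fun n => ?_
    have h1 : (1 : ℝ) / (n + 1) ≤ 1 := by
      rw [div_le_one (by positivity)]
      linarith [n.cast_nonneg (α := ℝ)]
    have := hU.measureReal_arc (U x) (q := 1 / ((n : ℝ) + 1)) (by positivity) h1
    rw [← this]
    exact measureReal_mono (Set.iInter_subset _ n)

end Uniform

/-! ### Finite algebras as labelled partitions -/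

section Labelling

variable {Ω ι κ : Type*} [MeasurableSpace Ω]

/-- A labelling of `Ω`: a map all of whose level sets are events. With finitely many labels it
encodes an ordered partition of `Ω`, in which empty cells are allowed. -/
def IsLabelling (φ : Ω → ι) : Prop := ∀ s : Set ι, MeasurableSet (φ ⁻¹' s)

theorem isLabelling_of_singleton [Finite ι] {φ : Ω → ι}
    (h : ∀ i, MeasurableSet (φ ⁻¹' {i})) : IsLabelling φ := by
  intro s
  have : φ ⁻¹' s = ⋃ i ∈ s, φ ⁻¹' {i} := by
    ext x
    simp
  rw [this]
  exact MeasurableSet.biUnion s.to_countable fun i _ => h i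

theorem IsLabelling.comp {φ : Ω → ι} (h : IsLabelling φ) (e : ι → κ) :
    IsLabelling fun x => e (φ x) := fun s => h (e ⁻¹' s)

theorem isLabelling_const (i : ι) : IsLabelling fun _ : Ω => i := fun s => by
  by_cases h : i ∈ s <;> simp [h]

theorem isLabelling_mem {B : Set Ω} (hB : MeasurableSet B) : IsLabelling fun x => x ∈ B := by
  refine isLabelling_of_singleton fun p => ?_
  by_cases hp : p
  · convert hB using 1
    ext x
    simp [hp]
  · convert hB.compl using 1
    ext x
    simp [hp]

theorem IsLabelling.pair [Finite ι] [Finite κ] {φ : Ω → ι} {χ : Ω → κ} (hφ : IsLabelling φ)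
    (hχ : IsLabelling χ) : IsLabelling fun x => (φ x, χ x) := by
  refine isLabelling_of_singleton fun p => ?_
  have : (fun x => (φ x, χ x)) ⁻¹' {p} = φ ⁻¹' {p.1} ∩ χ ⁻¹' {p.2} := by
    ext x
    simp [Prod.ext_iff]
  rw [this]
  exact (hφ _).inter (hχ _)

open Classical in
theorem IsLabelling.ite {φ ψ : Ω → ι} (hφ : IsLabelling φ) (hψ : IsLabelling ψ) {X : Set Ω}
    (hX : MeasurableSet X) : IsLabelling fun x => if x ∈ X then φ x else ψ x := by
  intro s
  have : (fun x => if x ∈ X then φ x else ψ x) ⁻¹' s = (X ∩ φ ⁻¹' s) ∪ (Xᶜ ∩ ψ ⁻¹' s) := by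
    ext x
    by_cases h : x ∈ X <;> simp [h]
  rw [this]
  exact (hX.inter (hφ s)).union (hX.compl.inter (hψ s))

/-- The algebra of all unions of cells of a labelled partition (and a junk value for maps that are
not labellings). -/
noncomputable def labelAlg [Finite ι] (φ : Ω → ι) : FiniteSubalgebra Ω := by
  classical
  exact if h : IsLabelling φ then
    { alg :=
        { carrier := Set.range (fun s : Set ι => φ ⁻¹' s)
          supClosed' := by
            rintro _ ⟨S, rfl⟩ _ ⟨T, rfl⟩
            exact ⟨S ∪ T, rfl⟩
          infClosed' := by
            rintro _ ⟨S, rfl⟩ _ ⟨T, rfl⟩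
            exact ⟨S ∩ T, rfl⟩
          compl_mem' := by
            rintro _ ⟨S, rfl⟩
            exact ⟨Sᶜ, rfl⟩
          bot_mem' := ⟨∅, rfl⟩ }
      finite := Set.finite_range (fun s : Set ι => φ ⁻¹' s)
      measurable := by
        rintro _ ⟨s, rfl⟩
        exact h s }
  else FiniteSubalgebra.twoAtom ∅ MeasurableSet.empty

theorem mem_labelAlg [Finite ι] {φ : Ω → ι} (h : IsLabelling φ) {A : Set Ω} :
    A ∈ (labelAlg φ).alg ↔ ∃ s : Set ι, φ ⁻¹' s = A := by
  rw [labelAlg, dif_pos h]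
  rfl

theorem FiniteSubalgebra.ext_mem {𝒜 ℬ : FiniteSubalgebra Ω}
    (h : ∀ A, A ∈ 𝒜.alg ↔ A ∈ ℬ.alg) : 𝒜 = ℬ :=
  FiniteSubalgebra.ext (SetLike.ext h)

/-- The algebra of a labelling depends only on the partition, not on the names of the labels. -/
theorem labelAlg_congr [Finite ι] [Finite κ] {φ : Ω → ι} {ψ : Ω → κ} (hφ : IsLabelling φ)
    (hψ : IsLabelling ψ) (h : ∀ x y, φ x = φ y ↔ ψ x = ψ y) : labelAlg φ = labelAlg ψ := by
  refine FiniteSubalgebra.ext_mem fun A => ?_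
  rw [mem_labelAlg hφ, mem_labelAlg hψ]
  constructor
  · rintro ⟨s, rfl⟩
    refine ⟨ψ '' (φ ⁻¹' s), ?_⟩
    ext x
    simp only [Set.mem_preimage, Set.mem_image]
    constructor
    · rintro ⟨y, hy, hyx⟩
      rwa [← (h y x).2 hyx]
    · exact fun hx => ⟨x, hx, rfl⟩
  · rintro ⟨s, rfl⟩
    refine ⟨φ '' (ψ ⁻¹' s), ?_⟩
    ext x
    simp only [Set.mem_preimage, Set.mem_image]
    constructor
    · rintro ⟨y, hy, hyx⟩
      rwa [← (h y x).1 hyx]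
    · exact fun hx => ⟨x, hx, rfl⟩

theorem labelAlg_pair [Finite ι] [Finite κ] {φ : Ω → ι} {χ : Ω → κ} (hφ : IsLabelling φ)
    (hχ : IsLabelling χ) :
    labelAlg (fun x => (φ x, χ x)) = (labelAlg φ).join (labelAlg χ) := by
  refine FiniteSubalgebra.ext_mem fun A => ?_
  rw [mem_labelAlg (hφ.pair hχ)]
  constructor
  · rintro ⟨s, rfl⟩
    change _ ∈ BooleanSubalgebra.closure _
    induction s, s.toFinite using Set.Finite.induction_on with
    | empty => exact BooleanSubalgebra.bot_mem
    | @insert a s _ _ ih =>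
      have : (fun x => (φ x, χ x)) ⁻¹' insert a s =
          (φ ⁻¹' {a.1} ⊓ χ ⁻¹' {a.2}) ⊔ (fun x => (φ x, χ x)) ⁻¹' s := by
        ext x
        simp [Prod.ext_iff]
      rw [this]
      refine BooleanSubalgebra.sup_mem (BooleanSubalgebra.inf_mem ?_ ?_) ih
      · exact BooleanSubalgebra.subset_closure (Or.inl ((mem_labelAlg hφ).2 ⟨_, rfl⟩))
      · exact BooleanSubalgebra.subset_closure (Or.inr ((mem_labelAlg hχ).2 ⟨_, rfl⟩))
  · intro hA
    rw [← mem_labelAlg (hφ.pair hχ)]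
    revert hA A
    change BooleanSubalgebra.closure _ ≤ (labelAlg fun x => (φ x, χ x)).alg
    rw [BooleanSubalgebra.closure_le]
    rintro A (hA | hA)
    · obtain ⟨s, rfl⟩ := (mem_labelAlg hφ).1 hA
      exact (mem_labelAlg (hφ.pair hχ)).2 ⟨Prod.fst ⁻¹' s, rfl⟩
    · obtain ⟨s, rfl⟩ := (mem_labelAlg hχ).1 hA
      exact (mem_labelAlg (hφ.pair hχ)).2 ⟨Prod.snd ⁻¹' s, rfl⟩

theorem twoAtom_eq_labelAlg {B : Set Ω} (hB : MeasurableSet B) :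
    FiniteSubalgebra.twoAtom B hB = labelAlg fun x => x ∈ B := by
  refine FiniteSubalgebra.ext_mem fun A => ?_
  have hmem := @mem_labelAlg Ω Prop _ _ _ (isLabelling_mem hB)
  constructor
  · revert A
    change BooleanSubalgebra.closure _ ≤ (labelAlg fun x => x ∈ B).alg
    rw [BooleanSubalgebra.closure_le]
    rintro A (rfl | rfl)
    · exact hmem.2 ⟨{True}, by ext x; simp⟩
    · exact hmem.2 ⟨{False}, by ext x; simp⟩
  · rw [hmem]
    rintro ⟨s, rfl⟩
    change _ ∈ BooleanSubalgebra.closure _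
    have hB1 : B ∈ BooleanSubalgebra.closure {B, Bᶜ} :=
      BooleanSubalgebra.subset_closure (Or.inl rfl)
    by_cases h1 : True ∈ s <;> by_cases h2 : False ∈ s
    · convert BooleanSubalgebra.top_mem
      ext x
      by_cases hx : x ∈ B <;> simp [hx, h1, h2]
    · convert hB1
      ext x
      by_cases hx : x ∈ B <;> simp [hx, h1, h2]
    · convert BooleanSubalgebra.compl_mem hB1
      ext x
      by_cases hx : x ∈ B <;> simp [hx, h1, h2]
    · convert BooleanSubalgebra.bot_mem
      ext x
      by_cases hx : x ∈ B <;> simp [hx, h1, h2]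

end Labelling

/-! ### Laws of labellings, independence -/

section Law

variable {Ω ι κ : Type*} [MeasurableSpace Ω] {P : Measure Ω} [IsProbabilityMeasure P]

/-- The law of a labelling: the probabilities of the cells. -/
noncomputable def law (P : Measure Ω) (φ : Ω → ι) (i : ι) : ℝ := P.real (φ ⁻¹' {i})

theorem law_nonneg {P : Measure Ω} (φ : Ω → ι) (i : ι) : 0 ≤ law P φ i := measureReal_nonneg

open Classical in
theorem IsLabelling.sum_inter [Fintype ι] {φ : Ω → ι} (hφ : IsLabelling φ) (s : Set ι)
    {A : Set Ω} (hA : MeasurableSet A) :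
    P.real (φ ⁻¹' s ∩ A) = ∑ i, if i ∈ s then P.real (φ ⁻¹' {i} ∩ A) else 0 := by
  have h1 : φ ⁻¹' s ∩ A = ⋃ i ∈ Finset.univ.filter (· ∈ s), φ ⁻¹' {i} ∩ A := by
    ext x
    simp
  rw [h1, measureReal_biUnion_finset, Finset.sum_filter]
  · intro i _ j _ hij
    refine Set.disjoint_left.2 fun x hx hx' => hij ?_
    exact hx.1.symm.trans hx'.1
  · exact fun i _ => (hφ _).inter hA

theorem IsLabelling.sum_inter_univ [Fintype ι] {φ : Ω → ι} (hφ : IsLabelling φ)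
    {A : Set Ω} (hA : MeasurableSet A) :
    ∑ i, P.real (φ ⁻¹' {i} ∩ A) = P.real A := by
  have := hφ.sum_inter (P := P) Set.univ hA
  simpa using this.symm

theorem IsLabelling.sum_law [Fintype ι] {φ : Ω → ι} (hφ : IsLabelling φ) :
    ∑ i, law P φ i = 1 := by
  have := hφ.sum_inter_univ (P := P) MeasurableSet.univ
  simpa [law] using this

theorem law_mem_true {P : Measure Ω} (B : Set Ω) : law P (fun x => x ∈ B) True = P.real B := by
  unfold law
  congr 1
  ext x
  simp

theorem law_mem_false {B : Set Ω} (hB : MeasurableSet B) :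
    law P (fun x => x ∈ B) False = 1 - P.real B := by
  rw [← probReal_compl_eq_one_sub hB]
  unfold law
  congr 1
  ext x
  simp

/-- Independence of two labellings, tested on pairs of cells. -/
def LabelIndep (P : Measure Ω) (φ : Ω → ι) (χ : Ω → κ) : Prop :=
  ∀ i k, P.real (φ ⁻¹' {i} ∩ χ ⁻¹' {k}) = law P φ i * law P χ k

theorem LabelIndep.independent [Finite ι] [Finite κ] {φ : Ω → ι} {χ : Ω → κ}
    (hφ : IsLabelling φ) (hχ : IsLabelling χ) (h : LabelIndep P φ χ) :
    FiniteSubalgebra.Independent P (labelAlg φ) (labelAlg χ) := by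
  classical
  have := Fintype.ofFinite ι
  have := Fintype.ofFinite κ
  intro A hA B hB
  obtain ⟨s, rfl⟩ := (mem_labelAlg hφ).1 hA
  obtain ⟨t, rfl⟩ := (mem_labelAlg hχ).1 hB
  have h1 : ∀ i, P.real (φ ⁻¹' {i} ∩ χ ⁻¹' t) = law P φ i * P.real (χ ⁻¹' t) := by
    intro i
    have e := hχ.sum_inter (P := P) t MeasurableSet.univ
    rw [Set.inter_univ] at e
    rw [Set.inter_comm, hχ.sum_inter t (hφ _), e, Finset.mul_sum]
    refine Finset.sum_congr rfl fun k _ => ?_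
    rw [Set.inter_comm, h i k, Set.inter_univ]
    split_ifs <;> simp [law]
  have h2 : P.real (φ ⁻¹' s ∩ χ ⁻¹' t) = P.real (φ ⁻¹' s) * P.real (χ ⁻¹' t) := by
    have e := hφ.sum_inter (P := P) s MeasurableSet.univ
    rw [Set.inter_univ] at e
    rw [hφ.sum_inter s (hχ _), e, Finset.sum_mul]
    refine Finset.sum_congr rfl fun k _ => ?_
    rw [h1, Set.inter_univ]
    split_ifs <;> simp [law]
  rw [← ENNReal.toReal_eq_toReal_iff' (measure_ne_top _ _)
    (ENNReal.mul_ne_top (measure_ne_top _ _) (measure_ne_top _ _)), ENNReal.toReal_mul]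
  exact h2

theorem IsAdditivePartitionEntropy.pair [Finite ι] [Finite κ] {I : FiniteSubalgebra Ω → ℝ}
    (hI : IsAdditivePartitionEntropy P I) {φ : Ω → ι} {χ : Ω → κ}
    (hφ : IsLabelling φ) (hχ : IsLabelling χ) (h : LabelIndep P φ χ) :
    I (labelAlg fun x => (φ x, χ x)) = I (labelAlg φ) + I (labelAlg χ) := by
  rw [labelAlg_pair hφ hχ]
  exact hI _ _ (h.independent hφ hχ)

theorem measureReal_inter_of_compl_null {A B : Set Ω} (h : P.real Aᶜ = 0) :
    P.real (A ∩ B) = P.real B := by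
  refine le_antisymm (measureReal_mono Set.inter_subset_right) ?_
  have : P.real B ≤ P.real (A ∩ B) + P.real Aᶜ := by
    refine (measureReal_mono ?_).trans (measureReal_union_le _ _)
    intro x hx
    by_cases hA : x ∈ A
    · exact Or.inl ⟨hA, hx⟩
    · exact Or.inr hA
  linarith

/-- A labelling that is almost surely constant is independent of every labelling. -/
theorem labelIndep_of_null {φ : Ω → ι} {ρ : Ω → κ} (hρ : IsLabelling ρ) {k₀ : κ}
    (h0 : P.real (ρ ⁻¹' {k₀})ᶜ = 0) : LabelIndep P φ ρ := by
  intro i k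
  by_cases hk : k = k₀
  · subst hk
    have h1 : P.real (ρ ⁻¹' {k}) = 1 := by
      rw [probReal_compl_eq_one_sub (hρ _)] at h0
      linarith
    rw [Set.inter_comm, measureReal_inter_of_compl_null h0]
    simp [law, h1]
  · have h2 : P.real (ρ ⁻¹' {k}) = 0 := measureReal_mono_null
      (fun x hx hx' => hk (hx.symm.trans hx')) h0
    rw [law, law, h2, mul_zero]
    exact measureReal_mono_null Set.inter_subset_right h2

/-- An almost surely constant labelling is independent of itself, so its entropy vanishes. -/
theorem IsAdditivePartitionEntropy.eq_zero_of_null [Finite κ] {I : FiniteSubalgebra Ω → ℝ}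
    (hI : IsAdditivePartitionEntropy P I) {ρ : Ω → κ} (hρ : IsLabelling ρ) {k₀ : κ}
    (h0 : P.real (ρ ⁻¹' {k₀})ᶜ = 0) : I (labelAlg ρ) = 0 := by
  have h1 := hI.pair hρ hρ (labelIndep_of_null hρ h0)
  rw [labelAlg_congr (hρ.pair hρ) hρ (by simp)] at h1
  linarith

/-- An additive partition entropy does not see events of probability zero: labellings that agree
almost surely become equivalent after joining them with one almost surely constant labelling. -/
theorem IsAdditivePartitionEntropy.congr_ae [Finite ι] {I : FiniteSubalgebra Ω → ℝ}
    (hI : IsAdditivePartitionEntropy P I) {φ ψ : Ω → ι} (hφ : IsLabelling φ)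
    (hψ : IsLabelling ψ) (h : P.real {x | φ x ≠ ψ x} = 0) :
    I (labelAlg φ) = I (labelAlg ψ) := by
  classical
  let N : Set Ω := (fun x => (φ x, ψ x)) ⁻¹' {p | p.1 ≠ p.2}
  have hN : MeasurableSet N := hφ.pair hψ _
  -- `ρ` records both labels on the null event `N`, so that `φ` and `ψ` determine each other
  -- given `ρ`
  let ρ : Ω → Option (ι × ι) := fun x => if x ∈ N then some (φ x, ψ x) else none
  have hρ : IsLabelling ρ := ((hφ.pair hψ).comp some).ite (isLabelling_const none) hN
  have h0 : P.real (ρ ⁻¹' {none})ᶜ = 0 := by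
    refine measureReal_mono_null (fun x hx => ?_) h
    by_contra hx'
    refine hx ?_
    have : x ∉ N := hx'
    simp [ρ, this]
  have hz := hI.eq_zero_of_null hρ h0
  have h1 := hI.pair hφ hρ (labelIndep_of_null hρ h0)
  have h2 := hI.pair hψ hρ (labelIndep_of_null hρ h0)
  rw [labelAlg_congr (hφ.pair hρ) (hψ.pair hρ)] at h1
  · linarith
  intro x y
  have hN' : ∀ x, x ∈ N ↔ φ x ≠ ψ x := fun x => Iff.rfl
  simp only [Prod.mk.injEq, ρ]
  by_cases hx : x ∈ N <;> by_cases hy : y ∈ N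
  · simp [hx, hy]
  · simp [hx, hy]
  · simp [hx, hy]
  · have hx' : φ x = ψ x := by simpa [hN'] using hx
    have hy' : φ y = ψ y := by simpa [hN'] using hy
    simp [hx, hy, hx', hy']

/-- The labelling `φ` after the part `X` of its cell `i` and the part `Y` of its cell `j` have been
exchanged. -/
noncomputable def swapCells (φ : Ω → ι) (X Y : Set Ω) (i j : ι) : Ω → ι := by
  classical
  exact fun x => if x ∈ X then j else if x ∈ Y then i else φ x

theorem IsLabelling.swapCells {φ : Ω → ι} (hφ : IsLabelling φ) {X Y : Set Ω}
    (hX : MeasurableSet X) (hY : MeasurableSet Y) (i j : ι) :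
    IsLabelling (swapCells φ X Y i j) :=
  (isLabelling_const j).ite ((isLabelling_const i).ite hφ hY) hX

/-- Permuting the labels of the joint labelling of two independent labellings by a permutation that
preserves the joint law gives two independent labellings with the same laws and the same total
entropy. -/
theorem IsAdditivePartitionEntropy.permute_joint [Finite ι] [Finite κ]
    {I : FiniteSubalgebra Ω → ℝ} (hI : IsAdditivePartitionEntropy P I) {φ : Ω → ι} {χ : Ω → κ}
    (hφ : IsLabelling φ) (hχ : IsLabelling χ) (h : LabelIndep P φ χ)
    (τ : Equiv.Perm (ι × κ))
    (hτ : ∀ z, law P φ (τ z).1 * law P χ (τ z).2 = law P φ z.1 * law P χ z.2)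
    {φ' : Ω → ι} {χ' : Ω → κ} (h' : ∀ x, (φ' x, χ' x) = τ (φ x, χ x)) :
    I (labelAlg φ) + I (labelAlg χ) = I (labelAlg φ') + I (labelAlg χ') ∧
    law P φ' = law P φ ∧ law P χ' = law P χ ∧ LabelIndep P φ' χ' := by
  have := Fintype.ofFinite ι
  have := Fintype.ofFinite κ
  have hφ' : IsLabelling φ' := by
    have h1 : φ' = fun x => (τ (φ x, χ x)).1 := funext fun x => by rw [← h']
    rw [h1]
    exact (hφ.pair hχ).comp fun z => (τ z).1
  have hχ' : IsLabelling χ' := by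
    have h1 : χ' = fun x => (τ (φ x, χ x)).2 := funext fun x => by rw [← h']
    rw [h1]
    exact (hφ.pair hχ).comp fun z => (τ z).2
  have hjoint : ∀ i k, P.real (φ' ⁻¹' {i} ∩ χ' ⁻¹' {k}) = law P φ i * law P χ k := by
    intro i k
    have h1 : φ' ⁻¹' {i} ∩ χ' ⁻¹' {k} =
        φ ⁻¹' {(τ.symm (i, k)).1} ∩ χ ⁻¹' {(τ.symm (i, k)).2} := by
      ext x
      have h2 : (φ' x, χ' x) = (i, k) ↔ (φ x, χ x) = τ.symm (i, k) := by
        rw [h', Equiv.eq_symm_apply]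
      rwa [Prod.ext_iff, Prod.ext_iff] at h2
    rw [h1, h]
    have := hτ (τ.symm (i, k))
    rw [Equiv.apply_symm_apply] at this
    exact this.symm
  have hl1 : law P φ' = law P φ := by
    funext i
    have h1 := hχ'.sum_inter_univ (P := P) (hφ' {i})
    rw [law, ← h1]
    simp only [Set.inter_comm (χ' ⁻¹' _), hjoint, ← Finset.mul_sum, hχ.sum_law, mul_one]
  have hl2 : law P χ' = law P χ := by
    funext i
    have h1 := hφ'.sum_inter_univ (P := P) (hχ' {i})
    rw [law, ← h1]
    simp only [hjoint, ← Finset.sum_mul, hφ.sum_law, one_mul]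
  have hind : LabelIndep P φ' χ' := fun i k => by rw [hjoint, hl1, hl2]
  refine ⟨?_, hl1, hl2, hind⟩
  rw [← hI.pair hφ hχ h, ← hI.pair hφ' hχ' hind]
  congr 1
  refine labelAlg_congr (hφ.pair hχ) (hφ'.pair hχ') fun x y => ?_
  rw [h', h', τ.apply_eq_iff_eq]

/-- Two cells of equal probability of the joint partition of independent labellings can be
exchanged. -/
theorem IsAdditivePartitionEntropy.swap_joint [Finite ι] [Finite κ]
    {I : FiniteSubalgebra Ω → ℝ} (hI : IsAdditivePartitionEntropy P I) {φ : Ω → ι} {χ : Ω → κ}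
    (hφ : IsLabelling φ) (hχ : IsLabelling χ) (h : LabelIndep P φ χ)
    {i j : ι} {a b : κ} {X Y : Set Ω} (hX : X = φ ⁻¹' {i} ∩ χ ⁻¹' {a})
    (hY : Y = φ ⁻¹' {j} ∩ χ ⁻¹' {b}) (hXY : P.real X = P.real Y) :
    I (labelAlg φ) + I (labelAlg χ) =
      I (labelAlg (swapCells φ X Y i j)) + I (labelAlg (swapCells χ X Y a b)) ∧
    law P (swapCells φ X Y i j) = law P φ ∧ law P (swapCells χ X Y a b) = law P χ ∧
    LabelIndep P (swapCells φ X Y i j) (swapCells χ X Y a b) := by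
  classical
  refine hI.permute_joint hφ hχ h (Equiv.swap (i, a) (j, b)) ?_ ?_
  · have e : law P φ i * law P χ a = law P φ j * law P χ b := by
      rw [← h, ← h, ← hX, ← hY, hXY]
    intro z
    by_cases h1 : z = (i, a)
    · subst h1
      simpa using e.symm
    by_cases h2 : z = (j, b)
    · subst h2
      simpa using e
    rw [Equiv.swap_apply_of_ne_of_ne h1 h2]
  · intro x
    have hx1 : x ∈ X ↔ (φ x, χ x) = (i, a) := by
      rw [hX]
      simp [Prod.ext_iff]
    have hx2 : x ∈ Y ↔ (φ x, χ x) = (j, b) := by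
      rw [hY]
      simp [Prod.ext_iff]
    unfold swapCells
    by_cases h1 : x ∈ X
    · have e1 := hx1.1 h1
      simp only [h1, if_true]
      rw [e1, Equiv.swap_apply_left]
    · by_cases h2 : x ∈ Y
      · have e2 := hx2.1 h2
        simp only [h1, h2, if_true, if_false]
        rw [e2, Equiv.swap_apply_right]
      · simp only [h1, h2, if_false]
        rw [Equiv.swap_apply_of_ne_of_ne (fun e => h1 (hx1.2 e)) (fun e => h2 (hx2.2 e))]

end Law

/-! ### Constructing labellings -/

section Construct

variable {Ω ι κ : Type*} [MeasurableSpace Ω] {P : Measure Ω} [IsProbabilityMeasure P]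

/-- An event can be split into cells of prescribed probabilities. -/
theorem IsNonatomic.exists_split (hP : IsNonatomic P) (T : Finset κ)
    (hT : T.Nonempty) (w : κ → ℝ) (hw : ∀ l, 0 ≤ w l) (S : Set Ω) (hS : MeasurableSet S)
    (hsum : ∑ l ∈ T, w l = P.real S) :
    ∃ θ : Ω → κ, IsLabelling θ ∧ (∀ x, θ x ∈ T) ∧
      ∀ l ∈ T, P.real (S ∩ θ ⁻¹' {l}) = w l := by
  classical
  induction hT using Finset.Nonempty.cons_induction generalizing S with
  | singleton a =>
    refine ⟨fun _ => a, isLabelling_const a, fun _ => by simp, fun l hl => ?_⟩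
    rw [Finset.mem_singleton] at hl
    subst hl
    simpa using hsum.symm
  | cons a T ha hT ih =>
    rw [Finset.sum_cons] at hsum
    have hnn : 0 ≤ ∑ l ∈ T, w l := Finset.sum_nonneg fun l _ => hw l
    obtain ⟨A, hA, hAS, hAw⟩ := hP.exists_real_eq hS (hw a) (by linarith)
    obtain ⟨θ, hθ, hθT, hθw⟩ := ih (S \ A) (hS.diff hA) (by
      rw [measureReal_sdiff hAS hA]
      linarith)
    refine ⟨fun x => if x ∈ A then a else θ x, (isLabelling_const a).ite hθ hA, fun x => ?_,
      fun l hl => ?_⟩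
    · by_cases hx : x ∈ A
      · simp [hx]
      · simp [hx, hθT x]
    · rw [Finset.mem_cons] at hl
      by_cases hla : l = a
      · subst hla
        rw [← hAw]
        congr 1
        ext x
        by_cases hx : x ∈ A
        · simp [hx, hAS hx]
        · have : θ x ≠ l := fun e => ha (e ▸ hθT x)
          simp [hx, this]
      · rw [← hθw l (hl.resolve_left hla)]
        congr 1
        ext x
        by_cases hx : x ∈ A
        · simp [hx, Ne.symm hla]
        · simp [hx]

/-- There is a labelling with prescribed law, independent of a given labelling `φ`, such that in
each cell of `φ` one of the cells of the new labelling is prescribed. -/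
theorem IsNonatomic.exists_labelIndep [Finite ι] [Fintype κ] [Nontrivial κ] (hP : IsNonatomic P)
    {φ : Ω → ι} (hφ : IsLabelling φ) {w : κ → ℝ} (hw : ∀ l, 0 ≤ w l) (hw1 : ∑ l, w l = 1)
    (c : ι → κ) (V : ι → Set Ω) (hV : ∀ k, MeasurableSet (V k)) (hVφ : ∀ k, V k ⊆ φ ⁻¹' {k})
    (hVw : ∀ k, P.real (V k) = law P φ k * w (c k)) :
    ∃ χ : Ω → κ, IsLabelling χ ∧ law P χ = w ∧ LabelIndep P φ χ ∧
      ∀ k, φ ⁻¹' {k} ∩ χ ⁻¹' {c k} = V k := by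
  classical
  have := Fintype.ofFinite ι
  have hex : ∀ k : ι, ∃ θ : Ω → κ, IsLabelling θ ∧ (∀ x, θ x ≠ c k) ∧
      ∀ l, l ≠ c k → P.real ((φ ⁻¹' {k} \ V k) ∩ θ ⁻¹' {l}) = law P φ k * w l := by
    intro k
    have hne : (Finset.univ.erase (c k)).Nonempty := by
      obtain ⟨l, hl⟩ := exists_ne (c k)
      exact ⟨l, by simp [hl]⟩
    obtain ⟨θ, h1, h2, h3⟩ := hP.exists_split (Finset.univ.erase (c k)) hne
      (fun l => law P φ k * w l) (fun l => mul_nonneg (law_nonneg _ _) (hw l))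
      (φ ⁻¹' {k} \ V k) ((hφ _).diff (hV k)) (by
        rw [← Finset.mul_sum, measureReal_sdiff (hVφ k) (hV k), hVw]
        have := Finset.add_sum_erase Finset.univ w (Finset.mem_univ (c k))
        rw [hw1] at this
        change _ = law P φ k - _
        rw [← eq_sub_iff_add_eq'] at this
        rw [this]
        ring)
    exact ⟨θ, h1, fun x => by simpa using h2 x, fun l hl => h3 l (by simp [hl])⟩
  choose θ hθ hθc hθw using hex
  let χ : Ω → κ := fun x => if x ∈ V (φ x) then c (φ x) else θ (φ x) x
  have hχk : ∀ k l, φ ⁻¹' {k} ∩ χ ⁻¹' {l} =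
      φ ⁻¹' {k} ∩ (fun x => if x ∈ V k then c k else θ k x) ⁻¹' {l} := by
    intro k l
    ext x
    simp only [Set.mem_inter_iff, Set.mem_preimage, Set.mem_singleton_iff, χ]
    refine and_congr_right fun h => ?_
    rw [h]
  have hcell : ∀ k, φ ⁻¹' {k} ∩ χ ⁻¹' {c k} = V k := by
    intro k
    rw [hχk]
    ext x
    by_cases hx : x ∈ V k
    · simpa [hx] using hVφ k hx
    · simp [hx, hθc k x]
  have hχ : IsLabelling χ := by
    refine isLabelling_of_singleton fun l => ?_
    have : χ ⁻¹' {l} = ⋃ k, φ ⁻¹' {k} ∩ χ ⁻¹' {l} := by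
      ext x
      simp
    rw [this]
    refine MeasurableSet.iUnion fun k => ?_
    rw [hχk]
    exact (hφ _).inter (((isLabelling_const (c k)).ite (hθ k) (hV k)) _)
  have hjoint : ∀ k l, P.real (φ ⁻¹' {k} ∩ χ ⁻¹' {l}) = law P φ k * w l := by
    intro k l
    by_cases hl : l = c k
    · rw [hl, hcell, hVw]
    · rw [← hθw k l hl, hχk]
      congr 1
      ext x
      by_cases hx : x ∈ V k
      · simp [hx, Ne.symm hl]
      · simp [hx]
  have hlaw : law P χ = w := by
    funext l
    have h1 := hφ.sum_inter_univ (P := P) (hχ {l})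
    rw [law, ← h1]
    simp only [hjoint, ← Finset.sum_mul, hφ.sum_law, one_mul]
  exact ⟨χ, hχ, hlaw, fun k l => by rw [hjoint, hlaw], hcell⟩

theorem IsNonatomic.exists_labelling [Fintype κ] (hP : IsNonatomic P) {w : κ → ℝ}
    (hw : ∀ l, 0 ≤ w l) (hw1 : ∑ l, w l = 1) :
    ∃ θ : Ω → κ, IsLabelling θ ∧ law P θ = w := by
  have hne : (Finset.univ : Finset κ).Nonempty := by
    by_contra h
    rw [Finset.not_nonempty_iff_eq_empty] at h
    rw [h] at hw1
    simp at hw1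
  obtain ⟨θ, h1, -, h3⟩ := hP.exists_split Finset.univ hne w hw Set.univ MeasurableSet.univ
    (by simpa using hw1)
  exact ⟨θ, h1, funext fun l => by simpa [law] using h3 l (Finset.mem_univ l)⟩

/-- Every law is the law of a labelling without empty cells: the labels of probability zero are
placed on pairwise disjoint nonempty null events. -/
theorem IsNonatomic.exists_surjective_labelling [Fintype κ] (hP : IsNonatomic P) {w : κ → ℝ}
    (hw : ∀ l, 0 ≤ w l) (hw1 : ∑ l, w l = 1) :
    ∃ θ : Ω → κ, IsLabelling θ ∧ law P θ = w ∧ Function.Surjective θ := by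
  classical
  have key : ∀ T : Finset κ, ∃ θ : Ω → κ, IsLabelling θ ∧ law P θ = w ∧
      ∀ l ∈ T, w l = 0 → ∃ x, θ x = l := by
    intro T
    induction T using Finset.induction_on with
    | empty =>
      obtain ⟨θ, h1, h2⟩ := hP.exists_labelling hw hw1
      exact ⟨θ, h1, h2, by simp⟩
    | insert a T ha ih =>
      obtain ⟨θ, h1, h2, h3⟩ := ih
      by_cases hwa : w a = 0
      swap
      · refine ⟨θ, h1, h2, fun l hl hl0 => ?_⟩
        rcases Finset.mem_insert.1 hl with rfl | hl
        · exact absurd hl0 hwa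
        · exact h3 l hl hl0
      -- the new null cell is taken from a cell of positive probability
      obtain ⟨b, hb⟩ : ∃ b, w b ≠ 0 := by
        by_contra! hall
        rw [Finset.sum_eq_zero fun l _ => hall l] at hw1
        exact zero_ne_one hw1
      obtain ⟨x, hx⟩ : (θ ⁻¹' {b}).Nonempty :=
        nonempty_of_measureReal_ne_zero (μ := P) (by
          change law P θ b ≠ 0
          rwa [h2])
      obtain ⟨N, hN, hxN, hN0⟩ := hP.exists_null_mem x
      have hx' : θ x = b := hx
      obtain ⟨M, hM⟩ : ∃ M, M = N ∩ θ ⁻¹' {b} := ⟨_, rfl⟩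
      have hMm : MeasurableSet M := hM ▸ hN.inter (h1 _)
      have hM0 : P.real M = 0 := hM ▸ measureReal_mono_null Set.inter_subset_left hN0
      refine ⟨fun y => if y ∈ M then a else θ y, (isLabelling_const a).ite h1 hMm, ?_, ?_⟩
      · rw [← h2]
        funext l
        refine measureReal_congr (measure_symmDiff_eq_zero_iff.1 ?_)
        rw [← measureReal_eq_zero_iff]
        refine measureReal_mono_null (fun y hy => ?_) hM0
        by_contra hyM
        rcases hy with ⟨hy1, hy2⟩ | ⟨hy1, hy2⟩
        · exact hy2 (by simpa [hyM] using hy1)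
        · exact hy2 (by simpa [hyM] using hy1)
      · intro l hl hl0
        rcases Finset.mem_insert.1 hl with rfl | hl
        · exact ⟨x, by simp [hM, hxN, hx']⟩
        · obtain ⟨y, hy⟩ := h3 l hl hl0
          refine ⟨y, ?_⟩
          have : y ∉ M := fun hyM => by
            have h4 : θ y = b := (hM ▸ hyM).2
            rw [hy] at h4
            exact hb (h4 ▸ hl0)
          simp [this, hy]
  obtain ⟨θ, h1, h2, h3⟩ := key Finset.univ
  refine ⟨θ, h1, h2, fun l => ?_⟩
  by_cases hl : w l = 0
  · exact h3 l (Finset.mem_univ l) hl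
  · obtain ⟨x, hx⟩ : (θ ⁻¹' {l}).Nonempty :=
      nonempty_of_measureReal_ne_zero (μ := P) (by
        change law P θ l ≠ 0
        rwa [h2])
    exact ⟨x, hx⟩

end Construct

section Construct

variable {Ω ι κ : Type*} [MeasurableSpace Ω] {P : Measure Ω} [IsProbabilityMeasure P]

/-- An event is independent of a labelling as soon as this holds for all cells but one. -/
theorem inter_eq_mul_of_forall_ne [Finite κ] {A : Set Ω} (hA : MeasurableSet A) {χ : Ω → κ}
    (hχ : IsLabelling χ) (k₀ : κ)
    (h : ∀ k, k ≠ k₀ → P.real (A ∩ χ ⁻¹' {k}) = P.real A * law P χ k) (k : κ) :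
    P.real (A ∩ χ ⁻¹' {k}) = P.real A * law P χ k := by
  classical
  have := Fintype.ofFinite κ
  by_cases hk : k = k₀
  swap
  · exact h k hk
  subst hk
  have h1 := hχ.sum_inter_univ (P := P) hA
  have h2 := hχ.sum_law (P := P)
  rw [← Finset.add_sum_erase _ _ (Finset.mem_univ k)] at h1 h2
  have h3 : ∑ l ∈ Finset.univ.erase k, P.real (χ ⁻¹' {l} ∩ A) =
      P.real A * ∑ l ∈ Finset.univ.erase k, law P χ l := by
    rw [Finset.mul_sum]
    refine Finset.sum_congr rfl fun l hl => ?_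
    rw [Set.inter_comm]
    exact h l (Finset.ne_of_mem_erase hl)
  rw [h3, ← eq_sub_iff_add_eq] at h1
  rw [← eq_sub_iff_add_eq'] at h2
  rw [Set.inter_comm, h1, h2]
  ring

theorem labelIndep_of_forall_ne [Finite ι] [Finite κ] {φ : Ω → ι} {χ : Ω → κ}
    (hφ : IsLabelling φ) (hχ : IsLabelling χ) (i₀ : ι) (k₀ : κ)
    (h : ∀ i k, i ≠ i₀ → k ≠ k₀ → P.real (φ ⁻¹' {i} ∩ χ ⁻¹' {k}) = law P φ i * law P χ k) :
    LabelIndep P φ χ := by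
  intro i k
  refine inter_eq_mul_of_forall_ne (hφ _) hχ k₀ (fun k hk => ?_) k
  rw [Set.inter_comm, mul_comm]
  refine inter_eq_mul_of_forall_ne (hχ _) hφ i₀ (fun i hi => ?_) i
  rw [Set.inter_comm, mul_comm]
  exact h i k hi hk

theorem IsNonatomic.exists_disjoint (hP : IsNonatomic P) {V : Set Ω} (hV : MeasurableSet V) {r : ℝ}
    (h0 : 0 ≤ r) (hr : r ≤ 1 - P.real V) :
    ∃ Z, MeasurableSet Z ∧ Disjoint Z V ∧ P.real Z = r := by
  obtain ⟨Z, h1, h2, h3, -⟩ := hP.exists_near MeasurableSet.empty hV h0 hr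
  exact ⟨Z, h1, h2, h3⟩

theorem IsNonatomic.exists_labelIndep_law [Finite ι] [Fintype κ] [Nontrivial κ]
    (hP : IsNonatomic P) {φ : Ω → ι} (hφ : IsLabelling φ) {w : κ → ℝ} (hw : ∀ l, 0 ≤ w l)
    (hw1 : ∑ l, w l = 1) :
    ∃ χ : Ω → κ, IsLabelling χ ∧ law P χ = w ∧ LabelIndep P φ χ := by
  obtain ⟨l⟩ : Nonempty κ := inferInstance
  have hl1 : w l ≤ 1 := hw1 ▸ Finset.single_le_sum (fun k _ => hw k) (Finset.mem_univ l)
  have hex : ∀ k, ∃ V, MeasurableSet V ∧ V ⊆ φ ⁻¹' {k} ∧ P.real V = law P φ k * w l :=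
    fun k => hP.exists_real_eq (hφ {k}) (mul_nonneg (law_nonneg _ _) (hw l))
      (mul_le_of_le_one_right (law_nonneg _ _) hl1)
  choose V h1 h2 h3 using hex
  obtain ⟨χ, h4, h5, h6, -⟩ := hP.exists_labelIndep hφ hw hw1 (fun _ => l) V h1 h2 h3
  exact ⟨χ, h4, h5, h6⟩

/-- There are events of every probability that are independent of a given labelling. -/
theorem IsNonatomic.exists_indep_event [Finite ι] (hP : IsNonatomic P) {φ : Ω → ι}
    (hφ : IsLabelling φ) {s : ℝ} (h0 : 0 ≤ s) (h1 : s ≤ 1) :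
    ∃ E, MeasurableSet E ∧ ∀ S : Set ι, P.real (φ ⁻¹' S ∩ E) = P.real (φ ⁻¹' S) * s := by
  obtain ⟨χ, h2, h3, h4⟩ := hP.exists_labelIndep_law (κ := Bool) hφ
    (w := fun b => if b then s else 1 - s)
    (fun b => by cases b <;> simp [h0, h1]) (by simp)
  refine ⟨χ ⁻¹' {true}, h2 _, fun S => ?_⟩
  have h5 := h4.independent hφ h2 (φ ⁻¹' S) ((mem_labelAlg hφ).2 ⟨S, rfl⟩) (χ ⁻¹' {true})
    ((mem_labelAlg h2).2 ⟨_, rfl⟩)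
  have h6 : P.real (χ ⁻¹' {true}) = s := by
    have := congrFun h3 true
    simpa [law] using this
  rw [← h6, measureReal_def, h5, ENNReal.toReal_mul]
  rfl

end Construct

/-! ### The entropy gained by exchanging two small events -/

section Gain

variable {Ω : Type*} [MeasurableSpace Ω] {P : Measure Ω} [IsProbabilityMeasure P]
  {I : FiniteSubalgebra Ω → ℝ}

/-- The entropy `I(⟨B, Ω \ B⟩)` as a function of the event `B`. -/
noncomputable def eventEntropy (I : FiniteSubalgebra Ω → ℝ) (B : Set Ω) : ℝ :=
  I (labelAlg fun x => x ∈ B)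

theorem swapCells_mem {Ω : Type*} {B B' X Y : Set Ω} (hX : ∀ x ∈ X, x ∉ B')
    (hY : ∀ x ∈ Y, x ∉ X → x ∈ B') (h : ∀ x, x ∉ X → x ∉ Y → (x ∈ B ↔ x ∈ B')) :
    swapCells (fun x => x ∈ B) X Y True False = fun x => x ∈ B' := by
  funext x
  unfold swapCells
  by_cases h1 : x ∈ X
  · simp [h1, hX x h1]
  · by_cases h2 : x ∈ Y
    · simp [h1, h2, hY x h2 h1]
    · simp [h1, h2, h x h1 h2]

/-- The three-valued labelling with cells `E`, `F` and the complement of `E ∪ F`. -/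
noncomputable def twoSetLabel {Ω : Type*} (E F : Set Ω) : Ω → Option Bool := by
  classical
  exact fun x => if x ∈ E then some true else if x ∈ F then some false else none

theorem isLabelling_twoSetLabel {E F : Set Ω} (hE : MeasurableSet E) (hF : MeasurableSet F) :
    IsLabelling (twoSetLabel E F) :=
  (isLabelling_const _).ite ((isLabelling_const _).ite (isLabelling_const _) hF) hE

theorem twoSetLabel_preimage_true {Ω : Type*} (E F : Set Ω) :
    twoSetLabel E F ⁻¹' {some true} = E := by
  ext x
  by_cases h1 : x ∈ E <;> by_cases h2 : x ∈ F <;> simp [twoSetLabel, h1, h2]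

theorem twoSetLabel_preimage_false {Ω : Type*} {E F : Set Ω} (h : Disjoint E F) :
    twoSetLabel E F ⁻¹' {some false} = F := by
  ext x
  have h' : x ∈ E → x ∉ F := fun hx => Set.disjoint_left.1 h hx
  by_cases h1 : x ∈ E <;> by_cases h2 : x ∈ F <;> simp_all [twoSetLabel]

/-- Exchanging `X` and `Y` in a two-cell partition has the same effect as exchanging them in a
three-cell partition that is independent of it. The probabilities of `X'` and `Y'` are chosen such
that `X ∪ X'` and `Y ∪ Y'` are independent of `X ∪ Z`. The point is that the right-hand side does
not involve `Z`. -/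
theorem eventEntropy_sub_eq_twoSetLabel (hI : IsAdditivePartitionEntropy P I)
    {X Y X' Y' Z : Set Ω} (hX : MeasurableSet X) (hY : MeasurableSet Y) (hX' : MeasurableSet X')
    (hY' : MeasurableSet Y') (hZ : MeasurableSet Z) (hXY : Disjoint X Y)
    (hZXY : Disjoint Z (X ∪ Y)) (hX'd : Disjoint X' (X ∪ Y ∪ Z)) (hY'Z : Y' ⊆ Z) {t q : ℝ}
    (ht0 : 0 < t) (ht1 : t < 1) (hPX : P.real X = q) (hPY : P.real Y = q)
    (hPZ : P.real Z = t - q) (hPX' : P.real X' = q * (1 - t) / t)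
    (hPY' : P.real Y' = q * t / (1 - t)) :
    eventEntropy I (X ∪ Z) - eventEntropy I (Y ∪ Z) =
      I (labelAlg (swapCells (twoSetLabel (X ∪ X') (Y ∪ Y')) X Y (some true) (some false))) -
      I (labelAlg (twoSetLabel (X ∪ X') (Y ∪ Y'))) := by
  have ht1' : 1 - t ≠ 0 := by linarith
  rw [Set.disjoint_left] at hXY hZXY hX'd
  have hEF : Disjoint (X ∪ X') (Y ∪ Y') := by
    rw [Set.disjoint_left]
    rintro x (hx | hx) (hy | hy)
    · exact hXY hx hy
    · exact hZXY (hY'Z hy) (Or.inl hx)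
    · exact hX'd hx (Or.inl (Or.inr hy))
    · exact hX'd hx (Or.inr (hY'Z hy))
  have hφ := isLabelling_mem (hX.union hZ)
  have hχ := isLabelling_twoSetLabel (hX.union hX') (hY.union hY')
  have e1 : (fun x => x ∈ X ∪ Z) ⁻¹' {True} = X ∪ Z := by ext x; simp
  have e2 : (fun x => x ∈ X ∪ Z) ⁻¹' {False} = (X ∪ Z)ᶜ := by ext x; simp
  have e3 := twoSetLabel_preimage_true (X ∪ X') (Y ∪ Y')
  have e4 := twoSetLabel_preimage_false hEF
  have c1 : (X ∪ Z) ∩ (X ∪ X') = X := by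
    ext x
    have := @hX'd x
    simp only [Set.mem_inter_iff, Set.mem_union] at *
    tauto
  have c2 : (X ∪ Z) ∩ (Y ∪ Y') = Y' := by
    ext x
    have h1 := @hXY x
    have h2 := @hZXY x
    have h3 := @hY'Z x
    simp only [Set.mem_inter_iff, Set.mem_union] at *
    tauto
  have c3 : (X ∪ Z)ᶜ ∩ (Y ∪ Y') = Y := by
    ext x
    have h1 := @hXY x
    have h2 := @hZXY x
    have h3 := @hY'Z x
    simp only [Set.mem_inter_iff, Set.mem_union, Set.mem_compl_iff] at *
    tauto
  have m1 : P.real (X ∪ Z) = t := by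
    rw [measureReal_union _ hZ, hPX, hPZ]
    · ring
    · exact Set.disjoint_left.2 fun x hx hz => hZXY hz (Or.inl hx)
  have m2 : P.real (X ∪ X') = q / t := by
    rw [measureReal_union _ hX', hPX, hPX']
    · field_simp
      ring
    · exact Set.disjoint_left.2 fun x hx hz => hX'd hz (Or.inl (Or.inl hx))
  have m3 : P.real (Y ∪ Y') = q / (1 - t) := by
    rw [measureReal_union _ hY', hPY, hPY']
    · field_simp
      ring
    · exact Set.disjoint_left.2 fun x hx hz => hZXY (hY'Z hz) (Or.inr hx)
  have hind : LabelIndep P (fun x => x ∈ X ∪ Z) (twoSetLabel (X ∪ X') (Y ∪ Y')) := by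
    refine labelIndep_of_forall_ne hφ hχ False none fun p k hp hk => ?_
    have hp' : p = True := by simpa using hp
    subst hp'
    rw [law_mem_true, m1, law, e1]
    match k, hk with
    | some true, _ =>
      rw [e3, c1, m2, hPX]
      field_simp
    | some false, _ =>
      rw [e4, c2, m3, hPY']
      ring
  have hswap := (hI.swap_joint hφ hχ hind (i := True) (j := False) (a := some true)
    (b := some false) (X := X) (Y := Y) (by rw [e1, e3, c1]) (by rw [e2, e4, c3])
    (hPX.trans hPY.symm)).1
  rw [swapCells_mem (B' := Y ∪ Z)] at hswap
  · simp only [eventEntropy]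
    linarith
  · rintro x hx (hy | hz)
    · exact hXY hx hy
    · exact hZXY hz (Or.inl hx)
  · exact fun x hx _ => Or.inl hx
  · intro x h1 h2
    simp [h1, h2]

/-- The effect `I(⟨X ∪ Z, ·⟩) - I(⟨Y ∪ Z, ·⟩)` of exchanging two small events does not depend on
`Z`. If `Z₁` and `Z₂` leave room for the auxiliary events of `eventEntropy_sub_eq_twoSetLabel`, this is
immediate; in general one passes through a third event independent of both. -/
theorem eventEntropy_sub_eq_of_disjoint (hP : IsNonatomic P) (hI : IsAdditivePartitionEntropy P I)
    {X Y Z₁ Z₂ : Set Ω} (hX : MeasurableSet X) (hY : MeasurableSet Y) (hZ₁ : MeasurableSet Z₁)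
    (hZ₂ : MeasurableSet Z₂) (hXY : Disjoint X Y) (hd₁ : Disjoint Z₁ (X ∪ Y))
    (hd₂ : Disjoint Z₂ (X ∪ Y)) {t q : ℝ} (ht0 : 0 < t) (ht1 : t < 1) (hPX : P.real X = q)
    (hPY : P.real Y = q) (hPZ₁ : P.real Z₁ = t - q) (hPZ₂ : P.real Z₂ = t - q)
    (hq : 4 * q ≤ t * (1 - t)) :
    eventEntropy I (X ∪ Z₁) - eventEntropy I (Y ∪ Z₁) =
      eventEntropy I (X ∪ Z₂) - eventEntropy I (Y ∪ Z₂) := by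
  have hq0 : 0 ≤ q := hPX ▸ measureReal_nonneg
  have ht1' : 0 < 1 - t := by linarith
  have hqt : 4 * q ≤ t := by nlinarith
  have hqt' : 4 * q ≤ 1 - t := by nlinarith
  -- if there is room for common auxiliary events `X'` and `Y'`, the two effects agree
  have room : ∀ Z Z' : Set Ω, MeasurableSet Z → MeasurableSet Z' → Disjoint Z (X ∪ Y) →
      Disjoint Z' (X ∪ Y) → P.real Z = t - q → P.real Z' = t - q →
      q * t / (1 - t) ≤ P.real (Z ∩ Z') →
      q * (1 - t) / t ≤ P.real ((X ∪ Y ∪ Z) ∪ (X ∪ Y ∪ Z'))ᶜ →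
      eventEntropy I (X ∪ Z) - eventEntropy I (Y ∪ Z) =
        eventEntropy I (X ∪ Z') - eventEntropy I (Y ∪ Z') := by
    intro Z Z' hZ hZ' hd hd' hPZ hPZ' h1 h2
    obtain ⟨Y', hY', hY'Z, hPY'⟩ := hP.exists_real_eq (hZ.inter hZ') (by positivity) h1
    obtain ⟨X', hX', hX'Z, hPX'⟩ := hP.exists_real_eq
      (((hX.union hY).union hZ).union ((hX.union hY).union hZ')).compl (by positivity) h2
    rw [eventEntropy_sub_eq_twoSetLabel hI hX hY hX' hY' hZ hXY hd
        (Set.disjoint_left.2 fun x hx hx' => hX'Z hx (Or.inl hx'))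
        (fun x hx => (hY'Z hx).1) ht0 ht1 hPX hPY hPZ hPX' hPY',
      eventEntropy_sub_eq_twoSetLabel hI hX hY hX' hY' hZ' hXY hd'
        (Set.disjoint_left.2 fun x hx hx' => hX'Z hx (Or.inr hx'))
        (fun x hx => (hY'Z hx).2) ht0 ht1 hPX hPY hPZ' hPX' hPY']
  have hPXY : P.real (X ∪ Y) = 2 * q := by
    rw [measureReal_union hXY hY, hPX, hPY]
    ring
  -- the conditional probability of the third event outside `X ∪ Y`
  have hs0 : 0 ≤ (t - q) / (1 - 2 * q) := div_nonneg (by linarith) (by linarith)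
  have hs1 : (t - q) / (1 - 2 * q) ≤ 1 := by
    rw [div_le_one (by linarith)]
    linarith
  set s := (t - q) / (1 - 2 * q) with hs
  have hs' : s * (1 - 2 * q) = t - q := div_mul_cancel₀ _ (by linarith)
  have hsl : t - q ≤ s := by nlinarith
  have hsl' : 1 - t - q ≤ 1 - s := by nlinarith
  have hφ : IsLabelling fun x => (x ∈ X ∪ Y, x ∈ Z₁, x ∈ Z₂) :=
    (isLabelling_mem (hX.union hY)).pair ((isLabelling_mem hZ₁).pair (isLabelling_mem hZ₂))
  obtain ⟨E, hE, hind⟩ := hP.exists_indep_event hφ hs0 hs1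
  have hindc : ∀ S : Set (Prop × Prop × Prop),
      P.real ((fun x => (x ∈ X ∪ Y, x ∈ Z₁, x ∈ Z₂)) ⁻¹' S ∩ Eᶜ) =
      P.real ((fun x => (x ∈ X ∪ Y, x ∈ Z₁, x ∈ Z₂)) ⁻¹' S) * (1 - s) := by
    intro S
    have h1 := measureReal_inter_add_sdiff (μ := P)
      (s := (fun x => (x ∈ X ∪ Y, x ∈ Z₁, x ∈ Z₂)) ⁻¹' S) hE
    rw [hind] at h1
    rw [← Set.sdiff_eq]
    linarith
  -- the third event
  have hZ₃ : MeasurableSet (E \ (X ∪ Y)) := hE.diff (hX.union hY)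
  have hd₃ : Disjoint (E \ (X ∪ Y)) (X ∪ Y) := Set.disjoint_sdiff_left
  have hPZ₃ : P.real (E \ (X ∪ Y)) = t - q := by
    have h1 := hind {p | ¬ p.1}
    have h2 : (fun x => (x ∈ X ∪ Y, x ∈ Z₁, x ∈ Z₂)) ⁻¹' {p | ¬ p.1} = (X ∪ Y)ᶜ := rfl
    rw [h2, probReal_compl_eq_one_sub (hX.union hY), hPXY] at h1
    rw [Set.sdiff_eq, Set.inter_comm, h1, ← hs']
    ring
  have hr1 : q * t / (1 - t) ≤ s * (t - q) := by
    rw [div_le_iff₀ ht1']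
    have h1 : (t - q) * (t - q) ≤ s * (t - q) :=
      mul_le_mul_of_nonneg_right hsl (by linarith)
    have h2 : (3 / 4 * t) * (3 / 4 * t) ≤ (t - q) * (t - q) :=
      mul_self_le_mul_self (by linarith) (by linarith)
    have h3 : q * t ≤ (3 / 4 * t) * (3 / 4 * t) * (1 - t) := by nlinarith [mul_pos ht0 ht1']
    nlinarith
  have hr2 : q * (1 - t) / t ≤ (1 - s) * (1 - t - q) := by
    rw [div_le_iff₀ ht0]
    have h1 : (1 - t - q) * (1 - t - q) ≤ (1 - s) * (1 - t - q) :=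
      mul_le_mul_of_nonneg_right hsl' (by linarith)
    have h2 : (3 / 4 * (1 - t)) * (3 / 4 * (1 - t)) ≤ (1 - t - q) * (1 - t - q) :=
      mul_self_le_mul_self (by linarith) (by linarith)
    have h3 : q * (1 - t) ≤ (3 / 4 * (1 - t)) * (3 / 4 * (1 - t)) * t := by
      nlinarith [mul_pos ht0 ht1']
    nlinarith
  have via : ∀ (Z : Set Ω) (S : Set (Prop × Prop × Prop)), MeasurableSet Z →
      Disjoint Z (X ∪ Y) → P.real Z = t - q →
      (fun x => (x ∈ X ∪ Y, x ∈ Z₁, x ∈ Z₂)) ⁻¹' S = Z →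
      (∀ p, p.1 → p ∉ S) →
      eventEntropy I (X ∪ Z) - eventEntropy I (Y ∪ Z) =
        eventEntropy I (X ∪ (E \ (X ∪ Y))) - eventEntropy I (Y ∪ (E \ (X ∪ Y))) := by
    intro Z S hZ hd hPZ hS hS1
    have hd' := Set.disjoint_left.1 hd
    refine room _ _ hZ hZ₃ hd hd₃ hPZ hPZ₃ ?_ ?_
    · have h1 : Z ∩ (E \ (X ∪ Y)) = Z ∩ E := by
        ext x
        have := @hd' x
        simp only [Set.mem_inter_iff, Set.mem_sdiff] at *
        tauto
      rw [h1, ← hS, hind, hS, hPZ]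
      linarith
    · have h1 : ((X ∪ Y ∪ Z) ∪ (X ∪ Y ∪ (E \ (X ∪ Y))))ᶜ =
          (fun x => (x ∈ X ∪ Y, x ∈ Z₁, x ∈ Z₂)) ⁻¹' {p | ¬ p.1 ∧ p ∉ S} ∩ Eᶜ := by
        ext x
        have hx : (x ∈ X ∪ Y, x ∈ Z₁, x ∈ Z₂) ∈ S ↔ x ∈ Z := by rw [← hS]; rfl
        simp only [Set.mem_compl_iff, Set.mem_union, Set.mem_sdiff, Set.mem_inter_iff,
          Set.mem_preimage, Set.mem_ofPred_eq] at hx ⊢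
        rw [hx]
        tauto
      have h2 : (fun x => (x ∈ X ∪ Y, x ∈ Z₁, x ∈ Z₂)) ⁻¹' {p | ¬ p.1 ∧ p ∉ S} =
          (X ∪ Y ∪ Z)ᶜ := by
        ext x
        have hx : (x ∈ X ∪ Y, x ∈ Z₁, x ∈ Z₂) ∈ S ↔ x ∈ Z := by rw [← hS]; rfl
        simp only [Set.mem_compl_iff, Set.mem_union,
          Set.mem_preimage, Set.mem_ofPred_eq] at hx ⊢
        rw [hx]
        tauto
      rw [h1, hindc, h2, probReal_compl_eq_one_sub ((hX.union hY).union hZ),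
        measureReal_union hd.symm hZ, hPXY, hPZ]
      linarith
  have mem1 : ∀ Z : Set Ω, Disjoint Z (X ∪ Y) → ∀ x, ¬ x ∈ X ∪ Y ∧ x ∈ Z ↔ x ∈ Z :=
    fun Z hd x => ⟨fun h => h.2, fun h => ⟨Set.disjoint_left.1 hd h, h⟩⟩
  rw [via Z₁ {p | ¬ p.1 ∧ p.2.1} hZ₁ hd₁ hPZ₁ (Set.ext (mem1 _ hd₁)) (fun p h h' => h'.1 h),
    via Z₂ {p | ¬ p.1 ∧ p.2.2} hZ₂ hd₂ hPZ₂ (Set.ext (mem1 _ hd₂)) (fun p h h' => h'.1 h)]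

/-- The entropy gained when `Y` is replaced by `X` in an event `Y ∪ Z` of probability `t`, where `Z`
is disjoint from `X ∪ Y`; for small `X` and `Y` the choice of `Z` is immaterial. -/
noncomputable def swapGain (P : Measure Ω) (I : FiniteSubalgebra Ω → ℝ) (t : ℝ) (X Y : Set Ω) :
    ℝ := by
  classical
  exact if h : ∃ Z, MeasurableSet Z ∧ Disjoint Z (X ∪ Y) ∧ P.real Z = t - P.real X then
    eventEntropy I (X ∪ h.choose) - eventEntropy I (Y ∪ h.choose) else 0

theorem swapGain_eq (hP : IsNonatomic P) (hI : IsAdditivePartitionEntropy P I) {X Y Z : Set Ω}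
    (hX : MeasurableSet X) (hY : MeasurableSet Y) (hZ : MeasurableSet Z)
    (hd : Disjoint Z (X ∪ Y)) {t : ℝ} (ht0 : 0 < t) (ht1 : t < 1)
    (hXY : P.real X = P.real Y) (hPZ : P.real Z = t - P.real X)
    (hq : 4 * P.real X ≤ t * (1 - t)) :
    swapGain P I t X Y = eventEntropy I (X ∪ Z) - eventEntropy I (Y ∪ Z) := by
  have h : ∃ Z, MeasurableSet Z ∧ Disjoint Z (X ∪ Y) ∧ P.real Z = t - P.real X :=
    ⟨Z, hZ, hd, hPZ⟩
  rw [swapGain, dif_pos h]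
  obtain ⟨hZ', hd', hPZ'⟩ := h.choose_spec
  set Z' := h.choose
  -- the common part of `X` and `Y` is moved to `Z`
  have e : ∀ A B C : Set Ω, A ∪ C = (A \ B) ∪ (C ∪ (A ∩ B)) := by
    intro A B C
    ext x
    simp only [Set.mem_union, Set.mem_sdiff, Set.mem_inter_iff]
    tauto
  have hdiff : ∀ C : Set Ω, Disjoint C (X ∪ Y) →
      Disjoint (C ∪ (X ∩ Y)) ((X \ Y) ∪ (Y \ X)) := by
    intro C hC
    rw [Set.disjoint_left] at *
    intro x
    have := @hC x
    simp only [Set.mem_union, Set.mem_sdiff, Set.mem_inter_iff] at *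
    tauto
  have hm1 := measureReal_inter_add_sdiff (μ := P) (s := X) hY
  have hm2 := measureReal_inter_add_sdiff (μ := P) (s := Y) hX
  rw [Set.inter_comm] at hm2
  have hm3 : ∀ C : Set Ω, Disjoint C (X ∪ Y) →
      P.real (C ∪ (X ∩ Y)) = P.real C + P.real (X ∩ Y) := by
    intro C hC
    exact measureReal_union (hC.mono_right (Set.inter_subset_left.trans Set.subset_union_left))
      (hX.inter hY)
  rw [e X Y Z, e X Y Z', e Y X Z, e Y X Z', Set.inter_comm Y X]
  exact eventEntropy_sub_eq_of_disjoint hP hI (hX.diff hY) (hY.diff hX) (hZ'.union (hX.inter hY))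
    (hZ.union (hX.inter hY)) (Set.disjoint_left.2 fun x h1 h2 => h1.2 h2.1) (hdiff _ hd')
    (hdiff _ hd) ht0 ht1 rfl (by linarith) (by rw [hm3 _ hd', hPZ']; linarith)
    (by rw [hm3 _ hd, hPZ]; linarith)
    (by linarith [measureReal_nonneg (μ := P) (s := X ∩ Y)])

theorem four_mul_le_bounds {t q : ℝ} (ht0 : 0 < t) (ht1 : t < 1) (hq : 4 * q ≤ t * (1 - t)) :
    4 * q ≤ t ∧ 4 * q ≤ 1 - t := by
  constructor <;> nlinarith

/-- Replacing `W` by `X` can be done in two steps, as one `Z` serves for all three events. -/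
theorem swapGain_cocycle (hP : IsNonatomic P) (hI : IsAdditivePartitionEntropy P I)
    {X Y W : Set Ω} (hX : MeasurableSet X) (hY : MeasurableSet Y) (hW : MeasurableSet W)
    {t : ℝ} (ht0 : 0 < t) (ht1 : t < 1) (hXY : P.real X = P.real Y) (hYW : P.real Y = P.real W)
    (hq : 4 * P.real X ≤ t * (1 - t)) :
    swapGain P I t X Y + swapGain P I t Y W = swapGain P I t X W := by
  obtain ⟨hb1, hb2⟩ := four_mul_le_bounds ht0 ht1 hq
  have hle : P.real (X ∪ Y ∪ W) ≤ 3 * P.real X := by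
    have h1 := measureReal_union_le (μ := P) (X ∪ Y) W
    have h2 := measureReal_union_le (μ := P) X Y
    linarith
  have hX0 : 0 ≤ P.real X := measureReal_nonneg
  obtain ⟨Z, hZ, hd, hPZ⟩ := hP.exists_disjoint ((hX.union hY).union hW) (r := t - P.real X)
    (by linarith) (by linarith)
  rw [swapGain_eq hP hI hX hY hZ (hd.mono_right Set.subset_union_left) ht0 ht1 hXY hPZ hq,
    swapGain_eq hP hI hY hW hZ (hd.mono_right
      (Set.union_subset_union_left _ Set.subset_union_right)) ht0 ht1 hYW (by linarith)
      (by linarith),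
    swapGain_eq hP hI hX hW hZ (hd.mono_right
      (Set.union_subset_union_left _ Set.subset_union_left)) ht0 ht1 (hXY.trans hYW) hPZ hq]
  ring

theorem swapGain_self (hP : IsNonatomic P) (hI : IsAdditivePartitionEntropy P I)
    {X : Set Ω} (hX : MeasurableSet X) {t : ℝ} (ht0 : 0 < t) (ht1 : t < 1)
    (hq : 4 * P.real X ≤ t * (1 - t)) : swapGain P I t X X = 0 := by
  have := swapGain_cocycle hP hI hX hX hX ht0 ht1 rfl rfl hq
  linarith

/-- If the new event is disjoint from the old one, the exchange is done in two steps with a common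
`Z`; the general case follows through a third event by the cocycle relation. -/
theorem swapGain_union (hP : IsNonatomic P) (hI : IsAdditivePartitionEntropy P I)
    {X₁ X₂ Y₁ Y₂ : Set Ω} (hX₁ : MeasurableSet X₁) (hX₂ : MeasurableSet X₂)
    (hY₁ : MeasurableSet Y₁) (hY₂ : MeasurableSet Y₂) (hdX : Disjoint X₁ X₂)
    (hdY : Disjoint Y₁ Y₂) {t : ℝ} (ht0 : 0 < t) (ht1 : t < 1) (h₁ : P.real X₁ = P.real Y₁)
    (h₂ : P.real X₂ = P.real Y₂) (hq : 4 * (P.real X₁ + P.real X₂) ≤ t * (1 - t)) :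
    swapGain P I t (X₁ ∪ X₂) (Y₁ ∪ Y₂) = swapGain P I t X₁ Y₁ + swapGain P I t X₂ Y₂ := by
  obtain ⟨hb1, hb2⟩ := four_mul_le_bounds ht0 ht1 hq
  have hX₁0 : 0 ≤ P.real X₁ := measureReal_nonneg
  have hX₂0 : 0 ≤ P.real X₂ := measureReal_nonneg
  -- the case in which the new event is disjoint from the old one
  have disj : ∀ A₁ A₂ W₁ W₂ : Set Ω, MeasurableSet A₁ → MeasurableSet A₂ → MeasurableSet W₁ →
      MeasurableSet W₂ → Disjoint A₁ A₂ → Disjoint W₁ W₂ → Disjoint (A₁ ∪ A₂) (W₁ ∪ W₂) →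
      P.real A₁ = P.real X₁ → P.real A₂ = P.real X₂ → P.real W₁ = P.real X₁ →
      P.real W₂ = P.real X₂ →
      swapGain P I t (A₁ ∪ A₂) (W₁ ∪ W₂) = swapGain P I t A₁ W₁ + swapGain P I t A₂ W₂ := by
    intro A₁ A₂ W₁ W₂ hA₁ hA₂ hW₁ hW₂ hdA hdW hAW e1 e2 e3 e4
    have mA : P.real (A₁ ∪ A₂) = P.real X₁ + P.real X₂ := by
      rw [measureReal_union hdA hA₂, e1, e2]
    have mW : P.real (W₁ ∪ W₂) = P.real X₁ + P.real X₂ := by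
      rw [measureReal_union hdW hW₂, e3, e4]
    have hle := measureReal_union_le (μ := P) (A₁ ∪ A₂) (W₁ ∪ W₂)
    obtain ⟨Z, hZ, hd, hPZ⟩ := hP.exists_disjoint ((hA₁.union hA₂).union (hW₁.union hW₂))
      (r := t - (P.real X₁ + P.real X₂)) (by linarith) (by linarith)
    rw [Set.disjoint_left] at hd hAW hdA hdW
    have g1 : P.real (A₂ ∪ Z) = t - P.real A₁ := by
      rw [measureReal_union (Set.disjoint_left.2 fun x h h' => hd h' (Or.inl (Or.inr h))) hZ, e1,
        e2, hPZ]
      ring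
    have g2 : P.real (W₁ ∪ Z) = t - P.real A₂ := by
      rw [measureReal_union (Set.disjoint_left.2 fun x h h' => hd h' (Or.inr (Or.inl h))) hZ, e2,
        e3, hPZ]
      ring
    rw [swapGain_eq hP hI (hA₁.union hA₂) (hW₁.union hW₂) hZ (Set.disjoint_left.2 hd) ht0 ht1
        (mA.trans mW.symm) (by rw [mA, hPZ]) (by rw [mA]; exact hq),
      swapGain_eq hP hI hA₁ hW₁ (hA₂.union hZ) (Set.disjoint_left.2 fun x => by
        have h1 := @hd x
        have h2 := @hAW x
        have h3 := @hdA x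
        simp only [Set.mem_union] at *
        tauto) ht0 ht1 (e1.trans e3.symm) g1 (by linarith),
      swapGain_eq hP hI hA₂ hW₂ (hW₁.union hZ) (Set.disjoint_left.2 fun x => by
        have h1 := @hd x
        have h2 := @hAW x
        have h3 := @hdW x
        simp only [Set.mem_union] at *
        tauto) ht0 ht1 (e2.trans e4.symm) g2 (by linarith)]
    have s1 : W₁ ∪ (A₂ ∪ Z) = A₂ ∪ (W₁ ∪ Z) := Set.union_left_comm _ _ _
    have s2 : W₂ ∪ (W₁ ∪ Z) = W₁ ∪ W₂ ∪ Z := by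
      rw [Set.union_left_comm, Set.union_assoc]
    rw [s1, s2, Set.union_assoc A₁]
    ring
  have mX : P.real (X₁ ∪ X₂) = P.real X₁ + P.real X₂ := measureReal_union hdX hX₂
  have mY : P.real (Y₁ ∪ Y₂) = P.real X₁ + P.real X₂ := by
    rw [measureReal_union hdY hY₂, h₁, h₂]
  have hle := measureReal_union_le (μ := P) (X₁ ∪ X₂) (Y₁ ∪ Y₂)
  obtain ⟨W₁, hW₁, hdW₁, hPW₁⟩ := hP.exists_disjoint ((hX₁.union hX₂).union (hY₁.union hY₂))
    (r := P.real X₁) hX₁0 (by linarith)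
  have hle' := measureReal_union_le (μ := P) (X₁ ∪ X₂ ∪ (Y₁ ∪ Y₂)) W₁
  obtain ⟨W₂, hW₂, hdW₂, hPW₂⟩ := hP.exists_disjoint
    (((hX₁.union hX₂).union (hY₁.union hY₂)).union hW₁)
    (r := P.real X₂) hX₂0 (by linarith)
  have hdW : Disjoint W₁ W₂ := (hdW₂.mono_right Set.subset_union_right).symm
  have mW : P.real (W₁ ∪ W₂) = P.real X₁ + P.real X₂ := by
    rw [measureReal_union hdW hW₂, hPW₁, hPW₂]
  have hdX' : Disjoint (X₁ ∪ X₂) (W₁ ∪ W₂) := by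
    refine (Set.disjoint_union_left.2 ⟨?_, ?_⟩).symm
    · exact hdW₁.mono_right Set.subset_union_left
    · exact hdW₂.mono_right (Set.subset_union_left.trans Set.subset_union_left)
  have hdY' : Disjoint (Y₁ ∪ Y₂) (W₁ ∪ W₂) := by
    refine (Set.disjoint_union_left.2 ⟨?_, ?_⟩).symm
    · exact hdW₁.mono_right Set.subset_union_right
    · exact hdW₂.mono_right (Set.subset_union_right.trans Set.subset_union_left)
  have k1 := disj X₁ X₂ W₁ W₂ hX₁ hX₂ hW₁ hW₂ hdX hdW hdX' rfl rfl hPW₁ hPW₂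
  have k2 := disj Y₁ Y₂ W₁ W₂ hY₁ hY₂ hW₁ hW₂ hdY hdW hdY' h₁.symm h₂.symm hPW₁ hPW₂
  have k3 := swapGain_cocycle hP hI (hX₁.union hX₂) (hY₁.union hY₂) (hW₁.union hW₂) ht0 ht1
    (mX.trans mY.symm) (mY.trans mW.symm) (by rw [mX]; exact hq)
  have k4 := swapGain_cocycle hP hI hX₁ hY₁ hW₁ ht0 ht1 h₁ (h₁.symm.trans hPW₁.symm)
    (by linarith)
  have k5 := swapGain_cocycle hP hI hX₂ hY₂ hW₂ ht0 ht1 h₂ (h₂.symm.trans hPW₂.symm)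
    (by linarith)
  linarith

/-- The sequential continuity hypothesis in its `ε`-`δ` form. -/
theorem eventEntropy_continuousAt (hIc : IsContinuousOnTwoAtom P I) {A : Set Ω}
    (hA : MeasurableSet A) (h0 : 0 < P.real A) (h1 : P.real A < 1) {ε : ℝ} (hε : 0 < ε) :
    ∃ δ : ℝ, 0 < δ ∧ ∀ B, MeasurableSet B → P.real (symmDiff A B) < δ →
      |eventEntropy I B - eventEntropy I A| < ε := by
  by_contra! hcon
  have hex : ∀ n : ℕ, ∃ B, MeasurableSet B ∧ P.real (symmDiff A B) < 1 / ((n : ℝ) + 1) ∧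
      ε ≤ |eventEntropy I B - eventEntropy I A| := fun n => hcon _ (by positivity)
  choose B hB hBA hBε using hex
  have hlim : Filter.Tendsto (fun n => P (symmDiff A (B n))) Filter.atTop (nhds 0) := by
    rw [← ENNReal.tendsto_toReal_iff (fun n => measure_ne_top _ _) ENNReal.zero_ne_top]
    exact squeeze_zero (fun n => ENNReal.toReal_nonneg) (fun n => (hBA n).le)
      tendsto_one_div_add_atTop_nhds_zero_nat
  have hPA1 : P A < 1 := by
    rw [← ENNReal.toReal_lt_toReal (measure_ne_top _ _) ENNReal.one_ne_top]
    exact h1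
  have key := hIc A hA B hB (ENNReal.toReal_pos_iff.1 h0).1 hPA1 hlim
  simp only [twoAtom_eq_labelAlg] at key
  obtain ⟨n, hn⟩ := (Metric.tendsto_nhds.1 key ε hε).exists
  exact absurd hn (not_lt.2 (hBε n))

/-- The gain is small for small events, uniformly for `t` near a given `t₀`. -/
theorem swapGain_small (hP : IsNonatomic P) (hI : IsAdditivePartitionEntropy P I)
    (hIc : IsContinuousOnTwoAtom P I) {t₀ : ℝ} (ht0 : 0 < t₀) (ht1 : t₀ < 1) {ε : ℝ}
    (hε : 0 < ε) :
    ∃ δ : ℝ, 0 < δ ∧ ∀ t, |t - t₀| ≤ δ → 0 < t ∧ t < 1 ∧ 4 * δ ≤ t * (1 - t) ∧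
      ∀ X Y : Set Ω, MeasurableSet X → MeasurableSet Y → P.real X = P.real Y → P.real X ≤ δ →
        |swapGain P I t X Y| ≤ ε := by
  obtain ⟨A, hA, -, hPA⟩ := hP.exists_real_eq MeasurableSet.univ ht0.le (by simpa using ht1.le)
  obtain ⟨η, hη, hcont⟩ := eventEntropy_continuousAt hIc hA (by linarith) (by linarith)
    (half_pos hε)
  have hpos : 0 < t₀ * (1 - t₀) := mul_pos ht0 (by linarith)
  obtain ⟨δ, hδ, hδη, hδt⟩ : ∃ δ : ℝ, 0 < δ ∧ 8 * δ ≤ η ∧ 8 * δ ≤ t₀ * (1 - t₀) :=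
    ⟨min (η / 8) (t₀ * (1 - t₀) / 8), by positivity, by
      have := min_le_left (η / 8) (t₀ * (1 - t₀) / 8)
      linarith, by
      have := min_le_right (η / 8) (t₀ * (1 - t₀) / 8)
      linarith⟩
  refine ⟨δ, hδ, fun t ht => ?_⟩
  obtain ⟨hl, hu⟩ := abs_le.1 ht
  have hb1 : 8 * δ ≤ t₀ := by nlinarith
  have hb2 : 8 * δ ≤ 1 - t₀ := by nlinarith
  have h4 : 4 * δ ≤ t * (1 - t) := by
    have e : t * (1 - t) = t₀ * (1 - t₀) + (t - t₀) * (1 - 2 * t₀) - (t - t₀) ^ 2 := by ring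
    have e2 : |(t - t₀) * (1 - 2 * t₀)| ≤ δ * 1 := by
      rw [abs_mul]
      exact mul_le_mul ht (abs_le.2 ⟨by linarith, by linarith⟩) (abs_nonneg _) hδ.le
    have e3 := (abs_le.1 e2).1
    have e4 : (t - t₀) ^ 2 ≤ δ := by nlinarith
    linarith
  refine ⟨by linarith, by linarith, h4, fun X Y hX hY hXY hXδ => ?_⟩
  have ht0' : 0 < t := by linarith
  have ht1' : t < 1 := by linarith
  have hle := measureReal_union_le (μ := P) X Y
  have hX0 : 0 ≤ P.real X := measureReal_nonneg
  obtain ⟨Z, hZ, hd, hPZ, hnear⟩ := hP.exists_near hA (hX.union hY) (r := t - P.real X)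
    (by linarith) (by linarith)
  have habs : |t - P.real X - P.real A| ≤ 2 * δ := by
    rw [hPA, abs_le]
    constructor <;> linarith
  rw [swapGain_eq hP hI hX hY hZ hd ht0' ht1' hXY hPZ (by linarith)]
  have hclose : ∀ V : Set Ω, P.real V ≤ δ → P.real (symmDiff A (V ∪ Z)) < η := by
    intro V hV
    have h1 : symmDiff A (V ∪ Z) ⊆ V ∪ symmDiff Z A := by
      intro x
      simp only [Set.mem_symmDiff, Set.mem_union]
      tauto
    have h2 := measureReal_mono (μ := P) h1
    have h3 := measureReal_union_le (μ := P) V (symmDiff Z A)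
    linarith
  have k1 := abs_lt.1 (hcont _ (hX.union hZ) (hclose X hXδ))
  have k2 := abs_lt.1 (hcont _ (hY.union hZ) (hclose Y (hXY ▸ hXδ)))
  rw [abs_le]
  constructor <;> linarith

end Gain

section Gain

variable {Ω ι κ : Type*} [MeasurableSpace Ω] {P : Measure Ω} [IsProbabilityMeasure P]
  {I : FiniteSubalgebra Ω → ℝ}

/-- Labellings whose joint law is a product are independent. The sums of the factors are quantified
over all finite sets that contain every label, so that no `Fintype` instance enters. -/
theorem labelIndep_of_law_eq_mul [Finite ι] [Finite κ] {φ : Ω → ι} {χ : Ω → κ}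
    (hφ : IsLabelling φ) (hχ : IsLabelling χ) {u : ι → ℝ} {v : κ → ℝ}
    (hlaw : ∀ i k, law P (fun x => (φ x, χ x)) (i, k) = u i * v k)
    (hu : ∀ s : Finset ι, (∀ i, i ∈ s) → ∑ i ∈ s, u i = 1)
    (hv : ∀ s : Finset κ, (∀ k, k ∈ s) → ∑ k ∈ s, v k = 1) :
    LabelIndep P φ χ ∧ law P φ = u ∧ law P χ = v := by
  have := Fintype.ofFinite ι
  have := Fintype.ofFinite κ
  have hj : ∀ i k, P.real (φ ⁻¹' {i} ∩ χ ⁻¹' {k}) = u i * v k := by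
    intro i k
    rw [← hlaw]
    unfold law
    congr 1
    ext x
    simp [Prod.ext_iff]
  have h1 : law P φ = u := by
    funext i
    have e := hχ.sum_inter_univ (P := P) (hφ {i})
    rw [law, ← e]
    simp only [Set.inter_comm (χ ⁻¹' _), hj, ← Finset.mul_sum, hv _ (Finset.mem_univ), mul_one]
  have h2 : law P χ = v := by
    funext i
    have e := hφ.sum_inter_univ (P := P) (hχ {i})
    rw [law, ← e]
    simp only [hj, ← Finset.sum_mul, hu _ (Finset.mem_univ), one_mul]
  exact ⟨fun i k => by rw [hj, h1, h2], h1, h2⟩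

theorem LabelIndep.law_pair {P : Measure Ω} {φ : Ω → ι} {χ : Ω → κ} (h : LabelIndep P φ χ)
    (i : ι) (k : κ) : law P (fun x => (φ x, χ x)) (i, k) = law P φ i * law P χ k := by
  rw [← h]
  unfold law
  congr 1
  ext x
  simp [Prod.ext_iff]

/-- Additivity for a single labelling by pairs whose law is a product. -/
theorem IsAdditivePartitionEntropy.fst_add_snd [Fintype ι] [Fintype κ]
    (hI : IsAdditivePartitionEntropy P I) {χ : Ω → ι × κ} (hχ : IsLabelling χ) {u : ι → ℝ}
    {v : κ → ℝ} (hlaw : ∀ i k, law P χ (i, k) = u i * v k)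
    (hu : ∑ i, u i = 1) (hv : ∑ k, v k = 1) :
    I (labelAlg χ) = I (labelAlg fun x => (χ x).1) + I (labelAlg fun x => (χ x).2) := by
  have h := labelIndep_of_law_eq_mul (P := P) (hχ.comp Prod.fst) (hχ.comp Prod.snd) (u := u)
    (v := v) hlaw
    (fun s hs => by rw [Finset.eq_univ_iff_forall.2 hs, hu])
    (fun s hs => by rw [Finset.eq_univ_iff_forall.2 hs, hv])
  exact hI.pair (hχ.comp Prod.fst) (hχ.comp Prod.snd) h.1

/-- Exchanging small parts of two cells of an arbitrary partition has the same effect as exchanging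
them between two cells, with the same ratio of probabilities, of a two-cell partition. For the
proof, the given partition is joined with an independent one into four cells `C ∩ D`, `Cᶜ ∩ D`,
`C ∩ Dᶜ`, `Cᶜ ∩ Dᶜ`, where `C` has the right ratio of probabilities and `D` adjusts the size, such
that the sets to be exchanged are whole cells of the joint partition. -/
theorem entropy_sub_swapCells [Finite ι] (hP : IsNonatomic P)
    (hI : IsAdditivePartitionEntropy P I) {φ : Ω → ι} (hφ : IsLabelling φ) {i j : ι} (hij : i ≠ j)
    {X Y : Set Ω} (hX : MeasurableSet X) (hY : MeasurableSet Y) (hXi : X ⊆ φ ⁻¹' {i})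
    (hYj : Y ⊆ φ ⁻¹' {j}) (hXY : P.real X = P.real Y) (hi : 0 < law P φ i) (hj : 0 < law P φ j)
    (hij1 : law P φ i + law P φ j ≤ 1) (hq : 4 * P.real X ≤ law P φ i * law P φ j) :
    I (labelAlg φ) - I (labelAlg (swapCells φ X Y i j)) =
      swapGain P I (law P φ i / (law P φ i + law P φ j)) X Y ∧
    law P (swapCells φ X Y i j) = law P φ := by
  classical
  set pi := law P φ i with hpi
  set pj := law P φ j with hpj
  set q := P.real X with hqdef
  have hs : 0 < pi + pj := by linarith
  set t := pi / (pi + pj) with ht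
  have ht0 : 0 < t := div_pos hi hs
  have ht' : 1 - t = pj / (pi + pj) := by
    rw [ht]
    field_simp
    ring
  have ht1 : t < 1 := by
    have : 0 < 1 - t := ht' ▸ div_pos hj hs
    linarith
  have hq0 : 0 ≤ q := measureReal_nonneg
  have hpp : 0 < pi * pj := mul_pos hi hj
  -- the probability of `D`, for which the cells `C ∩ D` and `Cᶜ ∩ D` meet the cells `j` and `i` of
  -- `φ` in events of probability `q`
  set d := q * (pi + pj) / (pi * pj) with hd
  have hd0 : 0 ≤ d := by positivity
  have hd1 : d ≤ 1 := by
    rw [hd, div_le_one hpp]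
    nlinarith
  have hqt : 4 * q ≤ t * (1 - t) := by
    rw [ht', ht, div_mul_div_comm, le_div_iff₀ (by positivity)]
    nlinarith [mul_nonneg hq0 (mul_self_nonneg (1 - (pi + pj))), mul_nonneg hq0 hs.le,
      mul_nonneg (mul_nonneg hq0 hs.le) (sub_nonneg.2 hij1)]
  let u : Bool → ℝ := fun b => if b then t else 1 - t
  let v : Bool → ℝ := fun b => if b then d else 1 - d
  have hu : ∑ b, u b = 1 := by simp [u]
  have hv : ∑ b, v b = 1 := by simp [v]
  have hw : ∀ l : Bool × Bool, 0 ≤ u l.1 * v l.2 := by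
    rintro ⟨a, b⟩
    refine mul_nonneg ?_ ?_
    · cases a <;> simp [u] <;> linarith
    · cases b <;> simp [v] <;> linarith
  have hw1 : ∑ l : Bool × Bool, u l.1 * v l.2 = 1 := by
    rw [Fintype.sum_prod_type]
    simp only [← Finset.mul_sum, hv, hu, mul_one]
  let c : ι → Bool × Bool := fun k => if k = j then (true, true) else (false, true)
  have hle : ∀ l : Bool × Bool, u l.1 * v l.2 ≤ 1 := fun l =>
    hw1 ▸ Finset.single_le_sum (f := fun l : Bool × Bool => u l.1 * v l.2) (fun k _ => hw k)
      (Finset.mem_univ l)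
  have hex : ∀ k, ∃ V, MeasurableSet V ∧ V ⊆ φ ⁻¹' {k} ∧
      P.real V = law P φ k * (u (c k).1 * v (c k).2) ∧ (k = i → V = X) ∧ (k = j → V = Y) := by
    intro k
    by_cases hki : k = i
    · subst hki
      refine ⟨X, hX, hXi, ?_, fun _ => rfl, fun h => absurd h hij⟩
      simp only [c, hij, if_false, u, v, if_true, ← hpi, ← hqdef, ht', hd]
      simp only [Bool.false_eq_true, if_false]
      field_simp
    · by_cases hkj : k = j
      · subst hkj
        refine ⟨Y, hY, hYj, ?_, fun h => absurd h hki, fun _ => rfl⟩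
        rw [← hXY]
        simp only [c, if_true, u, v, ← hpj, ht, hd]
        field_simp
      · obtain ⟨V, h1, h2, h3⟩ := hP.exists_real_eq (hφ {k})
          (mul_nonneg (law_nonneg (P := P) φ k) (hw (c k)))
          (mul_le_of_le_one_right (law_nonneg _ _) (hle (c k)))
        exact ⟨V, h1, h2, h3, fun h => absurd h hki, fun h => absurd h hkj⟩
  choose V hV1 hV2 hV3 hVi hVj using hex
  obtain ⟨χ, hχ, hχlaw, hind, hcell⟩ := hP.exists_labelIndep hφ hw hw1 c V hV1 hV2 hV3
  have hXc : X = φ ⁻¹' {i} ∩ χ ⁻¹' {(false, true)} := by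
    have := hcell i
    rw [hVi i rfl] at this
    simpa [c, hij] using this.symm
  have hYc : Y = φ ⁻¹' {j} ∩ χ ⁻¹' {(true, true)} := by
    have := hcell j
    rw [hVj j rfl] at this
    simpa [c] using this.symm
  obtain ⟨k1, k2, k3, -⟩ := hI.swap_joint hφ hχ hind hXc hYc hXY
  refine ⟨?_, k2⟩
  have hχ' : IsLabelling (swapCells χ X Y (false, true) (true, true)) := hχ.swapCells hX hY _ _
  have a1 := hI.fst_add_snd hχ (u := u) (v := v) (fun a b => by rw [hχlaw]) hu hv
  have a2 := hI.fst_add_snd hχ' (u := u) (v := v) (fun a b => by rw [k3, hχlaw]) hu hv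
  have hXχ : ∀ x ∈ X, χ x = (false, true) := fun x hx => by
    rw [hXc] at hx
    exact hx.2
  have hYχ : ∀ x ∈ Y, χ x = (true, true) := fun x hx => by
    rw [hYc] at hx
    exact hx.2
  have hXY' : ∀ x ∈ X, x ∉ Y := fun x hx hy => by
    have := hXχ x hx
    rw [hYχ x hy] at this
    simp at this
  -- the exchange does not affect `D`
  have a3 : (fun x => (swapCells χ X Y (false, true) (true, true) x).2) = fun x => (χ x).2 := by
    funext x
    unfold swapCells
    by_cases h1 : x ∈ X
    · simp [h1, hXχ x h1]
    · by_cases h2 : x ∈ Y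
      · simp [h1, h2, hYχ x h2]
      · simp [h1, h2]
  obtain ⟨Z, hZ⟩ : ∃ Z, Z = (fun x => (χ x).1) ⁻¹' {true} \ Y := ⟨_, rfl⟩
  have hZm : MeasurableSet Z := hZ ▸ ((hχ.comp Prod.fst) _).diff hY
  have hZmem : ∀ x, x ∈ Z ↔ (χ x).1 = true ∧ x ∉ Y := fun x => by rw [hZ]; rfl
  have a4 : I (labelAlg fun x => (χ x).1) = eventEntropy I (Y ∪ Z) := by
    refine congrArg I (labelAlg_congr (hχ.comp Prod.fst) (isLabelling_mem (hY.union hZm)) ?_)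
    have : ∀ x, x ∈ Y ∪ Z ↔ (χ x).1 = true := fun x => by
      simp only [Set.mem_union, hZmem]
      constructor
      · rintro (h | h)
        · rw [hYχ x h]
        · exact h.1
      · intro h
        by_cases hy : x ∈ Y
        · exact Or.inl hy
        · exact Or.inr ⟨h, hy⟩
    intro x y
    rw [this, this, eq_iff_iff, Bool.eq_iff_iff]
  have a5 : I (labelAlg fun x => (swapCells χ X Y (false, true) (true, true) x).1) =
      eventEntropy I (X ∪ Z) := by
    refine congrArg I (labelAlg_congr (hχ'.comp Prod.fst) (isLabelling_mem (hX.union hZm)) ?_)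
    have : ∀ x, x ∈ X ∪ Z ↔ (swapCells χ X Y (false, true) (true, true) x).1 = true := fun x => by
      simp only [Set.mem_union, hZmem, swapCells]
      by_cases h1 : x ∈ X
      · simp [h1]
      · by_cases h2 : x ∈ Y
        · simp [h1, h2]
        · simp [h1, h2]
    intro x y
    rw [this, this, eq_iff_iff, Bool.eq_iff_iff]
  have hZd : Disjoint Z (X ∪ Y) := by
    rw [Set.disjoint_left]
    rintro x hz (hx | hy)
    · have := ((hZmem x).1 hz).1
      rw [hXχ x hx] at this
      simp at this
    · exact ((hZmem x).1 hz).2 hy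
  have hPZ : P.real Z = t - q := by
    have h1 : law P (fun x => (χ x).1) true = t := by
      have := (labelIndep_of_law_eq_mul (P := P) (hχ.comp Prod.fst) (hχ.comp Prod.snd) (u := u)
        (v := v) (fun a b => by
          change law P χ (a, b) = _
          rw [hχlaw])
        (fun s hs => by rw [Finset.eq_univ_iff_forall.2 hs, hu])
        (fun s hs => by rw [Finset.eq_univ_iff_forall.2 hs, hv])).2.1
      rw [this]
      simp [u]
    rw [hZ, measureReal_sdiff (fun x hx => by simp [hYχ x hx]) hY, ← hXY]
    rw [law] at h1
    rw [h1]
  rw [swapGain_eq hP hI hX hY hZm hZd ht0 ht1 hXY hPZ hqt, ← a4, ← a5]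
  rw [a3] at a2
  linarith

/-- The joint partition of two independent events `B`, `C` of probabilities `t`, `s` is subjected to
an exchange between its cells `B ∩ C` and `Bᶜ ∩ Cᶜ`. The result is again the joint partition of two
independent events, which arise from `B` and `C` by replacing `X` by `Y`. -/
theorem swapGain_mul_of_disjoint (hP : IsNonatomic P) (hI : IsAdditivePartitionEntropy P I)
    {X Y : Set Ω} (hX : MeasurableSet X) (hY : MeasurableSet Y) (hXY : Disjoint X Y)
    (hPXY : P.real X = P.real Y) {t s : ℝ} (ht0 : 0 < t) (ht1 : t < 1) (hs0 : 0 < s) (hs1 : s < 1)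
    (hq : 4 * P.real X ≤ t * s * ((1 - t) * (1 - s))) :
    swapGain P I (t * s / (t * s + (1 - t) * (1 - s))) X Y =
      swapGain P I t X Y + swapGain P I s X Y := by
  have ht1' : 0 < 1 - t := by linarith
  have hs1' : 0 < 1 - s := by linarith
  have hX0 : 0 ≤ P.real X := measureReal_nonneg
  have hts : 0 < t * s := mul_pos ht0 hs0
  have hts' : 0 < (1 - t) * (1 - s) := mul_pos ht1' hs1'
  have hts1 : t * s ≤ 1 := by nlinarith
  have hts1' : (1 - t) * (1 - s) ≤ 1 := by nlinarith
  have hq1 : 4 * P.real X ≤ t * s := hq.trans (mul_le_of_le_one_right hts.le hts1')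
  have hq2 : 4 * P.real X ≤ (1 - t) * (1 - s) := hq.trans (mul_le_of_le_one_left hts'.le hts1)
  have hst1 : s * (1 - s) ≤ 1 := by nlinarith
  have htt1 : t * (1 - t) ≤ 1 := by nlinarith
  have hqt : 4 * P.real X ≤ t * (1 - t) := by
    refine hq.trans ?_
    rw [show t * s * ((1 - t) * (1 - s)) = t * (1 - t) * (s * (1 - s)) by ring]
    exact mul_le_of_le_one_right (mul_pos ht0 ht1').le hst1
  have hqs : 4 * P.real X ≤ s * (1 - s) := by
    refine hq.trans ?_
    rw [show t * s * ((1 - t) * (1 - s)) = t * (1 - t) * (s * (1 - s)) by ring]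
    exact mul_le_of_le_one_left (mul_pos hs0 hs1').le htt1
  obtain ⟨hb1, hb2⟩ := four_mul_le_bounds ht0 ht1 hqt
  -- independent events `B` and `C` of probabilities `t` and `s`, with `X` in both and `Y` in
  -- neither
  have mXY : P.real (X ∪ Y) = 2 * P.real X := by
    rw [measureReal_union hXY hY, ← hPXY]
    ring
  obtain ⟨Z₁, hZ₁, hd₁, hPZ₁⟩ := hP.exists_disjoint (hX.union hY) (r := t - P.real X)
    (by linarith) (by linarith)
  have hd₁' := Set.disjoint_left.1 hd₁
  have hXY' := Set.disjoint_left.1 hXY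
  obtain ⟨B, hBdef⟩ : ∃ B, B = X ∪ Z₁ := ⟨_, rfl⟩
  have hB : MeasurableSet B := hBdef ▸ hX.union hZ₁
  have hXB : X ⊆ B := hBdef ▸ Set.subset_union_left
  have hYB : Y ⊆ Bᶜ := by
    rw [hBdef]
    rintro y hy (h | h)
    · exact hXY' h hy
    · exact hd₁' h (Or.inr hy)
  have mB : P.real B = t := by
    rw [hBdef, measureReal_union (hd₁.symm.mono_left Set.subset_union_left) hZ₁, hPZ₁]
    ring
  have mBc : P.real Bᶜ = 1 - t := by rw [probReal_compl_eq_one_sub hB, mB]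
  obtain ⟨C₁, hC₁, hXC₁, hC₁B, mC₁⟩ := hP.exists_between hX hB hXB (r := t * s) (by linarith)
    (by rw [mB]; nlinarith)
  obtain ⟨C₂, hC₂, hC₂B, mC₂⟩ := hP.exists_real_eq (hB.compl.diff hY) (r := (1 - t) * s)
    (by positivity) (by
      rw [measureReal_sdiff hYB hY, mBc, ← hPXY]
      linarith)
  obtain ⟨C, hCdef⟩ : ∃ C, C = C₁ ∪ C₂ := ⟨_, rfl⟩
  have hC : MeasurableSet C := hCdef ▸ hC₁.union hC₂
  have hBC : B ∩ C = C₁ := by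
    rw [hCdef]
    ext x
    have h1 := @hC₁B x
    have h2 := @hC₂B x
    simp only [Set.mem_inter_iff, Set.mem_union, Set.mem_sdiff, Set.mem_compl_iff] at *
    tauto
  have mC : P.real C = s := by
    rw [hCdef, measureReal_union (Set.disjoint_left.2 fun x h1 h2 => (hC₂B h2).1 (hC₁B h1)) hC₂,
      mC₁, mC₂]
    ring
  have hXC : X ⊆ C := hCdef ▸ hXC₁.trans Set.subset_union_left
  have hYC : ∀ x ∈ Y, x ∉ C := by
    rw [hCdef]
    rintro y hy (h | h)
    · exact hYB hy (hC₁B h)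
    · exact (hC₂B h).2 hy
  have hind : LabelIndep P (fun x => x ∈ B) (fun x => x ∈ C) := by
    refine labelIndep_of_forall_ne (isLabelling_mem hB) (isLabelling_mem hC) False False
      fun p k hp hk => ?_
    have hp' : p = True := by simpa using hp
    have hk' : k = True := by simpa using hk
    subst hp' hk'
    rw [law_mem_true, law_mem_true, mB, mC, ← mC₁, ← hBC]
    congr 1
    ext x
    simp
  have hφ : IsLabelling fun x => (x ∈ B, x ∈ C) := (isLabelling_mem hB).pair (isLabelling_mem hC)
  have l1 : law P (fun x => (x ∈ B, x ∈ C)) (True, True) = t * s := by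
    rw [hind.law_pair, law_mem_true, law_mem_true, mB, mC]
  have l2 : law P (fun x => (x ∈ B, x ∈ C)) (False, False) = (1 - t) * (1 - s) := by
    rw [hind.law_pair, law_mem_false hB, law_mem_false hC, mB, mC]
  obtain ⟨g1, g2⟩ := entropy_sub_swapCells hP hI hφ (i := (True, True)) (j := (False, False))
    (by simp) hX hY (fun x hx => by simp [hXB hx, hXC hx])
    (fun x hx => by
      have h1 : x ∉ B := hYB hx
      simp [h1, hYC x hx]) hPXY (by rw [l1]; exact hts) (by rw [l2]; exact hts')
    (by rw [l1, l2]; nlinarith) (by rw [l1, l2]; exact hq)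
  rw [l1, l2] at g1
  rw [← g1]
  have e : swapCells (fun x => (x ∈ B, x ∈ C)) X Y (True, True) (False, False) =
      fun x => (x ∈ Y ∪ Z₁, x ∈ Y ∪ (C \ X)) := by
    funext x
    have h1 := @hd₁' x
    have h2 := @hXY' x
    unfold swapCells
    by_cases hx : x ∈ X
    · have : x ∉ Z₁ := fun h => h1 h (Or.inl hx)
      simp [hx, h2 hx, this]
    · by_cases hy : x ∈ Y
      · simp [hx, hy]
      · simp [hx, hy, hBdef]
  have hYZ : IsLabelling fun x => x ∈ Y ∪ Z₁ := isLabelling_mem (hY.union hZ₁)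
  have hYC' : IsLabelling fun x => x ∈ Y ∪ (C \ X) := isLabelling_mem (hY.union (hC.diff hX))
  have f1 := hI.pair (isLabelling_mem hB) (isLabelling_mem hC) hind
  have f2 := hI.fst_add_snd (hφ.swapCells hX hY (True, True) (False, False))
    (u := law P fun x => x ∈ B) (v := law P fun x => x ∈ C)
    (fun i k => by rw [g2, hind.law_pair]) (isLabelling_mem hB).sum_law
    (isLabelling_mem hC).sum_law
  rw [e] at f2 ⊢
  rw [f1, f2]
  have hCX : C = X ∪ (C \ X) := (Set.union_sdiff_cancel hXC).symm
  rw [swapGain_eq hP hI hX hY hZ₁ hd₁ ht0 ht1 hPXY hPZ₁ hqt,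
    swapGain_eq hP hI hX hY (hC.diff hX) (Set.disjoint_left.2 (by
      rintro x ⟨h1, h2⟩ (h | h)
      · exact h2 h
      · exact hYC x h h1)) hs0 hs1 hPXY (by rw [measureReal_sdiff hXC hX, mC]) hqs,
    ← hCX, ← hBdef]
  simp only [eventEntropy]
  ring

/-- The gain is additive in the logarithm of the odds of `t`. -/
theorem swapGain_mul (hP : IsNonatomic P) (hI : IsAdditivePartitionEntropy P I)
    {X Y : Set Ω} (hX : MeasurableSet X) (hY : MeasurableSet Y)
    (hPXY : P.real X = P.real Y) {t s : ℝ} (ht0 : 0 < t) (ht1 : t < 1) (hs0 : 0 < s) (hs1 : s < 1)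
    (hq : 4 * P.real X ≤ t * s * ((1 - t) * (1 - s)))
    (hr : 4 * P.real X ≤ t * s / (t * s + (1 - t) * (1 - s)) *
      (1 - t * s / (t * s + (1 - t) * (1 - s)))) (hqt : 4 * P.real X ≤ t * (1 - t))
    (hqs : 4 * P.real X ≤ s * (1 - s)) :
    swapGain P I (t * s / (t * s + (1 - t) * (1 - s))) X Y =
      swapGain P I t X Y + swapGain P I s X Y := by
  have hts : 0 < t * s := mul_pos ht0 hs0
  have hts' : 0 < (1 - t) * (1 - s) := mul_pos (by linarith) (by linarith)
  have hr0 : 0 < t * s / (t * s + (1 - t) * (1 - s)) := by positivity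
  have hr1 : t * s / (t * s + (1 - t) * (1 - s)) < 1 := by
    rw [div_lt_one (by positivity)]
    linarith
  obtain ⟨hb1, hb2⟩ := four_mul_le_bounds ht0 ht1 hqt
  have hX0 : 0 ≤ P.real X := measureReal_nonneg
  have hle := measureReal_union_le (μ := P) X Y
  obtain ⟨W, hW, hd, hPW⟩ := hP.exists_disjoint (hX.union hY) (r := P.real X) hX0 (by linarith)
  have hdX : Disjoint X W := hd.symm.mono_left Set.subset_union_left
  have hdY : Disjoint W Y := hd.mono_right Set.subset_union_right
  have c1 := swapGain_cocycle hP hI hX hW hY ht0 ht1 hPW.symm (hPW.trans hPXY) hqt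
  have c2 := swapGain_cocycle hP hI hX hW hY hs0 hs1 hPW.symm (hPW.trans hPXY) hqs
  have c3 := swapGain_cocycle hP hI hX hW hY hr0 hr1 hPW.symm (hPW.trans hPXY) hr
  have d1 := swapGain_mul_of_disjoint hP hI hX hW hdX hPW.symm ht0 ht1 hs0 hs1 hq
  have d2 := swapGain_mul_of_disjoint hP hI hW hY hdY (hPW.trans hPXY) ht0 ht1 hs0 hs1
    (by rw [hPW]; exact hq)
  linarith

end Gain

/-! ### The signed measure -/

section Mean

variable {Ω : Type*} [MeasurableSpace Ω] {P : Measure Ω} [IsProbabilityMeasure P]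
  {I : FiniteSubalgebra Ω → ℝ} {U : Ω → ℝ}

theorem arc_zero {Ω : Type*} (U : Ω → ℝ) (b : ℝ) : arc U b 0 = ∅ := by
  ext x
  simp [arc]

/-- Moving an arc by `h` exchanges two arcs of length `h`, so the gain depends continuously on the
position of the arc. -/
theorem continuous_swapGain_arc (hP : IsNonatomic P) (hI : IsAdditivePartitionEntropy P I)
    (hIc : IsContinuousOnTwoAtom P I) (hU : IsUniformCoord P U) {t : ℝ} (ht0 : 0 < t)
    (ht1 : t < 1) {X : Set Ω} (hX : MeasurableSet X) (hq : 4 * P.real X ≤ t * (1 - t)) :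
    Continuous fun b => swapGain P I t X (arc U b (P.real X)) := by
  set q := P.real X with hqd
  obtain ⟨hb1, hb2⟩ := four_mul_le_bounds ht0 ht1 hq
  have hq0 : 0 ≤ q := measureReal_nonneg
  rcases hq0.eq_or_lt with h0 | hqpos
  · simp only [← h0, arc_zero]
    exact continuous_const
  have hmeas := measurableSet_arc hU.1
  rw [Metric.continuous_iff]
  intro b ε hε
  obtain ⟨δ, hδ, hsm⟩ := swapGain_small hP hI hIc ht0 ht1 (half_pos hε)
  obtain ⟨-, -, -, hsm⟩ := hsm t (by simpa using hδ.le)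
  have key : ∀ c h : ℝ, 0 ≤ h → h ≤ δ → h ≤ q →
      |swapGain P I t X (arc U c q) - swapGain P I t X (arc U (c + h) q)| ≤ ε / 2 := by
    intro c h h0 hhδ hhq
    have e1 : arc U c q = arc U (c + h) (q - h) ∪ arc U c h := by
      rw [Set.union_comm, ← arc_add h0 (by linarith) (by linarith)]
      congr 1
      ring
    have e2 : arc U (c + h) q = arc U (c + h) (q - h) ∪ arc U (c + q) h := by
      have := arc_add (U := U) (b := c + h) (q := q - h) (r := h) (by linarith) h0 (by linarith)
      rw [show q - h + h = q by ring, show c + h + (q - h) = c + q by ring] at this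
      exact this
    have d1 : Disjoint (arc U (c + h) (q - h)) (arc U c h) :=
      (disjoint_arc h0 (by linarith)).symm
    have d2 : Disjoint (arc U (c + h) (q - h)) (arc U (c + q) h) := by
      have := disjoint_arc (U := U) (b := c + h) (q := q - h) (r := h) (by linarith) (by linarith)
      rwa [show c + h + (q - h) = c + q by ring] at this
    have m1 : P.real (arc U (c + h) (q - h)) = q - h :=
      hU.measureReal_arc _ (by linarith) (by linarith)
    have m2 : ∀ c, P.real (arc U c h) = h := fun c => hU.measureReal_arc _ h0 (by linarith)
    have m3 : ∀ c, P.real (arc U c q) = q := fun c => hU.measureReal_arc _ hq0 (by linarith)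
    have c1 := swapGain_cocycle hP hI hX (hmeas (c + h) q) (hmeas c q) ht0 ht1
      (by rw [m3]) (by rw [m3, m3]) hq
    have c2 := swapGain_union hP hI (hmeas (c + h) (q - h)) (hmeas (c + q) h)
      (hmeas (c + h) (q - h)) (hmeas c h) d2 d1 ht0 ht1 rfl (by rw [m2, m2])
      (by rw [m1, m2]; linarith)
    rw [← e1, ← e2, swapGain_self hP hI (hmeas _ _) ht0 ht1 (by rw [m1]; linarith), zero_add] at c2
    have c3 := hsm (arc U (c + q) h) (arc U c h) (hmeas _ _) (hmeas _ _) (by rw [m2, m2])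
      (by rw [m2]; exact hhδ)
    rw [← c2] at c3
    rwa [← c1, add_sub_cancel_left]
  refine ⟨min δ q, lt_min hδ hqpos, fun a ha => ?_⟩
  rw [Real.dist_eq, lt_min_iff] at ha
  rw [Real.dist_eq]
  refine lt_of_le_of_lt ?_ (half_lt_self hε)
  rcases le_total a b with hab | hab
  · rw [abs_sub_comm, abs_of_nonneg (sub_nonneg.2 hab)] at ha
    have := key a (b - a) (by linarith) ha.1.le ha.2.le
    rwa [add_sub_cancel] at this
  · rw [abs_of_nonneg (sub_nonneg.2 hab)] at ha
    have := key b (a - b) (by linarith) ha.1.le ha.2.le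
    rwa [add_sub_cancel, abs_sub_comm] at this

/-- The mean gain of exchanging `X` with an arc of the same probability in random position. -/
noncomputable def gainMean (P : Measure Ω) (I : FiniteSubalgebra Ω → ℝ) (U : Ω → ℝ) (t : ℝ)
    (X : Set Ω) : ℝ :=
  ∫ b in (0 : ℝ)..1, swapGain P I t X (arc U b (P.real X))

theorem gainMean_sub (hP : IsNonatomic P) (hI : IsAdditivePartitionEntropy P I)
    (hIc : IsContinuousOnTwoAtom P I) (hU : IsUniformCoord P U) {t : ℝ} (ht0 : 0 < t)
    (ht1 : t < 1) {X Y : Set Ω} (hX : MeasurableSet X) (hY : MeasurableSet Y)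
    (hXY : P.real X = P.real Y) (hq : 4 * P.real X ≤ t * (1 - t)) :
    gainMean P I U t X - gainMean P I U t Y = swapGain P I t X Y := by
  have hcX := continuous_swapGain_arc hP hI hIc hU ht0 ht1 hX hq
  have hcY := continuous_swapGain_arc hP hI hIc hU ht0 ht1 hY (hXY ▸ hq)
  obtain ⟨hb1, hb2⟩ := four_mul_le_bounds ht0 ht1 hq
  have hX0 : 0 ≤ P.real X := measureReal_nonneg
  rw [gainMean, gainMean, ← intervalIntegral.integral_sub (hcX.intervalIntegrable _ _)
    (hcY.intervalIntegrable _ _)]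
  have : ∀ b, swapGain P I t X (arc U b (P.real X)) - swapGain P I t Y (arc U b (P.real Y)) =
      swapGain P I t X Y := by
    intro b
    have m : P.real (arc U b (P.real X)) = P.real X := hU.measureReal_arc _ hX0 (by linarith)
    have := swapGain_cocycle hP hI hX hY (measurableSet_arc hU.1 b (P.real X)) ht0 ht1 hXY
      (by rw [m, hXY]) hq
    rw [← hXY]
    linarith
  simp [this]

/-- The arc paired with `X ∪ Y` is split into one paired with `X` and one paired with `Y`. -/
theorem gainMean_union (hP : IsNonatomic P) (hI : IsAdditivePartitionEntropy P I)
    (hIc : IsContinuousOnTwoAtom P I) (hU : IsUniformCoord P U) {t : ℝ} (ht0 : 0 < t)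
    (ht1 : t < 1) {X Y : Set Ω} (hX : MeasurableSet X) (hY : MeasurableSet Y)
    (hXY : Disjoint X Y) (hq : 4 * (P.real X + P.real Y) ≤ t * (1 - t)) :
    gainMean P I U t (X ∪ Y) = gainMean P I U t X + gainMean P I U t Y := by
  obtain ⟨hb1, hb2⟩ := four_mul_le_bounds ht0 ht1 hq
  have hX0 : 0 ≤ P.real X := measureReal_nonneg
  have hY0 : 0 ≤ P.real Y := measureReal_nonneg
  have hcX := continuous_swapGain_arc hP hI hIc hU ht0 ht1 hX (by linarith)
  have hcY := continuous_swapGain_arc hP hI hIc hU ht0 ht1 hY (by linarith)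
  have hcY' : Continuous fun b => swapGain P I t Y (arc U (b + P.real X) (P.real Y)) :=
    hcY.comp (continuous_add_const (P.real X))
  have hper : Function.Periodic (fun b => swapGain P I t Y (arc U b (P.real Y))) 1 := by
    intro b
    simp only [arc_add_one]
  -- the mean over all positions is invariant under rotation
  have hrot : gainMean P I U t Y =
      ∫ b in (0 : ℝ)..1, swapGain P I t Y (arc U (b + P.real X) (P.real Y)) := by
    rw [intervalIntegral.integral_comp_add_right
      (fun b => swapGain P I t Y (arc U b (P.real Y))), gainMean]
    have := hper.intervalIntegral_add_eq 0 (0 + P.real X)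
    rw [zero_add 1] at this
    rw [this]
    congr 1
    ring
  rw [hrot, gainMean, gainMean, measureReal_union hXY hY,
    ← intervalIntegral.integral_add (hcX.intervalIntegrable _ _)
      (hcY'.intervalIntegrable _ _)]
  congr 1
  funext b
  rw [arc_add hX0 hY0 (by linarith)]
  exact swapGain_union hP hI hX hY (measurableSet_arc hU.1 _ _) (measurableSet_arc hU.1 _ _) hXY
    (disjoint_arc hX0 (by linarith)) ht0 ht1 (hU.measureReal_arc _ hX0 (by linarith)).symm
    (hU.measureReal_arc _ hY0 (by linarith)).symm hq

theorem gainMean_small (hP : IsNonatomic P) (hI : IsAdditivePartitionEntropy P I)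
    (hIc : IsContinuousOnTwoAtom P I) (hU : IsUniformCoord P U) {t₀ : ℝ} (ht0 : 0 < t₀)
    (ht1 : t₀ < 1) {ε : ℝ} (hε : 0 < ε) :
    ∃ δ : ℝ, 0 < δ ∧ ∀ t, |t - t₀| ≤ δ → 0 < t ∧ t < 1 ∧ 4 * δ ≤ t * (1 - t) ∧
      ∀ X : Set Ω, MeasurableSet X → P.real X ≤ δ → |gainMean P I U t X| ≤ ε := by
  obtain ⟨δ, hδ, h⟩ := swapGain_small hP hI hIc ht0 ht1 hε
  refine ⟨δ, hδ, fun t ht => ?_⟩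
  obtain ⟨h1, h2, h3, h4⟩ := h t ht
  refine ⟨h1, h2, h3, fun X hX hXδ => ?_⟩
  obtain ⟨hb1, hb2⟩ := four_mul_le_bounds h1 h2 h3
  have := intervalIntegral.norm_integral_le_of_norm_le_const (a := 0) (b := 1) (C := ε)
    (f := fun b => swapGain P I t X (arc U b (P.real X))) (fun b _ =>
      h4 X _ hX (measurableSet_arc hU.1 _ _)
        (hU.measureReal_arc _ measureReal_nonneg (by linarith)).symm hXδ)
  simpa [gainMean] using this

theorem gainMean_mul (hP : IsNonatomic P) (hI : IsAdditivePartitionEntropy P I)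
    (hIc : IsContinuousOnTwoAtom P I) (hU : IsUniformCoord P U) {t s : ℝ} (ht0 : 0 < t)
    (ht1 : t < 1) (hs0 : 0 < s) (hs1 : s < 1) {X : Set Ω} (hX : MeasurableSet X)
    (hq : 4 * P.real X ≤ t * s * ((1 - t) * (1 - s)))
    (hr : 4 * P.real X ≤ t * s / (t * s + (1 - t) * (1 - s)) *
      (1 - t * s / (t * s + (1 - t) * (1 - s)))) (hqt : 4 * P.real X ≤ t * (1 - t))
    (hqs : 4 * P.real X ≤ s * (1 - s)) :
    gainMean P I U (t * s / (t * s + (1 - t) * (1 - s))) X =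
      gainMean P I U t X + gainMean P I U s X := by
  have hct := continuous_swapGain_arc hP hI hIc hU ht0 ht1 hX hqt
  have hcs := continuous_swapGain_arc hP hI hIc hU hs0 hs1 hX hqs
  obtain ⟨hb1, hb2⟩ := four_mul_le_bounds ht0 ht1 hqt
  have hX0 : 0 ≤ P.real X := measureReal_nonneg
  rw [gainMean, gainMean, gainMean, ← intervalIntegral.integral_add
    (hct.intervalIntegrable _ _) (hcs.intervalIntegrable _ _)]
  congr 1
  funext b
  exact swapGain_mul hP hI hX (measurableSet_arc hU.1 _ _)
    (hU.measureReal_arc _ hX0 (by linarith)).symm ht0 ht1 hs0 hs1 hq hr hqt hqs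

end Mean

section Extension

variable {Ω κ : Type*} [MeasurableSpace Ω] {P : Measure Ω} [IsProbabilityMeasure P]

/-- Finite additivity of a real set function on events. -/
def IsFinAdditive (E : Set Ω → ℝ) : Prop :=
  ∀ A B, MeasurableSet A → MeasurableSet B → Disjoint A B → E (A ∪ B) = E A + E B

/-- A set function that is additive on events of small probability is additive over the cells of a
labelling. -/
theorem sum_inter_of_small_additive [Fintype κ] {ν : Set Ω → ℝ} {r : ℝ} (hr : 0 ≤ r)
    (h : ∀ A B, MeasurableSet A → MeasurableSet B → Disjoint A B → P.real A + P.real B ≤ r →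
      ν (A ∪ B) = ν A + ν B) {θ : Ω → κ} (hθ : IsLabelling θ) {A : Set Ω} (hA : MeasurableSet A)
    (hAr : P.real A ≤ r) : ν A = ∑ k, ν (A ∩ θ ⁻¹' {k}) := by
  classical
  have h0 : ν ∅ = 0 := by
    have := h ∅ ∅ MeasurableSet.empty MeasurableSet.empty (Set.disjoint_empty _)
      (by simpa using hr)
    rw [Set.union_empty] at this
    linarith
  have key : ∀ s : Finset κ, ν (A ∩ θ ⁻¹' (s : Set κ)) = ∑ k ∈ s, ν (A ∩ θ ⁻¹' {k}) := by
    intro s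
    induction s using Finset.induction_on with
    | empty => simpa using h0
    | insert a s ha ih =>
      have hd : Disjoint (A ∩ θ ⁻¹' {a}) (A ∩ θ ⁻¹' (s : Set κ)) := by
        refine Set.disjoint_left.2 fun x hx hx' => ha ?_
        have h1 : θ x = a := hx.2
        have h2 : θ x ∈ s := hx'.2
        rwa [h1] at h2
      have hu : A ∩ θ ⁻¹' ((insert a s : Finset κ) : Set κ) =
          (A ∩ θ ⁻¹' {a}) ∪ (A ∩ θ ⁻¹' (s : Set κ)) := by
        ext x
        simp only [Finset.coe_insert, Set.mem_inter_iff, Set.mem_preimage, Set.mem_insert_iff,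
          Set.mem_union, Set.mem_singleton_iff]
        tauto
      have hm := measureReal_union (μ := P) hd (hA.inter (hθ _))
      rw [← hu] at hm
      rw [hu, h _ _ (hA.inter (hθ _)) (hA.inter (hθ _)) hd, ih, Finset.sum_insert ha]
      rw [← hm]
      exact (measureReal_mono Set.inter_subset_left).trans hAr
  have := key Finset.univ
  simpa using this

theorem IsFinAdditive.sum_inter [Fintype κ] {E : Set Ω → ℝ} (hE : IsFinAdditive E)
    (P : Measure Ω) [IsProbabilityMeasure P] {θ : Ω → κ} (hθ : IsLabelling θ) {A : Set Ω}
    (hA : MeasurableSet A) : E A = ∑ k, E (A ∩ θ ⁻¹' {k}) :=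
  sum_inter_of_small_additive (P := P) zero_le_one (fun A B hA hB hAB _ => hE A B hA hB hAB) hθ hA
    measureReal_le_one

theorem IsNonatomic.exists_fine_labelling (hP : IsNonatomic P) {r : ℝ} (hr : 0 < r) :
    ∃ (N : ℕ) (θ : Ω → Fin N), IsLabelling θ ∧ ∀ k, P.real (θ ⁻¹' {k}) ≤ r := by
  obtain ⟨n, hn⟩ := exists_nat_one_div_lt hr
  obtain ⟨θ, h1, h2⟩ := hP.exists_labelling (κ := Fin (n + 1)) (w := fun _ => 1 / ((n : ℝ) + 1))
    (fun _ => by positivity) (by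
      rw [Finset.sum_const, Finset.card_univ, Fintype.card_fin, nsmul_eq_mul]
      push_cast
      field_simp)
  refine ⟨n + 1, θ, h1, fun k => ?_⟩
  have := congrFun h2 k
  rw [law] at this
  rw [this]
  exact hn.le

/-- A set function that is additive on small events extends to a finitely additive one, as the sum
of its values on the pieces of a fine partition. -/
theorem IsNonatomic.exists_additive_extension (hP : IsNonatomic P) {ν : Set Ω → ℝ} {r : ℝ}
    (hr : 0 < r)
    (h : ∀ A B, MeasurableSet A → MeasurableSet B → Disjoint A B → P.real A + P.real B ≤ r →
      ν (A ∪ B) = ν A + ν B) :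
    ∃ E : Set Ω → ℝ, IsFinAdditive E ∧ ∀ A, MeasurableSet A → P.real A ≤ r → E A = ν A := by
  obtain ⟨N, θ, hθ, hθr⟩ := hP.exists_fine_labelling hr
  refine ⟨fun A => ∑ k, ν (A ∩ θ ⁻¹' {k}), fun A B hA hB hAB => ?_, fun A hA hAr =>
    (sum_inter_of_small_additive hr.le h hθ hA hAr).symm⟩
  rw [← Finset.sum_add_distrib]
  refine Finset.sum_congr rfl fun k _ => ?_
  have hd : Disjoint (A ∩ θ ⁻¹' {k}) (B ∩ θ ⁻¹' {k}) :=
    hAB.mono Set.inter_subset_left Set.inter_subset_left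
  have hm := measureReal_union (μ := P) hd (hB.inter (hθ _))
  rw [Set.union_inter_distrib_right, h _ _ (hA.inter (hθ _)) (hB.inter (hθ _)) hd]
  rw [← hm, ← Set.union_inter_distrib_right]
  exact (measureReal_mono Set.inter_subset_right).trans (hθr k)

theorem IsNonatomic.finAdditive_ext (hP : IsNonatomic P) {E F : Set Ω → ℝ} (hE : IsFinAdditive E)
    (hF : IsFinAdditive F) {r : ℝ} (hr : 0 < r)
    (h : ∀ A, MeasurableSet A → P.real A ≤ r → E A = F A) {A : Set Ω} (hA : MeasurableSet A) :
    E A = F A := by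
  obtain ⟨N, θ, hθ, hθr⟩ := hP.exists_fine_labelling hr
  rw [hE.sum_inter P hθ hA, hF.sum_inter P hθ hA]
  exact Finset.sum_congr rfl fun k _ => h _ (hA.inter (hθ _))
    ((measureReal_mono Set.inter_subset_right).trans (hθr k))

/-- A finitely additive set function that is small on events of small probability is countably
additive. -/
theorem IsFinAdditive.exists_signedMeasure {E : Set Ω → ℝ} (hE : IsFinAdditive E)
    (hsm : ∀ ε : ℝ, 0 < ε → ∃ δ : ℝ, 0 < δ ∧ ∀ A, MeasurableSet A → P.real A < δ → |E A| < ε) :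
    ∃ m : SignedMeasure Ω, IsAbsCont P m ∧ ∀ A, MeasurableSet A → m A = E A := by
  classical
  have h0 : E ∅ = 0 := by
    have := hE ∅ ∅ MeasurableSet.empty MeasurableSet.empty (Set.disjoint_empty _)
    rw [Set.union_empty] at this
    linarith
  let m : SignedMeasure Ω :=
    { measureOf' := fun A => if MeasurableSet A then E A else 0
      empty' := by simp [h0]
      not_measurable' := fun A hA => by simp [hA]
      m_iUnion' := by
        intro f hf hd
        have hfin : ∀ s : Finset ℕ, E (⋃ i ∈ s, f i) = ∑ i ∈ s, E (f i) := by
          intro s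
          induction s using Finset.induction_on with
          | empty => simpa using h0
          | insert a s ha ih =>
            rw [Finset.set_biUnion_insert, Finset.sum_insert ha, ← ih]
            refine hE _ _ (hf a) (Finset.measurableSet_biUnion _ fun i _ => hf i) ?_
            rw [Set.disjoint_iUnion₂_right]
            exact fun i hi => hd fun e => ha (e ▸ hi)
        have hU : MeasurableSet (⋃ i, f i) := MeasurableSet.iUnion hf
        have hsum : HasSum (fun i => P.real (f i)) (P.real (⋃ i, f i)) := by
          have h1 : P (⋃ i, f i) = ∑' i, P (f i) := measure_iUnion hd hf
          have h2 : ∑' i, P (f i) ≠ ⊤ := h1 ▸ measure_ne_top _ _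
          rw [measureReal_def, h1, ENNReal.tsum_toReal_eq fun i => measure_ne_top _ _]
          exact (ENNReal.summable_toReal h2).hasSum
        simp only [hf, hU, if_true]
        rw [HasSum, SummationFilter.unconditional_filter, Metric.tendsto_nhds]
        intro ε hε
        obtain ⟨δ, hδ, hδE⟩ := hsm ε hε
        have hev := Metric.tendsto_nhds.1 hsum δ hδ
        rw [SummationFilter.unconditional_filter] at hev
        filter_upwards [hev] with s hs
        have hsm : MeasurableSet (⋃ i ∈ s, f i) := Finset.measurableSet_biUnion _ fun i _ => hf i
        have hsub : (⋃ i ∈ s, f i) ⊆ ⋃ i, f i := Set.iUnion₂_subset fun i _ =>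
          Set.subset_iUnion f i
        have h1 : P.real (⋃ i ∈ s, f i) = ∑ i ∈ s, P.real (f i) :=
          measureReal_biUnion_finset (fun i _ j _ hij => hd hij) fun i _ => hf i
        have h2 : P.real ((⋃ i, f i) \ ⋃ i ∈ s, f i) < δ := by
          rw [measureReal_sdiff hsub hsm, h1]
          rw [Real.dist_eq, abs_lt] at hs
          linarith [hs.1]
        have h3 := hE _ _ hsm (hU.diff hsm) Set.disjoint_sdiff_right
        rw [Set.union_sdiff_cancel hsub, hfin] at h3
        rw [Real.dist_eq, abs_sub_comm, h3, add_sub_cancel_left]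
        exact hδE _ (hU.diff hsm) h2 }
  have hm : ∀ A, MeasurableSet A → m A = E A := fun A hA => if_pos hA
  refine ⟨m, fun ε hε => ?_, hm⟩
  obtain ⟨δ, hδ, h⟩ := hsm ε hε
  exact ⟨δ, hδ, fun A hA hAδ => by rw [hm A hA]; exact h A hA hAδ⟩

end Extension

section Measure

variable {Ω : Type*} [MeasurableSpace Ω] {P : Measure Ω} [IsProbabilityMeasure P]
  {I : FiniteSubalgebra Ω → ℝ}

/-- The probability `t` with logarithmic odds `log ((1 - t) / t) = x`. -/
noncomputable def oddsProb (x : ℝ) : ℝ := 1 / (1 + Real.exp x)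

theorem oddsProb_pos (x : ℝ) : 0 < oddsProb x := by
  unfold oddsProb
  positivity

theorem one_sub_oddsProb (x : ℝ) : 1 - oddsProb x = Real.exp x / (1 + Real.exp x) := by
  unfold oddsProb
  have : 1 + Real.exp x ≠ 0 := by positivity
  field_simp
  ring

theorem oddsProb_lt_one (x : ℝ) : oddsProb x < 1 := by
  have : 0 < 1 - oddsProb x := by
    rw [one_sub_oddsProb]
    positivity
  linarith

theorem oddsProb_add (x y : ℝ) : oddsProb (x + y) = oddsProb x * oddsProb y /
    (oddsProb x * oddsProb y + (1 - oddsProb x) * (1 - oddsProb y)) := by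
  rw [one_sub_oddsProb, one_sub_oddsProb]
  unfold oddsProb
  rw [Real.exp_add]
  field_simp

theorem oddsProb_log {t : ℝ} (h0 : 0 < t) (h1 : t < 1) :
    oddsProb (Real.log ((1 - t) / t)) = t := by
  unfold oddsProb
  rw [Real.exp_log (div_pos (by linarith) h0)]
  field_simp
  ring

theorem continuous_oddsProb : Continuous oddsProb := by
  unfold oddsProb
  refine Continuous.div continuous_const (by fun_prop) fun x => by positivity

/-- Cauchy's functional equation for functions that are bounded near zero. -/
theorem eq_mul_of_additive_of_bounded {F : ℝ → ℝ} (hF : ∀ x y, F (x + y) = F x + F y) {η C : ℝ}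
    (hη : 0 < η) (hC : ∀ x, |x| ≤ η → |F x| ≤ C) (x : ℝ) : F x = x * F 1 := by
  let f : ℝ →+ ℝ := AddMonoidHom.mk' F hF
  have hcont : Continuous f := by
    refine f.continuous_of_isBounded_nhds_zero (Metric.closedBall_mem_nhds 0 hη) ?_
    refine isBounded_iff_forall_norm_le.2 ⟨C, ?_⟩
    rintro _ ⟨x, hx, rfl⟩
    exact hC x (by simpa using hx)
  have h : f (x • 1) = x • f 1 := map_real_smul f hcont x 1
  rw [smul_eq_mul, smul_eq_mul, mul_one] at h
  exact h

/-- The signed measure behind an additive partition entropy: the mean gains extend to finitely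
additive set functions, which depend linearly on the logarithmic odds, being additive in them and
bounded near zero. -/
theorem exists_signedMeasure_swapGain (hP : IsNonatomic P) (hI : IsAdditivePartitionEntropy P I)
    (hIc : IsContinuousOnTwoAtom P I) :
    ∃ m : SignedMeasure Ω, IsAbsCont P m ∧ m Set.univ = 0 ∧ ∀ t : ℝ, 0 < t → t < 1 →
      ∃ δ : ℝ, 0 < δ ∧ ∀ X Y : Set Ω, MeasurableSet X → MeasurableSet Y →
        P.real X = P.real Y → P.real X ≤ δ →
        swapGain P I t X Y = Real.logb 2 ((1 - t) / t) * (m X - m Y) := by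
  obtain ⟨U, hU⟩ := hP.exists_uniformCoord
  -- `E x` extends the mean gain at log odds `x` from events of probability at most `r x`
  let r : ℝ → ℝ := fun x => oddsProb x * (1 - oddsProb x) / 4
  have hr : ∀ x, 0 < r x := fun x =>
    div_pos (mul_pos (oddsProb_pos x) (sub_pos.2 (oddsProb_lt_one x))) (by norm_num)
  have hrt : ∀ x q, q ≤ r x → 4 * q ≤ oddsProb x * (1 - oddsProb x) := by
    intro x q hq
    simp only [r] at hq
    linarith
  have hext : ∀ x, ∃ E : Set Ω → ℝ, IsFinAdditive E ∧
      ∀ A, MeasurableSet A → P.real A ≤ r x → E A = gainMean P I U (oddsProb x) A := fun x =>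
    hP.exists_additive_extension (hr x) fun A B hA hB hAB hle =>
      gainMean_union hP hI hIc hU (oddsProb_pos x) (oddsProb_lt_one x) hA hB hAB (hrt x _ hle)
  choose E hE hEr using hext
  have hadd : ∀ A, MeasurableSet A → ∀ x y, E (x + y) A = E x A + E y A := by
    intro A hA x y
    have h4 : 0 < oddsProb x * oddsProb y * ((1 - oddsProb x) * (1 - oddsProb y)) / 4 :=
      div_pos (mul_pos (mul_pos (oddsProb_pos x) (oddsProb_pos y))
        (mul_pos (sub_pos.2 (oddsProb_lt_one x)) (sub_pos.2 (oddsProb_lt_one y)))) (by norm_num)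
    refine hP.finAdditive_ext (hE (x + y)) (F := fun A => E x A + E y A) (fun A B hA hB hAB => ?_)
      (r := min (min (r x) (r y)) (min (r (x + y)) _))
      (lt_min (lt_min (hr x) (hr y)) (lt_min (hr (x + y)) h4)) (fun A hA hAr => ?_) hA
    · change E x (A ∪ B) + E y (A ∪ B) = _
      rw [hE x A B hA hB hAB, hE y A B hA hB hAB]
      ring
    · simp only [le_min_iff] at hAr
      obtain ⟨⟨h1, h2⟩, h3, h5⟩ := hAr
      rw [hEr _ A hA h3, hEr _ A hA h1, hEr _ A hA h2, oddsProb_add]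
      refine gainMean_mul hP hI hIc hU (oddsProb_pos x) (oddsProb_lt_one x) (oddsProb_pos y)
        (oddsProb_lt_one y) hA (by linarith) ?_ (hrt _ _ h1) (hrt _ _ h2)
      rw [← oddsProb_add]
      exact hrt _ _ h3
  have hsmall : ∀ x ε : ℝ, 0 < ε → ∃ δ : ℝ, 0 < δ ∧ ∀ y, |oddsProb y - oddsProb x| ≤ δ →
      ∀ A, MeasurableSet A → P.real A ≤ δ → |E y A| ≤ ε := by
    intro x ε hε
    obtain ⟨δ, hδ, h⟩ := gainMean_small hP hI hIc hU (oddsProb_pos x) (oddsProb_lt_one x) hε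
    refine ⟨δ, hδ, fun y hy A hA hAδ => ?_⟩
    obtain ⟨-, -, h3, h4⟩ := h _ hy
    rw [hEr y A hA]
    · exact h4 A hA hAδ
    · simp only [r]
      linarith
  -- boundedness of `E x A` for small `x` is checked on the pieces of a fine partition
  have hlin : ∀ A, MeasurableSet A → ∀ x, E x A = x * E 1 A := by
    intro A hA
    obtain ⟨δ, hδ, h⟩ := hsmall 0 1 one_pos
    obtain ⟨N, θ, hθ, hθδ⟩ := hP.exists_fine_labelling hδ
    obtain ⟨η, hη, hη'⟩ := Metric.continuous_iff.1 continuous_oddsProb 0 δ hδ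
    refine eq_mul_of_additive_of_bounded (hadd A hA) (half_pos hη) (C := ∑ _k : Fin N, 1)
      fun x hx => ?_
    rw [(hE x).sum_inter P hθ hA]
    refine (Finset.abs_sum_le_sum_abs _ _).trans (Finset.sum_le_sum fun k _ => ?_)
    refine h x ?_ _ (hA.inter (hθ _)) ((measureReal_mono Set.inter_subset_right).trans (hθδ k))
    have := hη' x (by
      rw [Real.dist_eq, sub_zero]
      linarith)
    rw [Real.dist_eq] at this
    exact this.le
  -- the normalization `m Ω = 0` costs a multiple of `P`, which does not affect `m X - m Y`
  let G : Set Ω → ℝ := fun A => Real.log 2 * (E 1 A - P.real A * E 1 Set.univ)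
  have hG : IsFinAdditive G := by
    intro A B hA hB hAB
    simp only [G]
    rw [hE 1 A B hA hB hAB, measureReal_union hAB hB]
    ring
  have hlog2 : 0 < Real.log 2 := Real.log_pos one_lt_two
  have hGs : ∀ ε : ℝ, 0 < ε → ∃ δ : ℝ, 0 < δ ∧ ∀ A, MeasurableSet A → P.real A < δ →
      |G A| < ε := by
    intro ε hε
    set c := |E 1 Set.univ| with hc
    have hc0 : 0 ≤ c := abs_nonneg _
    have hε' : 0 < ε / (4 * Real.log 2) := by positivity
    obtain ⟨δ, hδ, h⟩ := hsmall 1 _ hε'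
    have hη : 0 < ε / (4 * Real.log 2) / (c + 1) := by positivity
    refine ⟨min δ (ε / (4 * Real.log 2) / (c + 1)), lt_min hδ hη, fun A hA hAδ => ?_⟩
    rw [lt_min_iff] at hAδ
    have h1 := h 1 (by simpa using hδ.le) A hA hAδ.1.le
    have h2 : |P.real A * E 1 Set.univ| ≤ ε / (4 * Real.log 2) := by
      rw [abs_mul, abs_of_nonneg measureReal_nonneg, ← hc]
      have h3 := hAδ.2.le
      rw [le_div_iff₀ (by positivity)] at h3
      nlinarith [measureReal_nonneg (μ := P) (s := A)]
    have h3 : |E 1 A - P.real A * E 1 Set.univ| ≤ ε / (2 * Real.log 2) := by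
      refine (abs_sub _ _).trans ?_
      have : ε / (2 * Real.log 2) = ε / (4 * Real.log 2) + ε / (4 * Real.log 2) := by
        field_simp
        norm_num
      linarith
    simp only [G]
    rw [abs_mul, abs_of_pos hlog2]
    refine lt_of_le_of_lt (mul_le_mul_of_nonneg_left h3 hlog2.le) ?_
    have : Real.log 2 * (ε / (2 * Real.log 2)) = ε / 2 := by
      field_simp
    linarith
  obtain ⟨m, hm, hmG⟩ := hG.exists_signedMeasure hGs
  refine ⟨m, hm, ?_, fun t ht0 ht1 => ?_⟩
  · rw [hmG _ MeasurableSet.univ]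
    simp [G]
  · have ht := oddsProb_log ht0 ht1
    set x := Real.log ((1 - t) / t) with hx
    refine ⟨r x, hr x, fun X Y hX hY hXY hXr => ?_⟩
    rw [hmG X hX, hmG Y hY, ← gainMean_sub hP hI hIc hU ht0 ht1 hX hY hXY
      (by have := hrt x _ hXr; rwa [ht] at this), ← ht, ← hEr x X hX hXr,
      ← hEr x Y hY (hXY ▸ hXr), hlin X hX, hlin Y hY, ht, Real.logb, ← hx]
    simp only [G]
    rw [hXY]
    field_simp
    ring

end Measure

/-! ### Algebras and their atoms in terms of labellings -/

section Atoms

variable {Ω ι κ : Type*} [MeasurableSpace Ω]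

theorem mem_atoms_labelAlg [Finite ι] {φ : Ω → ι} (hφ : IsLabelling φ) {A : Set Ω} :
    A ∈ (labelAlg φ).atoms ↔ ∃ x, A = φ ⁻¹' {φ x} := by
  rw [FiniteSubalgebra.mem_atoms]
  constructor
  · intro hA
    obtain ⟨s, hs⟩ := (mem_labelAlg hφ).1 hA.prop.1
    obtain ⟨x, hx⟩ := Set.nonempty_iff_ne_empty.2 hA.prop.2
    have hxs : φ x ∈ s := by
      rw [← hs] at hx
      exact hx
    have hsub : φ ⁻¹' {φ x} ⊆ A := by
      rw [← hs]
      exact Set.preimage_mono (Set.singleton_subset_iff.2 hxs)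
    refine ⟨x, Set.Subset.antisymm (hA.le_of_le ⟨(mem_labelAlg hφ).2 ⟨_, rfl⟩, ?_⟩ hsub) hsub⟩
    exact Set.Nonempty.ne_empty ⟨x, rfl⟩
  · rintro ⟨x, rfl⟩
    refine ⟨⟨(mem_labelAlg hφ).2 ⟨_, rfl⟩, Set.Nonempty.ne_empty ⟨x, rfl⟩⟩, ?_⟩
    rintro B ⟨hB, hBne⟩ hBx
    obtain ⟨s, rfl⟩ := (mem_labelAlg hφ).1 hB
    obtain ⟨y, hy⟩ := Set.nonempty_iff_ne_empty.2 hBne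
    have hyx : φ y = φ x := hBx hy
    have hxs : φ x ∈ s := hyx ▸ hy
    exact Set.preimage_mono (Set.singleton_subset_iff.2 hxs)

/-- Empty cells are not atoms, which is why `g` has to vanish on the empty set. -/
theorem sum_atoms_labelAlg [Fintype ι] {φ : Ω → ι} (hφ : IsLabelling φ) {g : Set Ω → ℝ}
    (h0 : g ∅ = 0) : ∑ A ∈ (labelAlg φ).atoms, g A = ∑ i, g (φ ⁻¹' {i}) := by
  classical
  have h1 : (labelAlg φ).atoms =
      (Finset.univ.filter fun i => (φ ⁻¹' {i}).Nonempty).image fun i => φ ⁻¹' {i} := by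
    ext A
    rw [mem_atoms_labelAlg hφ]
    simp only [Finset.mem_image, Finset.mem_filter, Finset.mem_univ, true_and]
    constructor
    · rintro ⟨x, rfl⟩
      exact ⟨φ x, ⟨x, rfl⟩, rfl⟩
    · rintro ⟨i, ⟨x, rfl⟩, rfl⟩
      exact ⟨x, rfl⟩
  rw [h1, Finset.sum_image, Finset.sum_filter]
  · refine Finset.sum_congr rfl fun i _ => ?_
    split_ifs with h
    · rfl
    · rw [Set.not_nonempty_iff_eq_empty.1 h, h0]
  · intro i hi j _ hij
    obtain ⟨x, hx⟩ := (Finset.mem_filter.1 hi).2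
    have hx' : x ∈ φ ⁻¹' {j} := by
      have hij' : φ ⁻¹' {i} = φ ⁻¹' {j} := hij
      rwa [← hij']
    exact (show φ x = i from hx).symm.trans hx'

theorem FiniteSubalgebra.subset_of_mem_atoms {𝒜 : FiniteSubalgebra Ω} {A C : Set Ω}
    (hA : A ∈ 𝒜.atoms) (hC : C ∈ 𝒜.alg) {x : Ω} (hxA : x ∈ A) (hxC : x ∈ C) : A ⊆ C := by
  rw [mem_atoms] at hA
  have hmem : A ∩ C ∈ 𝒜.alg := BooleanSubalgebra.inf_mem hA.prop.1 hC
  have : A ⊆ A ∩ C := hA.le_of_le ⟨hmem, Set.Nonempty.ne_empty ⟨x, hxA, hxC⟩⟩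
    Set.inter_subset_left
  exact this.trans Set.inter_subset_right

/-- Every finite algebra comes from a labelling by an enumeration of its atoms. -/
theorem FiniteSubalgebra.exists_labelling (𝒜 : FiniteSubalgebra Ω) :
    ∃ φ : Ω → Fin 𝒜.atoms.card, IsLabelling φ ∧ Function.Surjective φ ∧ labelAlg φ = 𝒜 ∧
      ∀ i, φ ⁻¹' {i} = (𝒜.atoms.equivFin.symm i : Set Ω) := by
  choose a ha hxa using 𝒜.exists_mem_atoms
  let φ : Ω → Fin 𝒜.atoms.card := fun x => 𝒜.atoms.equivFin ⟨a x, ha x⟩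
  have huniq : ∀ x, ∀ A ∈ 𝒜.atoms, x ∈ A → a x = A := by
    intro x A hA hx
    by_contra hne
    exact Set.disjoint_left.1 (𝒜.pairwiseDisjoint_atoms (Finset.mem_coe.2 (ha x))
      (Finset.mem_coe.2 hA) hne) (hxa x) hx
  have hfib : ∀ i, φ ⁻¹' {i} = (𝒜.atoms.equivFin.symm i : Set Ω) := by
    intro i
    ext x
    have h1 : x ∈ φ ⁻¹' {i} ↔ (⟨a x, ha x⟩ : 𝒜.atoms) = 𝒜.atoms.equivFin.symm i := by
      rw [Equiv.eq_symm_apply]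
      rfl
    rw [h1, Subtype.ext_iff]
    constructor
    · intro h
      have := hxa x
      simp only at h
      rwa [h] at this
    · exact fun h => huniq x _ (𝒜.atoms.equivFin.symm i).2 h
  have hφ : IsLabelling φ := isLabelling_of_singleton fun i => by
    rw [hfib]
    exact FiniteSubalgebra.measurableSet_of_mem_atoms (𝒜.atoms.equivFin.symm i).2
  refine ⟨φ, hφ, fun i => ?_, FiniteSubalgebra.ext_mem fun A => ?_, hfib⟩
  · have h1 := (FiniteSubalgebra.mem_atoms.1 (𝒜.atoms.equivFin.symm i).2).prop.2
    obtain ⟨x, hx⟩ := Set.nonempty_iff_ne_empty.2 h1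
    rw [← hfib] at hx
    exact ⟨x, hx⟩
  · rw [mem_labelAlg hφ]
    constructor
    · rintro ⟨s, rfl⟩
      induction s, s.toFinite using Set.Finite.induction_on with
      | empty => exact BooleanSubalgebra.bot_mem
      | @insert i s _ _ ih =>
        have : φ ⁻¹' insert i s = φ ⁻¹' {i} ⊔ φ ⁻¹' s := by
          ext x
          simp
        rw [this]
        refine BooleanSubalgebra.sup_mem ?_ ih
        rw [hfib]
        exact (FiniteSubalgebra.mem_atoms.1 (𝒜.atoms.equivFin.symm i).2).prop.1
    · intro hA
      refine ⟨φ '' A, Set.Subset.antisymm ?_ (Set.subset_preimage_image φ A)⟩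
      rintro x ⟨y, hy, hyx⟩
      have h1 : a y = a x := by simpa [φ] using hyx
      have h2 := 𝒜.subset_of_mem_atoms (ha y) hA (hxa y) hy
      exact h2 (h1 ▸ hxa x)

theorem FiniteSubalgebra.exists_eq_labelAlg (𝒜 : FiniteSubalgebra Ω) :
    ∃ (n : ℕ) (φ : Ω → Fin n), IsLabelling φ ∧ labelAlg φ = 𝒜 := by
  obtain ⟨φ, h1, -, h2, -⟩ := 𝒜.exists_labelling
  exact ⟨_, φ, h1, h2⟩

theorem numAtoms_labelAlg [Finite ι] {P : Measure Ω} {φ : Ω → ι} (hφ : IsLabelling φ)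
    (hpos : ∀ i, P (φ ⁻¹' {i}) ≠ 0) : FiniteSubalgebra.numAtoms P (labelAlg φ) = Nat.card ι := by
  have hne : ∀ i, (φ ⁻¹' {i}).Nonempty := fun i => nonempty_of_measure_ne_zero (hpos i)
  have h1 : {A : Set Ω | A ∈ (labelAlg φ).atoms ∧ P A ≠ 0} = (fun i => φ ⁻¹' {i}) '' Set.univ := by
    ext A
    simp only [Set.mem_ofPred_eq, mem_atoms_labelAlg hφ, Set.image_univ, Set.mem_range]
    constructor
    · rintro ⟨⟨x, rfl⟩, -⟩
      exact ⟨φ x, rfl⟩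
    · rintro ⟨i, rfl⟩
      obtain ⟨x, hx⟩ := hne i
      have hx' : φ x = i := hx
      exact ⟨⟨x, by rw [hx']⟩, hpos i⟩
  rw [FiniteSubalgebra.numAtoms, h1, Set.ncard_image_of_injective, Set.ncard_univ]
  intro i j hij
  obtain ⟨x, hx⟩ := hne i
  have hx' : x ∈ φ ⁻¹' {j} := by
    have hij' : φ ⁻¹' {i} = φ ⁻¹' {j} := hij
    rwa [← hij']
  exact (show φ x = i from hx).symm.trans hx'

end Atoms

/-! ### The functional `L_m` -/

section Lm

variable {Ω ι κ : Type*} [MeasurableSpace Ω] {P : Measure Ω} [IsProbabilityMeasure P]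
  {m : SignedMeasure Ω}

theorem SignedMeasure.isFinAdditive (m : SignedMeasure Ω) : IsFinAdditive fun A => m A :=
  fun _ _ hA hB hAB => VectorMeasure.of_union hAB hA hB

theorem measureReal_isFinAdditive (P : Measure Ω) [IsProbabilityMeasure P] :
    IsFinAdditive fun A => P.real A :=
  fun _ _ _ hB hAB => measureReal_union hAB hB

theorem IsAbsCont.eq_zero {P : Measure Ω} (hm : IsAbsCont P m) {A : Set Ω} (hA : MeasurableSet A)
    (h0 : P.real A = 0) : m A = 0 := by
  by_contra hne
  obtain ⟨δ, hδ, h⟩ := hm |m A| (abs_pos.2 hne)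
  exact lt_irrefl _ (h A hA (by rwa [h0]))

theorem Lm_labelAlg {P : Measure Ω} [Fintype ι] (m : SignedMeasure Ω) {φ : Ω → ι}
    (hφ : IsLabelling φ) :
    Lm P m (labelAlg φ) = ∑ i, m (φ ⁻¹' {i}) * Real.logb 2 (1 / law P φ i) :=
  sum_atoms_labelAlg hφ (g := fun A => m A * Real.logb 2 (1 / P.real A)) (by simp)

theorem labelIndep_of_independent {P : Measure Ω} [Finite ι] [Finite κ] {φ : Ω → ι} {χ : Ω → κ}
    (hφ : IsLabelling φ) (hχ : IsLabelling χ)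
    (h : FiniteSubalgebra.Independent P (labelAlg φ) (labelAlg χ)) : LabelIndep P φ χ := by
  intro i k
  have := h _ ((mem_labelAlg hφ).2 ⟨{i}, rfl⟩) _ ((mem_labelAlg hχ).2 ⟨{k}, rfl⟩)
  rw [measureReal_def, this, ENNReal.toReal_mul]
  rfl

theorem isAdditivePartitionEntropy_Lm (hm : IsAbsCont P m) :
    IsAdditivePartitionEntropy P (Lm P m) := by
  intro 𝒜 ℬ hind
  obtain ⟨m₁, φ, hφ, rfl⟩ := 𝒜.exists_eq_labelAlg
  obtain ⟨m₂, χ, hχ, rfl⟩ := ℬ.exists_eq_labelAlg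
  have hi := labelIndep_of_independent hφ hχ hind
  rw [← labelAlg_pair hφ hχ, Lm_labelAlg m (hφ.pair hχ), Lm_labelAlg m hφ, Lm_labelAlg m hχ,
    Fintype.sum_prod_type]
  have hterm : ∀ i k, m ((fun x => (φ x, χ x)) ⁻¹' {(i, k)}) *
      Real.logb 2 (1 / law P (fun x => (φ x, χ x)) (i, k)) =
      m (φ ⁻¹' {i} ∩ χ ⁻¹' {k}) * Real.logb 2 (1 / law P φ i) +
      m (χ ⁻¹' {k} ∩ φ ⁻¹' {i}) * Real.logb 2 (1 / law P χ k) := by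
    intro i k
    have hset : (fun x => (φ x, χ x)) ⁻¹' {(i, k)} = φ ⁻¹' {i} ∩ χ ⁻¹' {k} := by
      ext x
      simp
    rw [hset, hi.law_pair, Set.inter_comm (χ ⁻¹' {k}), ← mul_add]
    by_cases h0 : law P φ i * law P χ k = 0
    · rw [hm.eq_zero ((hφ _).inter (hχ _)) (by rw [hi, h0]), zero_mul, zero_mul]
    · obtain ⟨h1, h2⟩ := mul_ne_zero_iff.1 h0
      rw [← Real.logb_mul (one_div_ne_zero h1) (one_div_ne_zero h2)]
      congr 2
      field_simp
  simp only [hterm, Finset.sum_add_distrib]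
  congr 1
  · refine Finset.sum_congr rfl fun i _ => ?_
    rw [← Finset.sum_mul]
    congr 1
    exact ((SignedMeasure.isFinAdditive m).sum_inter P hχ (hφ {i})).symm
  · rw [Finset.sum_comm]
    refine Finset.sum_congr rfl fun i _ => ?_
    rw [← Finset.sum_mul]
    congr 1
    exact ((SignedMeasure.isFinAdditive m).sum_inter P hφ (hχ {i})).symm

/-- Continuity of one term of `L_m`. -/
theorem IsAbsCont.term_continuous (hm : IsAbsCont P m) {A : Set Ω} (hA : MeasurableSet A)
    (h0 : P.real A ≠ 0) {ε : ℝ} (hε : 0 < ε) :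
    ∃ δ : ℝ, 0 < δ ∧ ∀ B, MeasurableSet B → P.real (symmDiff A B) < δ →
      |m B * Real.logb 2 (1 / P.real B) - m A * Real.logb 2 (1 / P.real A)| < ε := by
  have hcont : ContinuousAt (fun z : ℝ × ℝ => z.1 * Real.logb 2 (1 / z.2)) (m A, P.real A) := by
    refine continuousAt_fst.mul ?_
    simp only [Real.logb]
    exact (((continuousAt_const.div continuousAt_snd h0).log (one_div_ne_zero h0)).div_const _)
  obtain ⟨η, hη, h⟩ := Metric.continuousAt_iff.1 hcont ε hε
  obtain ⟨δ, hδ, hmδ⟩ := hm (η / 2) (half_pos hη)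
  refine ⟨min δ η, lt_min hδ hη, fun B hB hAB => ?_⟩
  rw [lt_min_iff] at hAB
  have hsub1 : A \ B ⊆ symmDiff A B := fun x hx => Or.inl hx
  have hsub2 : B \ A ⊆ symmDiff A B := fun x hx => Or.inr hx
  have hadd : ∀ E : Set Ω → ℝ, IsFinAdditive E → E B - E A = E (B \ A) - E (A \ B) := by
    intro E hE
    have e1 := hE (A ∩ B) (A \ B) (hA.inter hB) (hA.diff hB)
      (Set.disjoint_left.2 fun x h1 h2 => h2.2 h1.2)
    have e2 := hE (A ∩ B) (B \ A) (hA.inter hB) (hB.diff hA)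
      (Set.disjoint_left.2 fun x h1 h2 => h2.2 h1.1)
    rw [Set.inter_union_sdiff] at e1
    rw [Set.inter_comm, Set.inter_union_sdiff] at e2
    rw [Set.inter_comm] at e1
    linarith
  have d1 : |m B - m A| < η := by
    have e := hadd _ (SignedMeasure.isFinAdditive m)
    rw [e]
    have k1 := hmδ (A \ B) (hA.diff hB) ((measureReal_mono hsub1).trans_lt hAB.1)
    have k2 := hmδ (B \ A) (hB.diff hA) ((measureReal_mono hsub2).trans_lt hAB.1)
    exact (abs_sub _ _).trans_lt (by linarith)
  have d2 : |P.real B - P.real A| < η := by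
    have e := hadd _ (measureReal_isFinAdditive P)
    rw [e]
    have k1 := (measureReal_mono (μ := P) hsub1).trans_lt hAB.2
    have k2 := (measureReal_mono (μ := P) hsub2).trans_lt hAB.2
    have k3 := measureReal_nonneg (μ := P) (s := A \ B)
    have k4 := measureReal_nonneg (μ := P) (s := B \ A)
    rw [abs_lt]
    constructor <;> linarith
  have := h (x := (m B, P.real B)) (by
    rw [Prod.dist_eq, max_lt_iff]
    exact ⟨d1, d2⟩)
  exact this

/-- Numbers of atoms that differ by less than one are equal. -/
theorem openDist_lt {P : Measure Ω} {𝒜 ℬ : FiniteSubalgebra Ω} {δ : ℝ} (hδ1 : δ ≤ 1)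
    (h : FiniteSubalgebra.openDist P 𝒜 ℬ < δ) :
    FiniteSubalgebra.numAtoms P 𝒜 = FiniteSubalgebra.numAtoms P ℬ ∧
    ∃ Z, MeasurableSet Z ∧ 𝒜.trace Zᶜ = ℬ.trace Zᶜ ∧ P.real Z < δ := by
  unfold FiniteSubalgebra.openDist at h
  set S := {r : ℝ | ∃ Z : Set Ω, MeasurableSet Z ∧ 𝒜.trace Zᶜ = ℬ.trace Zᶜ ∧ r = P.real Z}
  have hS0 : 0 ≤ sInf S := Real.sInf_nonneg (by
    rintro _ ⟨Z, -, -, rfl⟩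
    exact measureReal_nonneg)
  have habs := abs_nonneg
    ((FiniteSubalgebra.numAtoms P 𝒜 : ℝ) - (FiniteSubalgebra.numAtoms P ℬ : ℝ))
  constructor
  · have h1 : |((FiniteSubalgebra.numAtoms P 𝒜 : ℤ) - (FiniteSubalgebra.numAtoms P ℬ : ℤ) : ℤ)|
        < 1 := by
      have : |(FiniteSubalgebra.numAtoms P 𝒜 : ℝ) - (FiniteSubalgebra.numAtoms P ℬ : ℝ)| < 1 := by
        linarith
      exact_mod_cast this
    rw [Int.abs_lt_one_iff] at h1
    omega
  · have hne : S.Nonempty := by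
      refine ⟨_, Set.univ, MeasurableSet.univ, ?_, rfl⟩
      have : ∀ 𝒞 : FiniteSubalgebra Ω, 𝒞.trace (Set.univ)ᶜ = {∅} := by
        intro 𝒞
        ext A
        simp only [FiniteSubalgebra.trace, Set.compl_univ, Set.inter_empty, Set.mem_image,
          Set.mem_singleton_iff]
        constructor
        · rintro ⟨B, -, rfl⟩
          rfl
        · rintro rfl
          exact ⟨⊥, BooleanSubalgebra.bot_mem, rfl⟩
      rw [this, this]
    obtain ⟨_, ⟨Z, h1, h2, rfl⟩, h3⟩ := exists_lt_of_csInf_lt hne (show sInf S < δ by linarith)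
    exact ⟨Z, h1, h2, h3⟩

/-- Continuity of `L_m`. If `𝒜` and `ℬ` have the same trace on `Ω \ Z` and the same number of atoms
of positive probability, and `Z` is less likely than each of these atoms of `𝒜`, then the atoms of
`𝒜` and `ℬ` of positive probability correspond to each other bijectively, up to subsets of `Z`, and
the terms of `L_m` are compared one by one. -/
theorem isContinuousEntropy_Lm (hm : IsAbsCont P m) : IsContinuousEntropy P (Lm P m) := by
  classical
  intro 𝒜 ε hε
  let f : Set Ω → ℝ := fun A => m A * Real.logb 2 (1 / P.real A)
  let pos : FiniteSubalgebra Ω → Finset (Set Ω) := fun 𝒞 => 𝒞.atoms.filter fun A => P.real A ≠ 0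
  have hLm : ∀ 𝒞 : FiniteSubalgebra Ω, Lm P m 𝒞 = ∑ A ∈ pos 𝒞, f A := by
    intro 𝒞
    refine (Finset.sum_filter_of_ne (p := fun A => P.real A ≠ 0) fun A hA hne h0 => hne ?_).symm
    simp [h0]
  have hcard : ∀ 𝒞 : FiniteSubalgebra Ω, FiniteSubalgebra.numAtoms P 𝒞 = (pos 𝒞).card := by
    intro 𝒞
    rw [FiniteSubalgebra.numAtoms, ← Set.ncard_coe_finset]
    congr 1
    ext A
    simp [pos, measureReal_eq_zero_iff]
  have hε' : 0 < ε / ((pos 𝒜).card + 1) := by positivity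
  have hδA : ∀ A ∈ pos 𝒜, ∀ᶠ δ in nhdsWithin (0 : ℝ) (Set.Ioi 0), δ < P.real A ∧
      ∀ B, MeasurableSet B → P.real (symmDiff A B) < δ → |f B - f A| < ε / ((pos 𝒜).card + 1) := by
    intro A hA
    obtain ⟨hA1, hA2⟩ := Finset.mem_filter.1 hA
    obtain ⟨δ, hδ, h⟩ := hm.term_continuous (FiniteSubalgebra.measurableSet_of_mem_atoms hA1) hA2
      hε'
    have hApos : 0 < P.real A := lt_of_le_of_ne measureReal_nonneg hA2.symm
    filter_upwards [Ioo_mem_nhdsGT (lt_min hδ hApos)] with δ' hδ'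
    have h2 := lt_min_iff.1 hδ'.2
    exact ⟨h2.2, fun B hB hAB => h B hB (hAB.trans h2.1)⟩
  obtain ⟨δ, hδall, hδ0, hδ1⟩ := (((Filter.eventually_all_finset _).2 hδA).and
    (Ioo_mem_nhdsGT (zero_lt_one' ℝ))).exists
  refine ⟨δ, hδ0, fun ℬ hℬ => ?_⟩
  obtain ⟨hN, Z, hZ, htr, hPZ⟩ := openDist_lt hδ1.le hℬ
  -- an atom of `𝒜` is matched with the atom of `ℬ` that contains a common point outside `Z`
  have hmatch : ∀ A ∈ pos 𝒜, ∃ B ∈ pos ℬ, A ∩ Zᶜ = B ∩ Zᶜ ∧ (A ∩ Zᶜ).Nonempty := by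
    intro A hA
    have hA1 := (Finset.mem_filter.1 hA).1
    have hPA := (hδall A hA).1
    have hpos : 0 < P.real (A ∩ Zᶜ) := by
      have := le_measureReal_sdiff (μ := P) (s₁ := A) (s₂ := Z)
      rw [Set.sdiff_eq] at this
      linarith
    obtain ⟨x, hxA, hxZ⟩ := nonempty_of_measureReal_ne_zero hpos.ne'
    obtain ⟨B, hB, hxB⟩ := ℬ.exists_mem_atoms x
    have hsub : ∀ (𝒞 𝒟 : FiniteSubalgebra Ω) (C D : Set Ω), 𝒞.trace Zᶜ = 𝒟.trace Zᶜ →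
        C ∈ 𝒞.atoms → D ∈ 𝒟.atoms → x ∈ C → x ∈ D → C ∩ Zᶜ ⊆ D ∩ Zᶜ := by
      intro 𝒞 𝒟 C D h hC hD hxC hxD
      have h1 : D ∩ Zᶜ ∈ 𝒞.trace Zᶜ := by
        rw [h]
        exact ⟨D, (FiniteSubalgebra.mem_atoms.1 hD).prop.1, rfl⟩
      obtain ⟨E, hE, hED⟩ := h1
      have hxE : x ∈ E := by
        have : x ∈ D ∩ Zᶜ := ⟨hxD, hxZ⟩
        rw [← hED] at this
        exact this.1
      rw [← hED]
      exact Set.inter_subset_inter_left _ (𝒞.subset_of_mem_atoms hC hE hxC hxE)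
    have heq : A ∩ Zᶜ = B ∩ Zᶜ := Set.Subset.antisymm (hsub 𝒜 ℬ A B htr hA1 hB hxA hxB)
      (hsub ℬ 𝒜 B A htr.symm hB hA1 hxB hxA)
    refine ⟨B, Finset.mem_filter.2 ⟨hB, ?_⟩, heq, ⟨x, hxA, hxZ⟩⟩
    have : P.real (A ∩ Zᶜ) ≤ P.real B := by
      rw [heq]
      exact measureReal_mono Set.inter_subset_left
    exact (hpos.trans_le this).ne'
  choose! σ hσ1 hσ2 hσ3 using hmatch
  have hinj : Set.InjOn σ (pos 𝒜) := by
    intro A hA A' hA' h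
    by_contra hne
    obtain ⟨x, hx⟩ := hσ3 A hA
    have hx' : x ∈ A' ∩ Zᶜ := by
      rw [hσ2 A' hA', ← h, ← hσ2 A hA]
      exact hx
    exact Set.disjoint_left.1 (𝒜.pairwiseDisjoint_atoms
      (Finset.mem_coe.2 (Finset.mem_filter.1 hA).1)
      (Finset.mem_coe.2 (Finset.mem_filter.1 hA').1) hne) hx.1 hx'.1
  have himg : (pos 𝒜).image σ = pos ℬ := by
    refine Finset.eq_of_subset_of_card_le (Finset.image_subset_iff.2 hσ1) ?_
    rw [Finset.card_image_of_injOn hinj, ← hcard, ← hcard, hN]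
  rw [hLm, hLm, ← himg, Finset.sum_image hinj, ← Finset.sum_sub_distrib]
  have hterm : ∀ A ∈ pos 𝒜, |f (σ A) - f A| ≤ ε / ((pos 𝒜).card + 1) := by
    intro A hA
    have hB := (Finset.mem_filter.1 (hσ1 A hA)).1
    refine ((hδall A hA).2 _ (FiniteSubalgebra.measurableSet_of_mem_atoms hB) ?_).le
    refine lt_of_le_of_lt (measureReal_mono fun x hx => ?_) hPZ
    by_contra hxZ
    have h1 : x ∈ A ↔ x ∈ σ A := by
      have := Set.ext_iff.1 (hσ2 A hA) x
      simpa [hxZ] using this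
    rcases hx with ⟨h2, h3⟩ | ⟨h2, h3⟩
    · exact h3 (h1.1 h2)
    · exact h3 (h1.2 h2)
  refine ((Finset.abs_sum_le_sum_abs _ _).trans (Finset.sum_le_sum hterm)).trans_lt ?_
  rw [Finset.sum_const, nsmul_eq_mul, ← mul_div_assoc, div_lt_iff₀ (by positivity)]
  nlinarith

end Lm

/-! ### Entropies that only depend on the law of the partition -/

section Swap

variable {Ω ι κ : Type*} [MeasurableSpace Ω] {P : Measure Ω} [IsProbabilityMeasure P]

open Classical in
/-- The values of a finitely additive set function on the cells after an exchange. -/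
theorem IsFinAdditive.swapCells {E : Set Ω → ℝ} (hE : IsFinAdditive E) {φ : Ω → ι}
    (hφ : IsLabelling φ) {i j : ι} (hij : i ≠ j) {X Y : Set Ω} (hX : MeasurableSet X)
    (hY : MeasurableSet Y) (hXi : X ⊆ φ ⁻¹' {i}) (hYj : Y ⊆ φ ⁻¹' {j}) (k : ι) :
    E (swapCells φ X Y i j ⁻¹' {k}) = E (φ ⁻¹' {k}) +
      (if k = j then E X - E Y else 0) - (if k = i then E X - E Y else 0) := by
  have hXY : Disjoint X Y := Set.disjoint_left.2 fun x hx hx' => hij ((hXi hx).symm.trans (hYj hx'))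
  have hsub : ∀ {A B : Set Ω}, A ⊆ B → MeasurableSet A → MeasurableSet B →
      E B = E A + E (B \ A) := fun {A B} hAB hA hB => by
    rw [← hE A (B \ A) hA (hB.diff hA) disjoint_sdiff_self_right, Set.union_sdiff_cancel hAB]
  by_cases hki : k = i
  · subst hki
    rw [if_neg hij, if_pos rfl]
    have h1 : _root_.swapCells φ X Y k j ⁻¹' {k} = (φ ⁻¹' {k} \ X) ∪ Y := by
      ext x
      have h2 := @hYj x
      have h3 : x ∈ X → x ∉ Y := fun h h' => Set.disjoint_left.1 hXY h h'
      by_cases hx : x ∈ X <;> by_cases hy : x ∈ Y <;> simp_all [_root_.swapCells, hij.symm]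
    have h2 : Disjoint (φ ⁻¹' {k} \ X) Y :=
      Set.disjoint_left.2 fun x hx hy => hij (hx.1.symm.trans (hYj hy))
    rw [h1, hE _ _ ((hφ _).diff hX) hY h2, hsub hXi hX (hφ _)]
    ring
  · by_cases hkj : k = j
    · subst hkj
      rw [if_neg hki, if_pos rfl]
      have h1 : _root_.swapCells φ X Y i k ⁻¹' {k} = (φ ⁻¹' {k} \ Y) ∪ X := by
        ext x
        have h2 := @hXi x
        have h3 : x ∈ X → x ∉ Y := fun h h' => Set.disjoint_left.1 hXY h h'
        by_cases hx : x ∈ X <;> by_cases hy : x ∈ Y <;> simp_all [_root_.swapCells]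
      have h2 : Disjoint (φ ⁻¹' {k} \ Y) X :=
        Set.disjoint_left.2 fun x hx hy => hij ((hXi hy).symm.trans hx.1)
      rw [h1, hE _ _ ((hφ _).diff hY) hX h2, hsub hYj hY (hφ _)]
      ring
    · rw [if_neg hki, if_neg hkj]
      have h1 : _root_.swapCells φ X Y i j ⁻¹' {k} = φ ⁻¹' {k} := by
        ext x
        have h2 := @hXi x
        have h3 := @hYj x
        by_cases hx : x ∈ X <;> by_cases hy : x ∈ Y <;>
          simp_all [_root_.swapCells, eq_comm]
      rw [h1]
      ring

theorem law_swapCells {φ : Ω → ι} (hφ : IsLabelling φ) {i j : ι} (hij : i ≠ j) {X Y : Set Ω}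
    (hX : MeasurableSet X) (hY : MeasurableSet Y) (hXi : X ⊆ φ ⁻¹' {i}) (hYj : Y ⊆ φ ⁻¹' {j})
    (hXY : P.real X = P.real Y) : law P (swapCells φ X Y i j) = law P φ := by
  funext k
  have := (measureReal_isFinAdditive P).swapCells hφ hij hX hY hXi hYj k
  simpa [law, hXY] using this

/-- The change of `L_m` under an exchange has the same form as that of an additive partition
entropy. -/
theorem Lm_sub_swapCells [Finite ι] (m : SignedMeasure Ω) {φ : Ω → ι} (hφ : IsLabelling φ)
    {i j : ι} (hij : i ≠ j) {X Y : Set Ω} (hX : MeasurableSet X) (hY : MeasurableSet Y)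
    (hXi : X ⊆ φ ⁻¹' {i}) (hYj : Y ⊆ φ ⁻¹' {j}) (hXY : P.real X = P.real Y)
    (hi : 0 < law P φ i) (hj : 0 < law P φ j) :
    Lm P m (labelAlg φ) - Lm P m (labelAlg (swapCells φ X Y i j)) =
      Real.logb 2 (law P φ j / law P φ i) * (m X - m Y) := by
  classical
  have := Fintype.ofFinite ι
  rw [Lm_labelAlg m hφ, Lm_labelAlg m (hφ.swapCells hX hY i j),
    law_swapCells hφ hij hX hY hXi hYj hXY, ← Finset.sum_sub_distrib]
  have h1 : ∀ k, m (φ ⁻¹' {k}) * Real.logb 2 (1 / law P φ k) -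
      m (swapCells φ X Y i j ⁻¹' {k}) * Real.logb 2 (1 / law P φ k) =
      (if k = i then (m X - m Y) * Real.logb 2 (1 / law P φ k) else 0) -
      (if k = j then (m X - m Y) * Real.logb 2 (1 / law P φ k) else 0) := by
    intro k
    have := (SignedMeasure.isFinAdditive m).swapCells hφ hij hX hY hXi hYj k
    rw [this]
    split_ifs <;> ring
  rw [Finset.sum_congr rfl fun k _ => h1 k, Finset.sum_sub_distrib, Finset.sum_ite_eq',
    Finset.sum_ite_eq', if_pos (Finset.mem_univ _), if_pos (Finset.mem_univ _),
    Real.logb_div hj.ne' hi.ne', one_div, one_div, Real.logb_inv, Real.logb_inv]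
  ring

theorem IsLabelling.law_add_law_le {φ : Ω → ι} (hφ : IsLabelling φ) {i j : ι} (hij : i ≠ j) :
    law P φ i + law P φ j ≤ 1 := by
  unfold law
  rw [← measureReal_union _ (hφ _)]
  · exact measureReal_le_one
  · exact Set.disjoint_left.2 fun x hx hx' => hij (hx.symm.trans hx')

variable {J : FiniteSubalgebra Ω → ℝ}

/-- Invariance under exchanges of small events of equal probability, with a bound that depends
only on the probabilities of the two cells, gives invariance under all exchanges of events of equal
probability: a large exchange is a succession of small ones, none of which changes the law. -/
theorem swapCells_invariant_of_small [Finite ι] (hP : IsNonatomic P) {a b r : ℝ} (hr : 0 < r)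
    {i j : ι} (hij : i ≠ j)
    (h : ∀ φ : Ω → ι, IsLabelling φ → law P φ i = a → law P φ j = b →
      ∀ X Y, MeasurableSet X → MeasurableSet Y → X ⊆ φ ⁻¹' {i} → Y ⊆ φ ⁻¹' {j} →
        P.real X = P.real Y → P.real X ≤ r → J (labelAlg φ) = J (labelAlg (swapCells φ X Y i j)))
    {φ : Ω → ι} (hφ : IsLabelling φ) (ha : law P φ i = a) (hb : law P φ j = b) {X Y : Set Ω}
    (hX : MeasurableSet X) (hY : MeasurableSet Y) (hXi : X ⊆ φ ⁻¹' {i}) (hYj : Y ⊆ φ ⁻¹' {j})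
    (hXY : P.real X = P.real Y) :
    J (labelAlg φ) = J (labelAlg (swapCells φ X Y i j)) := by
  classical
  have key : ∀ n : ℕ, ∀ φ : Ω → ι, IsLabelling φ → law P φ i = a → law P φ j = b →
      ∀ X Y, MeasurableSet X → MeasurableSet Y → X ⊆ φ ⁻¹' {i} → Y ⊆ φ ⁻¹' {j} →
        P.real X = P.real Y → P.real X ≤ 2 ^ n * r →
        J (labelAlg φ) = J (labelAlg (swapCells φ X Y i j)) := by
    intro n
    induction n with
    | zero =>
      intro φ hφ ha hb X Y hX hY hXi hYj hXY hXr
      exact h φ hφ ha hb X Y hX hY hXi hYj hXY (by simpa using hXr)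
    | succ n ih =>
      intro φ hφ ha hb X Y hX hY hXi hYj hXY hXr
      have hX0 : 0 ≤ P.real X := measureReal_nonneg
      obtain ⟨X₁, hX₁, hX₁X, hPX₁⟩ := hP.exists_real_eq hX (r := P.real X / 2) (by linarith)
        (by linarith)
      obtain ⟨Y₁, hY₁, hY₁Y, hPY₁⟩ := hP.exists_real_eq hY (r := P.real X / 2) (by linarith)
        (by linarith)
      have hXr' : P.real X / 2 ≤ 2 ^ n * r := by
        rw [pow_succ] at hXr
        linarith
      have hl := law_swapCells hφ hij hX₁ hY₁ (hX₁X.trans hXi) (hY₁Y.trans hYj)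
        (hPX₁.trans hPY₁.symm)
      have h1 := ih φ hφ ha hb X₁ Y₁ hX₁ hY₁ (hX₁X.trans hXi) (hY₁Y.trans hYj)
        (hPX₁.trans hPY₁.symm) (hPX₁.trans_le hXr')
      have hPX₂ : P.real (X \ X₁) = P.real X / 2 := by
        rw [measureReal_sdiff hX₁X hX₁, hPX₁]
        ring
      have hPY₂ : P.real (Y \ Y₁) = P.real X / 2 := by
        rw [measureReal_sdiff hY₁Y hY₁, hPY₁, ← hXY]
        ring
      have h2 := ih (swapCells φ X₁ Y₁ i j) (hφ.swapCells hX₁ hY₁ i j) (hl ▸ ha) (hl ▸ hb)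
        (X \ X₁) (Y \ Y₁) (hX.diff hX₁) (hY.diff hY₁) ?_ ?_ (hPX₂.trans hPY₂.symm)
        (hPX₂.trans_le hXr')
      · rw [h1, h2]
        congr 2
        funext x
        by_cases c1 : x ∈ X
        · have c3 : x ∉ Y := fun hy => hij ((hXi c1).symm.trans (hYj hy))
          have c4 : x ∉ Y₁ := fun hy => c3 (hY₁Y hy)
          by_cases c2 : x ∈ X₁ <;> simp [swapCells, c1, c2, c3, c4]
        · have c2 : x ∉ X₁ := fun hx => c1 (hX₁X hx)
          by_cases c3 : x ∈ Y
          · by_cases c4 : x ∈ Y₁ <;> simp [swapCells, c1, c2, c3, c4]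
          · have c4 : x ∉ Y₁ := fun hy => c3 (hY₁Y hy)
            simp [swapCells, c1, c2, c3, c4]
      · intro x hx
        have e1 : x ∉ Y₁ := fun hy => hij ((hXi hx.1).symm.trans (hYj (hY₁Y hy)))
        have e2 := hXi hx.1
        simpa [swapCells, hx.2, e1] using e2
      · intro x hx
        have e1 : x ∉ X₁ := fun hy => hij ((hXi (hX₁X hy)).symm.trans (hYj hx.1))
        have e2 := hYj hx.1
        simpa [swapCells, hx.2, e1] using e2
  obtain ⟨n, hn⟩ := pow_unbounded_of_one_lt (P.real X / r) (one_lt_two)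
  exact key n φ hφ ha hb X Y hX hY hXi hYj hXY ((div_le_iff₀ hr).1 hn.le)

/-- `J` does not change when two events of equal probability are exchanged between two cells. -/
def IsSwapInvariant (P : Measure Ω) (J : FiniteSubalgebra Ω → ℝ) : Prop :=
  ∀ (n : ℕ) (φ : Ω → Fin n) (i j : Fin n) (X Y : Set Ω), IsLabelling φ → i ≠ j →
    MeasurableSet X → MeasurableSet Y → X ⊆ φ ⁻¹' {i} → Y ⊆ φ ⁻¹' {j} → P.real X = P.real Y →
    J (labelAlg φ) = J (labelAlg (swapCells φ X Y i j))

/-- Subtracting the correction `L_m` turns an additive partition entropy that is continuous on the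
algebras with two atoms into one that is invariant under exchanges. -/
theorem exists_isSwapInvariant_sub_Lm {I : FiniteSubalgebra Ω → ℝ} (hP : IsNonatomic P)
    (hI : IsAdditivePartitionEntropy P I) (hIc : IsContinuousOnTwoAtom P I) :
    ∃ m : SignedMeasure Ω, IsAbsCont P m ∧ m Set.univ = 0 ∧
      IsAdditivePartitionEntropy P (fun 𝒜 => I 𝒜 - Lm P m 𝒜) ∧
      IsSwapInvariant P (fun 𝒜 => I 𝒜 - Lm P m 𝒜) := by
  obtain ⟨m, hm, hm0, hgain⟩ := exists_signedMeasure_swapGain hP hI hIc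
  have hJ : IsAdditivePartitionEntropy P (fun 𝒜 => I 𝒜 - Lm P m 𝒜) := by
    intro 𝒜 ℬ hind
    simp only
    rw [hI 𝒜 ℬ hind, isAdditivePartitionEntropy_Lm hm 𝒜 ℬ hind]
    ring
  refine ⟨m, hm, hm0, hJ, fun n φ i j X Y hφ hij hX hY hXi hYj hXY => ?_⟩
  rcases (measureReal_nonneg (μ := P) (s := X)).eq_or_lt with h0 | hpos
  · refine hJ.congr_ae hφ (hφ.swapCells hX hY i j) ?_
    refine le_antisymm ?_ measureReal_nonneg
    have : {x | φ x ≠ swapCells φ X Y i j x} ⊆ X ∪ Y := by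
      intro x hx
      by_contra hxx
      rw [Set.mem_union, not_or] at hxx
      exact hx (by simp [swapCells, hxx.1, hxx.2])
    calc _ ≤ P.real (X ∪ Y) := measureReal_mono this
      _ ≤ P.real X + P.real Y := measureReal_union_le _ _
      _ = 0 := by rw [← hXY, ← h0, add_zero]
  · have hi : 0 < law P φ i := hpos.trans_le (measureReal_mono hXi)
    have hj : 0 < law P φ j := (hXY ▸ hpos).trans_le (measureReal_mono hYj)
    set a := law P φ i with ha
    set b := law P φ j with hb
    obtain ⟨δ, hδ, hgain⟩ := hgain (a / (a + b)) (by positivity)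
      ((div_lt_one (by positivity)).2 (by linarith))
    have hr : 0 < min δ (a * b / 4) := lt_min hδ (by positivity)
    refine swapCells_invariant_of_small (a := a) (b := b)
      (J := fun 𝒜 => I 𝒜 - Lm P m 𝒜) hP hr hij ?_ hφ ha.symm hb.symm
      hX hY hXi hYj hXY
    intro φ' hφ' ha' hb' X Y hX hY hXi hYj hXY hXr
    have h1 := (entropy_sub_swapCells hP hI hφ' hij hX hY hXi hYj hXY (ha' ▸ hi) (hb' ▸ hj)
      (hφ'.law_add_law_le hij) (by
        rw [ha', hb']
        linarith [hXr.trans (min_le_right _ _)])).1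
    have h2 := Lm_sub_swapCells (P := P) m hφ' hij hX hY hXi hYj hXY (ha' ▸ hi) (hb' ▸ hj)
    rw [ha', hb'] at h1 h2
    rw [hgain X Y hX hY hXY (hXr.trans (min_le_left _ _))] at h1
    have h3 : (1 - a / (a + b)) / (a / (a + b)) = b / a := by
      have : a + b ≠ 0 := by positivity
      field_simp
      ring
    rw [h3] at h1
    linarith

end Swap

section SameLaw

variable {Ω ι κ : Type*} [MeasurableSpace Ω] {P : Measure Ω} [IsProbabilityMeasure P]
  {J : FiniteSubalgebra Ω → ℝ}

/-- Independent partitions with the same law have the same entropy: one of them is transformed into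
the other by exchanging, for all `i ≠ j`, the events `{φ = i, θ = j}` and `{φ = j, θ = i}`, which
have the same probability. -/
theorem IsSwapInvariant.eq_of_labelIndep {P : Measure Ω} (hJ : IsSwapInvariant P J) {n : ℕ}
    {φ θ : Ω → Fin n} (hφ : IsLabelling φ) (hθ : IsLabelling θ) (hind : LabelIndep P φ θ)
    (hlaw : law P θ = law P φ) : J (labelAlg φ) = J (labelAlg θ) := by
  classical
  let f : Finset (Sym2 (Fin n)) → Ω → Fin n := fun T x => if s(φ x, θ x) ∈ T then θ x else φ x
  have hf : ∀ T, IsLabelling (f T) := fun T =>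
    (hφ.pair hθ).comp fun z => if s(z.1, z.2) ∈ T then z.2 else z.1
  have key : ∀ T, J (labelAlg φ) = J (labelAlg (f T)) := by
    intro T
    induction T using Finset.induction_on with
    | empty => simp [f]
    | insert z T hz ih =>
      rw [ih]
      induction z using Sym2.ind with
      | _ i j =>
      by_cases hij : i = j
      · subst hij
        congr 2
        funext x
        by_cases h1 : s(φ x, θ x) = s(i, i)
        · have h2 : φ x = i ∧ θ x = i := by simpa using h1
          simp [f, h2]
        · simp only [f, Finset.mem_insert, h1, false_or]
      · have hX : MeasurableSet (φ ⁻¹' {i} ∩ θ ⁻¹' {j}) := (hφ _).inter (hθ _)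
        have hY : MeasurableSet (φ ⁻¹' {j} ∩ θ ⁻¹' {i}) := (hφ _).inter (hθ _)
        have h1 := hJ n (f T) i j _ _ (hf T) hij hX hY
          (by
            rintro x ⟨h1, h2⟩
            simp only [Set.mem_preimage, Set.mem_singleton_iff] at h1 h2
            simp [f, h1, h2, hz])
          (by
            rintro x ⟨h1, h2⟩
            simp only [Set.mem_preimage, Set.mem_singleton_iff] at h1 h2
            have hz' : s(j, i) ∉ T := by rwa [Sym2.eq_swap]
            simp [f, h1, h2, hz'])
          (by
            have e1 := hind i j
            have e2 := hind j i
            have e3 := congrFun hlaw i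
            have e4 := congrFun hlaw j
            rw [e1, e2, e3, e4, mul_comm])
        rw [h1]
        congr 2
        funext x
        by_cases hx : φ x = i ∧ θ x = j
        · simp [swapCells, f, hx]
        · by_cases hy : φ x = j ∧ θ x = i
          · have hz' : s(j, i) = s(i, j) := Sym2.eq_swap
            have hji : j ≠ i := Ne.symm hij
            simp [swapCells, f, hy, hij, hji]
          · have hne : s(φ x, θ x) ≠ s(i, j) := by
              rw [Ne, Sym2.eq_iff]
              tauto
            simp [swapCells, f, hx, hy, hne]
  rw [key Finset.univ]
  simp [f]

/-- An entropy that is invariant under exchanges depends on the law of the partition only: two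
partitions with the same law are compared with a third one that is independent of both. -/
theorem IsSwapInvariant.eq_of_law_eq (hP : IsNonatomic P) (hJ : IsSwapInvariant P J) {n : ℕ}
    {φ ψ : Ω → Fin n} (hφ : IsLabelling φ) (hψ : IsLabelling ψ) (hlaw : law P φ = law P ψ) :
    J (labelAlg φ) = J (labelAlg ψ) := by
  rcases subsingleton_or_nontrivial (Fin n) with h | h
  · congr 2
    funext x
    exact Subsingleton.elim _ _
  · obtain ⟨θ, hθ, hθlaw, hind⟩ := hP.exists_labelIndep_law (hφ.pair hψ) (w := law P φ)
      (law_nonneg φ) hφ.sum_law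
    have hi := hind.independent (hφ.pair hψ) hθ
    have real_eq : ∀ {A B : Set Ω}, P (A ∩ B) = P A * P B →
        P.real (A ∩ B) = P.real A * P.real B := fun {A B} h => by
      rw [measureReal_def, h, ENNReal.toReal_mul]
      rfl
    have h1 : LabelIndep P φ θ := fun i k => real_eq <|
      hi _ ((mem_labelAlg (hφ.pair hψ)).2 ⟨Prod.fst ⁻¹' {i}, rfl⟩) _
        ((mem_labelAlg hθ).2 ⟨{k}, rfl⟩)
    have h2 : LabelIndep P ψ θ := fun i k => real_eq <|
      hi _ ((mem_labelAlg (hφ.pair hψ)).2 ⟨Prod.snd ⁻¹' {i}, rfl⟩) _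
        ((mem_labelAlg hθ).2 ⟨{k}, rfl⟩)
    rw [hJ.eq_of_labelIndep hφ hθ h1 hθlaw, hJ.eq_of_labelIndep hψ hθ h2 (hθlaw.trans hlaw)]

end SameLaw

/-! ### The classical entropy -/

section Classical

variable {Ω ι κ : Type*} [MeasurableSpace Ω] {P : Measure Ω} [IsProbabilityMeasure P]
  {J : FiniteSubalgebra Ω → ℝ} {H : (n : ℕ) → stdSimplex ℝ (Fin n) → ℝ}

/-- An additive partition entropy that depends on the law only is of the form `H_P`. -/
theorem IsSwapInvariant.exists_additiveEntropy (hP : IsNonatomic P) (hJ : IsSwapInvariant P J)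
    (hadd : IsAdditivePartitionEntropy P J) :
    ∃ H : (n : ℕ) → stdSimplex ℝ (Fin n) → ℝ, IsAdditiveEntropy H ∧ ∀ 𝒜, J 𝒜 = HP P H 𝒜 := by
  choose φ hφ hlaw using fun (n : ℕ) (p : stdSimplex ℝ (Fin n)) =>
    hP.exists_labelling (w := p.1) p.2.1 p.2.2
  have hval : ∀ {n : ℕ} (p : stdSimplex ℝ (Fin n)) {ψ : Ω → Fin n}, IsLabelling ψ →
      law P ψ = p.1 → J (labelAlg (φ n p)) = J (labelAlg ψ) := fun p ψ hψ h =>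
    hJ.eq_of_law_eq hP (hφ _ p) hψ ((hlaw _ p).trans h.symm)
  refine ⟨fun n p => J (labelAlg (φ n p)), ⟨fun n s p => ?_, fun m n p q => ?_⟩, fun 𝒜 => ?_⟩
  · have h1 : IsLabelling fun x => s.symm (φ n p x) := (hφ n p).comp s.symm
    beta_reduce
    rw [hval (simplexPermute s p) h1]
    · exact congrArg J (labelAlg_congr h1 (hφ n p) fun x y => s.symm.injective.eq_iff)
    · funext i
      change _ = p.1 (s i)
      rw [← hlaw n p]
      unfold law
      congr 1
      ext x
      simp [Equiv.symm_apply_eq]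
  · set χ : Ω → Fin m × Fin n := fun x => finProdFinEquiv.symm (φ _ (simplexTensor p q) x) with hχd
    have hχ : IsLabelling χ := (hφ _ (simplexTensor p q)).comp finProdFinEquiv.symm
    have hl : ∀ i k, law P χ (i, k) = p.1 i * q.1 k := by
      intro i k
      have h1 := congrFun (hlaw _ (simplexTensor p q)) (finProdFinEquiv (i, k))
      have h2 : law P χ (i, k) = law P (φ _ (simplexTensor p q)) (finProdFinEquiv (i, k)) := by
        unfold law
        congr 1
        ext x
        simp only [hχd, Set.mem_preimage, Set.mem_singleton_iff, Equiv.symm_apply_eq]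
      rw [h2, h1]
      change p.1 (finProdFinEquiv.symm (finProdFinEquiv (i, k))).1 *
        q.1 (finProdFinEquiv.symm (finProdFinEquiv (i, k))).2 = _
      rw [Equiv.symm_apply_apply]
    have h3 : J (labelAlg (φ _ (simplexTensor p q))) = J (labelAlg χ) :=
      congrArg J (labelAlg_congr (hφ _ _) hχ fun x y => finProdFinEquiv.symm.injective.eq_iff.symm)
    have h4 := labelIndep_of_law_eq_mul (P := P) (hχ.comp Prod.fst) (hχ.comp Prod.snd) (u := p.1)
      (v := q.1) hl (fun s hs => by rw [Finset.eq_univ_of_forall hs]; exact p.2.2)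
      (fun s hs => by rw [Finset.eq_univ_of_forall hs]; exact q.2.2)
    beta_reduce
    rw [h3, hadd.fst_add_snd hχ hl p.2.2 q.2.2, hval p (hχ.comp Prod.fst) h4.2.1,
      hval q (hχ.comp Prod.snd) h4.2.2]
  · obtain ⟨ψ, hψ, -, hψ𝒜, hcell⟩ := 𝒜.exists_labelling
    unfold HP
    beta_reduce
    rw [hval (𝒜.atomProbs P) hψ, hψ𝒜]
    funext i
    unfold law
    rw [hcell]
    rfl

/-- If all cells are nonempty then `H_P` of the algebra of a labelling is `H` of its law; the order
in which the atoms are enumerated does not matter because `H` is symmetric. -/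
theorem HP_labelAlg (hH : IsAdditiveEntropy H) {n : ℕ} {φ : Ω → ι} [Finite ι] (hφ : IsLabelling φ)
    (hsurj : Function.Surjective φ) (e : ι ≃ Fin n) (p : stdSimplex ℝ (Fin n))
    (hp : ∀ i, law P φ i = p.1 (e i)) : HP P H (labelAlg φ) = H n p := by
  obtain ⟨ψ, hψ, hψs, hψ𝒜, hcell⟩ := (labelAlg φ).exists_labelling
  unfold HP
  have hq : ∀ i, ((labelAlg φ).atomProbs P).1 i = law P ψ i := by
    intro i
    unfold law
    rw [hcell]
    rfl
  generalize (labelAlg φ).atomProbs P = q at hq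
  clear hcell
  revert q ψ
  generalize (labelAlg φ).atoms.card = k
  intro ψ hψ hψs hψ𝒜 q hq
  -- the labels of `ψ` and of `φ` correspond to each other
  have hker : ∀ x y, ψ x = ψ y ↔ φ x = φ y := by
    intro x y
    have h1 : φ ⁻¹' {φ y} ∈ (labelAlg ψ).alg := by
      rw [hψ𝒜]
      exact (mem_labelAlg hφ).2 ⟨_, rfl⟩
    have h2 : ψ ⁻¹' {ψ y} ∈ (labelAlg φ).alg := by
      rw [← hψ𝒜]
      exact (mem_labelAlg hψ).2 ⟨_, rfl⟩
    obtain ⟨s, hs⟩ := (mem_labelAlg hψ).1 h1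
    obtain ⟨t, ht⟩ := (mem_labelAlg hφ).1 h2
    constructor
    · intro h
      have hy : y ∈ ψ ⁻¹' s := by rw [hs]; rfl
      have hx : x ∈ ψ ⁻¹' s := by
        change ψ x ∈ s
        rw [h]
        exact hy
      rw [hs] at hx
      exact hx
    · intro h
      have hy : y ∈ φ ⁻¹' t := by rw [ht]; rfl
      have hx : x ∈ φ ⁻¹' t := by
        change φ x ∈ t
        rw [h]
        exact hy
      rw [ht] at hx
      exact hx
  choose g hg using hψs
  let c : Fin k → ι := fun i => φ (g i)
  have hc : Function.Bijective c := by
    refine ⟨fun i j hij => ?_, fun i => ?_⟩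
    · rw [← hg i, ← hg j]
      exact (hker _ _).2 hij
    · obtain ⟨x, rfl⟩ := hsurj i
      exact ⟨ψ x, (hker _ _).1 (hg _)⟩
  let s : Fin k ≃ Fin n := (Equiv.ofBijective c hc).trans e
  obtain rfl : k = n := by simpa using Fintype.card_congr s
  have : q = simplexPermute s p := by
    refine Subtype.ext (funext fun i => ?_)
    rw [hq]
    change law P ψ i = p.1 (e (c i))
    rw [← hp]
    unfold law
    congr 1
    ext x
    simp only [Set.mem_preimage, Set.mem_singleton_iff, c]
    rw [← hker, hg]
  rw [this, hH.1]

end Classical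

/-! ### Uniqueness of the decomposition -/

section Uniqueness

variable {Ω ι κ : Type*} [MeasurableSpace Ω] {P : Measure Ω} [IsProbabilityMeasure P]
  {H : (n : ℕ) → stdSimplex ℝ (Fin n) → ℝ}

theorem HP_labelAlg_congr (hH : IsAdditiveEntropy H) [Finite ι] {φ ψ : Ω → ι} (hφ : IsLabelling φ)
    (hψ : IsLabelling ψ) (hφs : Function.Surjective φ) (hψs : Function.Surjective ψ)
    (h : law P φ = law P ψ) : HP P H (labelAlg φ) = HP P H (labelAlg ψ) := by
  have := Fintype.ofFinite ι
  let e := Fintype.equivFin ι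
  let p : stdSimplex ℝ (Fin (Fintype.card ι)) := ⟨fun i => law P φ (e.symm i),
    fun i => law_nonneg _ _, by
      rw [Equiv.sum_comp e.symm (law P φ)]
      exact hφ.sum_law⟩
  have hp : ∀ i, law P φ i = p.1 (e i) := fun i => by simp [p]
  rw [HP_labelAlg hH hφ hφs e p hp, HP_labelAlg hH hψ hψs e p (h ▸ hp)]

theorem Lm_labelAlg_mem (m : SignedMeasure Ω) (hm0 : m Set.univ = 0) {B : Set Ω}
    (hB : MeasurableSet B) (h0 : 0 < P.real B) (h1 : P.real B < 1) :
    Lm P m (labelAlg fun x => x ∈ B) = m B * Real.logb 2 ((1 - P.real B) / P.real B) := by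
  have hc : m Bᶜ = - m B := by
    have h2 := SignedMeasure.isFinAdditive m B Bᶜ hB hB.compl disjoint_compl_right
    rw [Set.union_compl_self] at h2
    linarith
  have e1 : (fun x => x ∈ B) ⁻¹' {True} = B := by
    ext x
    simp
  have e2 : (fun x => x ∈ B) ⁻¹' {False} = Bᶜ := by
    ext x
    simp
  rw [Lm_labelAlg m (isLabelling_mem hB), Fintype.univ_Prop, Finset.sum_pair (by simp),
    law_mem_true, law_mem_false hB, e1, e2, hc, one_div, one_div,
    Real.logb_inv, Real.logb_inv, Real.logb_div (by linarith) h0.ne']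
  ring

theorem surjective_mem {B : Set Ω} (h0 : 0 < P.real B) (h1 : P.real B < 1) :
    Function.Surjective fun x => x ∈ B := by
  intro q
  by_cases hq : q
  · obtain ⟨x, hx⟩ : B.Nonempty := by
      by_contra h
      rw [Set.not_nonempty_iff_eq_empty] at h
      simp [h] at h0
    exact ⟨x, by simp [hx, hq]⟩
  · obtain ⟨x, hx⟩ : ∃ x, x ∉ B := by
      by_contra! h
      rw [Set.eq_univ_of_forall h, probReal_univ] at h1
      exact lt_irrefl _ h1
    exact ⟨x, by simp [hx, hq]⟩

/-- A signed measure that vanishes on `Ω` and takes equal values on events of equal probability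
`t ∉ {0, 1/2, 1}` is zero: it vanishes on events of probability `1 / N` for `N ≥ 3`, hence on those
of rational probability, hence everywhere. -/
theorem signedMeasure_eq_zero_of_congr (hP : IsNonatomic P) {m : SignedMeasure Ω}
    (hm : IsAbsCont P m) (hm0 : m Set.univ = 0)
    (h : ∀ B C, MeasurableSet B → MeasurableSet C → 0 < P.real B → P.real B < 1 →
      P.real B ≠ 1 / 2 → P.real B = P.real C → m B = m C) : m = 0 := by
  have hadd := SignedMeasure.isFinAdditive m
  have hcell : ∀ N : ℕ, ∀ B, MeasurableSet B → P.real B = 1 / ((N : ℝ) + 3) → m B = 0 := by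
    intro N B hB hPB
    obtain ⟨θ, hθ, hθl⟩ := hP.exists_labelling (κ := Fin (N + 3))
      (w := fun _ => 1 / ((N : ℝ) + 3)) (fun _ => by positivity) (by
        rw [Finset.sum_const, Finset.card_univ, Fintype.card_fin, nsmul_eq_mul]
        push_cast
        field_simp)
    have h1 : m Set.univ = ∑ k, m (Set.univ ∩ θ ⁻¹' {k}) :=
      hadd.sum_inter P hθ MeasurableSet.univ
    have h2 : ∀ k, m (Set.univ ∩ θ ⁻¹' {k}) = m B := by
      intro k
      rw [Set.univ_inter]
      refine (h B _ hB (hθ _) (hPB ▸ by positivity) ?_ ?_ ?_).symm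
      · rw [hPB, div_lt_one (by positivity)]
        linarith [(Nat.cast_nonneg N : (0 : ℝ) ≤ N)]
      · rw [hPB]
        refine ne_of_lt (one_div_lt_one_div_of_lt two_pos ?_)
        linarith [(Nat.cast_nonneg N : (0 : ℝ) ≤ N)]
      · exact hPB.trans (congrFun hθl k).symm
    rw [hm0, Finset.sum_congr rfl fun k _ => h2 k, Finset.sum_const, Finset.card_univ,
      Fintype.card_fin, nsmul_eq_mul] at h1
    exact (mul_eq_zero.1 h1.symm).resolve_left (by positivity)
  have hrat : ∀ N k : ℕ, ∀ B, MeasurableSet B → P.real B = k / ((N : ℝ) + 3) → m B = 0 := by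
    intro N k
    induction k with
    | zero =>
      intro B hB hPB
      exact hm.eq_zero hB (by simpa using hPB)
    | succ k ih =>
      intro B hB hPB
      push_cast at hPB
      have hN : (0 : ℝ) < N + 3 := by positivity
      obtain ⟨C, hC, hCB, hPC⟩ := hP.exists_real_eq hB (r := 1 / ((N : ℝ) + 3)) (by positivity) (by
        rw [hPB]
        gcongr
        linarith [(Nat.cast_nonneg k : (0 : ℝ) ≤ k)])
      have h1 := hadd C (B \ C) hC (hB.diff hC) disjoint_sdiff_self_right
      beta_reduce at h1
      rw [Set.union_sdiff_cancel hCB, hcell N C hC hPC, ih (B \ C) (hB.diff hC) (by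
        rw [measureReal_sdiff hCB hC, hPB, hPC]
        ring)] at h1
      simpa using h1
  refine VectorMeasure.ext fun A hA => ?_
  change m A = 0
  by_contra hne
  obtain ⟨δ, hδ, hsmall⟩ := hm |m A| (abs_pos.2 hne)
  obtain ⟨N, hN⟩ := exists_nat_one_div_lt hδ
  have hN3 : (0 : ℝ) < N + 3 := by positivity
  set k := ⌊((N : ℝ) + 3) * P.real A⌋₊ with hk
  have hA0 : 0 ≤ P.real A := measureReal_nonneg
  have hk1 : (k : ℝ) / (N + 3) ≤ P.real A := by
    rw [div_le_iff₀ hN3, mul_comm]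
    exact Nat.floor_le (by positivity)
  have hk2 : P.real A < (k : ℝ) / (N + 3) + 1 / (N + 3) := by
    rw [← add_div, lt_div_iff₀ hN3, mul_comm]
    exact Nat.lt_floor_add_one _
  obtain ⟨C, hC, hCA, hPC⟩ := hP.exists_real_eq hA (r := (k : ℝ) / (N + 3)) (by positivity) hk1
  have h1 := hadd C (A \ C) hC (hA.diff hC) disjoint_sdiff_self_right
  rw [Set.union_sdiff_cancel hCA] at h1
  beta_reduce at h1
  rw [hrat N k C hC hPC, zero_add] at h1
  have h3 := hsmall (A \ C) (hA.diff hC) (by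
    rw [measureReal_sdiff hCA hC, hPC]
    have : 1 / ((N : ℝ) + 3) ≤ 1 / (N + 1) := by
      gcongr
      norm_num
    linarith)
  rw [h1] at h3
  exact lt_irrefl _ h3

/-- The decomposition is unique: by comparing two events `B`, `C` of probability `t`, the
difference `m B - m C` is read off from the entropies of the algebras with the atoms `B`, `Bᶜ` and
`C`, `Cᶜ`, unless `t = 1 / 2`. -/
theorem decomposition_unique (hP : IsNonatomic P) {H₁ H₂ : (n : ℕ) → stdSimplex ℝ (Fin n) → ℝ}
    {m₁ m₂ : SignedMeasure Ω} (hH₁ : IsAdditiveEntropy H₁) (hH₂ : IsAdditiveEntropy H₂)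
    (hm₁ : IsAbsCont P m₁) (hm₂ : IsAbsCont P m₂) (h₁ : m₁ Set.univ = 0) (h₂ : m₂ Set.univ = 0)
    (h : ∀ 𝒜, HP P H₁ 𝒜 + Lm P m₁ 𝒜 = HP P H₂ 𝒜 + Lm P m₂ 𝒜) : H₁ = H₂ ∧ m₁ = m₂ := by
  have hm : m₁ - m₂ = 0 := by
    refine signedMeasure_eq_zero_of_congr hP (fun ε hε => ?_) ?_ ?_
    · obtain ⟨δ₁, hδ₁, h₁⟩ := hm₁ (ε / 2) (half_pos hε)
      obtain ⟨δ₂, hδ₂, h₂⟩ := hm₂ (ε / 2) (half_pos hε)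
      refine ⟨min δ₁ δ₂, lt_min hδ₁ hδ₂, fun A hA hPA => ?_⟩
      have e1 := h₁ A hA (hPA.trans_le (min_le_left _ _))
      have e2 := h₂ A hA (hPA.trans_le (min_le_right _ _))
      calc |(m₁ - m₂) A| = |m₁ A - m₂ A| := rfl
        _ ≤ |m₁ A| + |m₂ A| := abs_sub _ _
        _ < ε := by linarith
    · change m₁ Set.univ - m₂ Set.univ = 0
      rw [h₁, h₂, sub_zero]
    · intro B C hB hC hB0 hB1 hB2 hBC
      change m₁ B - m₂ B = m₁ C - m₂ C
      have hC0 : 0 < P.real C := hBC ▸ hB0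
      have hC1 : P.real C < 1 := hBC ▸ hB1
      have hlaw : law P (fun x => x ∈ B) = law P (fun x => x ∈ C) := by
        funext q
        by_cases hq : q
        · rw [eq_true hq, law_mem_true, law_mem_true, hBC]
        · rw [eq_false hq, law_mem_false hB, law_mem_false hC, hBC]
      have e1 := h (labelAlg fun x => x ∈ B)
      have e2 := h (labelAlg fun x => x ∈ C)
      rw [Lm_labelAlg_mem m₁ h₁ hB hB0 hB1, Lm_labelAlg_mem m₂ h₂ hB hB0 hB1,
        HP_labelAlg_congr hH₁ (isLabelling_mem hB) (isLabelling_mem hC) (surjective_mem hB0 hB1)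
          (surjective_mem hC0 hC1) hlaw,
        HP_labelAlg_congr hH₂ (isLabelling_mem hB) (isLabelling_mem hC) (surjective_mem hB0 hB1)
          (surjective_mem hC0 hC1) hlaw] at e1
      rw [Lm_labelAlg_mem m₁ h₁ hC hC0 hC1, Lm_labelAlg_mem m₂ h₂ hC hC0 hC1, ← hBC] at e2
      have hne : Real.logb 2 ((1 - P.real B) / P.real B) ≠ 0 := by
        refine Real.logb_ne_zero_of_pos_of_ne_one one_lt_two
          (div_pos (by linarith) hB0) fun h => hB2 ?_
        rw [div_eq_one_iff_eq hB0.ne'] at h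
        linarith
      refine mul_right_cancel₀ hne ?_
      linarith
  refine ⟨funext fun n => funext fun p => ?_, sub_eq_zero.1 hm⟩
  obtain ⟨φ, hφ, hlaw, hs⟩ := hP.exists_surjective_labelling (w := p.1) p.2.1 p.2.2
  have h3 := h (labelAlg φ)
  rw [sub_eq_zero.1 hm, HP_labelAlg hH₁ hφ hs (Equiv.refl _) p (congrFun hlaw),
    HP_labelAlg hH₂ hφ hs (Equiv.refl _) p (congrFun hlaw)] at h3
  linarith

end Uniqueness

/-! ### Continuity in the open domain -/

section Continuity

variable {Ω ι κ : Type*} [MeasurableSpace Ω] {P : Measure Ω} [IsProbabilityMeasure P]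
  {H : (n : ℕ) → stdSimplex ℝ (Fin n) → ℝ}

/-- A partition with law `p` can be changed into one with law `w` on an event of probability at most
`∑ |p i - w i|`: a part of probability `min (p i) (w i)` of every cell is kept. -/
theorem IsNonatomic.exists_near_labelling [Fintype ι] (hP : IsNonatomic P) {φ : Ω → ι}
    (hφ : IsLabelling φ) {w : ι → ℝ} (hw : ∀ i, 0 ≤ w i) (hw1 : ∑ i, w i = 1) :
    ∃ ψ : Ω → ι, IsLabelling ψ ∧ law P ψ = w ∧ ∃ Z, MeasurableSet Z ∧
      (∀ x, x ∉ Z → φ x = ψ x) ∧ P.real Z ≤ ∑ i, |law P φ i - w i| := by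
  classical
  have hne : (Finset.univ : Finset ι).Nonempty := by
    by_contra h
    rw [Finset.not_nonempty_iff_eq_empty] at h
    rw [h] at hw1
    simp at hw1
  have hS : ∀ i, ∃ S, MeasurableSet S ∧ S ⊆ φ ⁻¹' {i} ∧ P.real S = min (law P φ i) (w i) :=
    fun i => hP.exists_real_eq (hφ {i}) (le_min (law_nonneg _ _) (hw i)) (min_le_left _ _)
  choose S hSm hSφ hSP using hS
  have hUm : MeasurableSet (⋃ i, S i) := MeasurableSet.iUnion hSm
  have hSi : ∀ i, (⋃ k, S k) ∩ φ ⁻¹' {i} = S i := by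
    intro i
    ext x
    simp only [Set.mem_inter_iff, Set.mem_iUnion]
    constructor
    · rintro ⟨⟨k, hk⟩, hx⟩
      have : k = i := (hSφ k hk).symm.trans hx
      rwa [← this]
    · exact fun hx => ⟨⟨i, hx⟩, hSφ i hx⟩
  have hPU : P.real (⋃ i, S i) = ∑ i, min (law P φ i) (w i) := by
    rw [(measureReal_isFinAdditive P).sum_inter P hφ hUm]
    exact Finset.sum_congr rfl fun i _ => by rw [hSi, hSP]
  have hPZ : P.real (⋃ i, S i)ᶜ = 1 - ∑ i, min (law P φ i) (w i) := by
    rw [probReal_compl_eq_one_sub hUm, hPU]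
  obtain ⟨θ, hθ, -, hθZ⟩ := hP.exists_split Finset.univ hne (fun i => w i - min (law P φ i) (w i))
    (fun i => sub_nonneg.2 (min_le_right _ _)) (⋃ i, S i)ᶜ hUm.compl (by
      rw [hPZ, Finset.sum_sub_distrib, hw1])
  refine ⟨fun x => if x ∈ ⋃ i, S i then φ x else θ x, hφ.ite hθ hUm, funext fun i => ?_,
    (⋃ i, S i)ᶜ, hUm.compl, fun x hx => ?_, ?_⟩
  · have h1 : (fun x => if x ∈ ⋃ i, S i then φ x else θ x) ⁻¹' {i} =
        S i ∪ ((⋃ i, S i)ᶜ ∩ θ ⁻¹' {i}) := by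
      rw [← hSi i]
      ext x
      by_cases hx : x ∈ ⋃ i, S i
      · simp only [Set.mem_preimage, Set.mem_union, Set.mem_inter_iff, Set.mem_compl_iff, hx,
          if_true, not_true_eq_false, true_and, false_and, or_false]
      · simp only [Set.mem_preimage, Set.mem_union, Set.mem_inter_iff, Set.mem_compl_iff, hx,
          if_false, not_false_eq_true, true_and, false_and, false_or]
    unfold law
    rw [h1, measureReal_union _ (hUm.compl.inter (hθ _)), hθZ i (Finset.mem_univ i), hSP]
    · unfold law
      ring
    · exact Set.disjoint_left.2 fun x hx hx' => hx'.1 (Set.mem_iUnion.2 ⟨i, hx⟩)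
  · rw [Set.mem_compl_iff, not_not] at hx
    simp only [if_pos hx]
  · rw [hPZ, ← hφ.sum_law (P := P), ← Finset.sum_sub_distrib]
    refine Finset.sum_le_sum fun i _ => ?_
    rcases le_total (law P φ i) (w i) with h | h
    · rw [min_eq_left h, sub_self]
      exact abs_nonneg _
    · rw [min_eq_right h]
      exact le_abs_self _

/-- Labellings without null cells have equally many atoms of positive probability, so that only the
event on which they differ contributes to their distance. -/
theorem openDist_labelAlg_le {P : Measure Ω} [Finite ι] {φ ψ : Ω → ι}
    (hφ : IsLabelling φ) (hψ : IsLabelling ψ) (hφ0 : ∀ i, law P φ i ≠ 0) (hψ0 : ∀ i, law P ψ i ≠ 0)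
    {Z : Set Ω} (hZ : MeasurableSet Z)
    (h : ∀ x, x ∉ Z → φ x = ψ x) :
    FiniteSubalgebra.openDist P (labelAlg φ) (labelAlg ψ) ≤ P.real Z := by
  have hne : ∀ {χ : Ω → ι}, (∀ i, law P χ i ≠ 0) → ∀ i, P (χ ⁻¹' {i}) ≠ 0 := fun h i h0 =>
    h i (by rw [law, measureReal_def, h0, ENNReal.toReal_zero])
  unfold FiniteSubalgebra.openDist
  rw [numAtoms_labelAlg hφ (hne hφ0), numAtoms_labelAlg hψ (hne hψ0), sub_self, abs_zero, add_zero]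
  refine csInf_le ⟨0, ?_⟩ ⟨Z, hZ, ?_, rfl⟩
  · rintro _ ⟨Z, -, -, rfl⟩
    exact measureReal_nonneg
  · have h1 : ∀ s, φ ⁻¹' s ∩ Zᶜ = ψ ⁻¹' s ∩ Zᶜ := by
      intro s
      ext x
      simp only [Set.mem_inter_iff, Set.mem_preimage, Set.mem_compl_iff, and_congr_left_iff]
      intro hx
      rw [h x hx]
    unfold FiniteSubalgebra.trace
    ext A
    constructor
    · rintro ⟨B, hB, rfl⟩
      obtain ⟨s, rfl⟩ := (mem_labelAlg hφ).1 hB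
      exact ⟨_, (mem_labelAlg hψ).2 ⟨s, rfl⟩, (h1 s).symm⟩
    · rintro ⟨B, hB, rfl⟩
      obtain ⟨s, rfl⟩ := (mem_labelAlg hψ).1 hB
      exact ⟨_, (mem_labelAlg hφ).2 ⟨s, rfl⟩, h1 s⟩

theorem surjective_of_law_ne_zero {P : Measure Ω} {φ : Ω → ι} (h : ∀ i, law P φ i ≠ 0) :
    Function.Surjective φ := by
  intro i
  by_contra! hi
  refine h i ?_
  have : φ ⁻¹' {i} = ∅ := Set.eq_empty_of_forall_notMem fun x hx => hi x hx
  rw [law, this, measureReal_empty]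

/-- Nearby laws are realized by nearby partitions, at which `H_P` takes nearby values. -/
theorem isContinuousOpenSimplex_of_HP (hP : IsNonatomic P) (hH : IsAdditiveEntropy H)
    (hc : IsContinuousEntropy P (HP P H)) : IsContinuousOpenSimplex H := by
  intro n p hp
  obtain ⟨φ, hφ, hφlaw⟩ := hP.exists_labelling (w := p.1) p.2.1 p.2.2
  have hφ0 : ∀ i, law P φ i ≠ 0 := fun i => hφlaw ▸ (hp i).ne'
  rw [Metric.continuousWithinAt_iff]
  intro ε hε
  obtain ⟨δ, hδ, h⟩ := hc (labelAlg φ) ε hε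
  refine ⟨δ / (n + 1), by positivity, fun {w} hw hwp => ?_⟩
  obtain ⟨ψ, hψ, hψlaw, Z, hZ, hZeq, hPZ⟩ := hP.exists_near_labelling hφ w.2.1 w.2.2
  have hψ0 : ∀ i, law P ψ i ≠ 0 := fun i => hψlaw ▸ (hw i).ne'
  have hsum : ∑ i, |law P φ i - w.1 i| < δ := by
    calc ∑ i, |law P φ i - w.1 i| ≤ ∑ _i : Fin n, δ / ((n : ℝ) + 1) := by
          refine Finset.sum_le_sum fun i _ => ?_
          rw [hφlaw, abs_sub_comm, ← Real.dist_eq]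
          exact (dist_le_pi_dist w.1 p.1 i).trans hwp.le
      _ = n * (δ / ((n : ℝ) + 1)) := by simp
      _ < ((n : ℝ) + 1) * (δ / ((n : ℝ) + 1)) := by
          gcongr
          linarith
      _ = δ := by field_simp
  have h1 := h (labelAlg ψ)
    ((openDist_labelAlg_le hφ hψ hφ0 hψ0 hZ hZeq).trans_lt (hPZ.trans_lt hsum))
  rw [HP_labelAlg hH hφ (surjective_of_law_ne_zero hφ0) (Equiv.refl _) p (congrFun hφlaw),
    HP_labelAlg hH hψ (surjective_of_law_ne_zero hψ0) (Equiv.refl _) w (congrFun hψlaw)] at h1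
  exact h1

end Continuity

theorem mainTheorem2 {Ω : Type*} [MeasurableSpace Ω] (P : Measure Ω) [IsProbabilityMeasure P]
    (hP : IsNonatomic P) (I : FiniteSubalgebra Ω → ℝ)
    (hI : IsAdditivePartitionEntropy P I) (hIcont : IsContinuousOnTwoAtom P I) :
    (∃! d : ((n : ℕ) → stdSimplex ℝ (Fin n) → ℝ) × SignedMeasure Ω,
      IsAdditiveEntropy d.1 ∧ IsAbsCont P d.2 ∧ d.2 Set.univ = 0 ∧
        ∀ 𝒜 : FiniteSubalgebra Ω, I 𝒜 = HP P d.1 𝒜 + Lm P d.2 𝒜) ∧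
    (∀ (H : (n : ℕ) → stdSimplex ℝ (Fin n) → ℝ) (m : SignedMeasure Ω),
      IsAdditiveEntropy H → IsAbsCont P m →
      (∀ 𝒜 : FiniteSubalgebra Ω, I 𝒜 = HP P H 𝒜 + Lm P m 𝒜) →
        IsAdditivePartitionEntropy P (HP P H) ∧ IsAdditivePartitionEntropy P (Lm P m) ∧
        IsContinuousEntropy P (Lm P m) ∧
        (IsContinuousEntropy P I →
          IsContinuousEntropy P (HP P H) ∧ IsContinuousOpenSimplex H)) := by
  refine ⟨?_, fun H m hH hm hdec => ?_⟩
  · obtain ⟨m, hm, hm0, hadd, hswap⟩ := exists_isSwapInvariant_sub_Lm hP hI hIcont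
    obtain ⟨H, hH, hJ⟩ := hswap.exists_additiveEntropy hP hadd
    have hdec : ∀ 𝒜, I 𝒜 = HP P H 𝒜 + Lm P m 𝒜 := fun 𝒜 => by
      rw [← hJ 𝒜, sub_add_cancel]
    refine ⟨(H, m), ⟨hH, hm, hm0, hdec⟩, fun d hd => ?_⟩
    obtain ⟨h1, h2⟩ := decomposition_unique hP hd.1 hH hd.2.1 hm hd.2.2.1 hm0
      fun 𝒜 => (hd.2.2.2 𝒜).symm.trans (hdec 𝒜)
    exact Prod.ext h1 h2
  · have hLadd : IsAdditivePartitionEntropy P (Lm P m) := isAdditivePartitionEntropy_Lm hm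
    have hLcont : IsContinuousEntropy P (Lm P m) := isContinuousEntropy_Lm hm
    refine ⟨fun 𝒜 ℬ hind => ?_, hLadd, hLcont, fun hIc => ?_⟩
    · have h1 := hI 𝒜 ℬ hind
      rw [hdec, hdec, hdec, hLadd 𝒜 ℬ hind] at h1
      linarith
    · have hHc : IsContinuousEntropy P (HP P H) := by
        intro 𝒜 ε hε
        obtain ⟨δ₁, hδ₁, h₁⟩ := hIc 𝒜 (ε / 2) (half_pos hε)
        obtain ⟨δ₂, hδ₂, h₂⟩ := hLcont 𝒜 (ε / 2) (half_pos hε)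
        refine ⟨min δ₁ δ₂, lt_min hδ₁ hδ₂, fun ℬ hℬ => ?_⟩
        have e1 := abs_lt.1 (h₁ ℬ (hℬ.trans_le (min_le_left _ _)))
        have e2 := abs_lt.1 (h₂ ℬ (hℬ.trans_le (min_le_right _ _)))
        rw [hdec, hdec] at e1
        rw [abs_lt]
        constructor <;> linarith
      exact ⟨hHc, isContinuousOpenSimplex_of_HP hP hH hHc⟩
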